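/- **Notation.** Let $\mathbb{H}$ be the upper half-plane, $z=x+iy\in\mathbb{H}$, $q=e^{2\pi i z}$. For a Dirichlet character $\chi$ mod $N$ let $\chi^0$ be the primitive character inducing $\chi$, $m_\chi$ its conductor, $\ell_\chi=N/m_\chi$, $W(\chi^0)=\sum_{n=1}^{m_\chi}\chi^0(n)e^{2\pi i n/m_\chi}$, and let $L(s,\chi)$ be the (analytically continued) Dirichlet $L$-function of $\chi$ as a character mod $N$. Let $\mathbf 1_N$ be the trivial character mod $N$ and $\gamma$ Euler's constant. For $\kappa\in\mathbb{Z}$ put $\xi_\kappa=2iy^\kappa\,\overline{\partial_{\bar z}}$ and $\Delta_\kappa=y^2(\partial_x^2+\partial_y^2)-i\kappa y(\partial_x+i\partial_y)$. Let $H_\kappa(N,\chi)$ be the space of real-analytic $F:\mathbb{H}\to\mathbb{C}$ with $F(\frac{az+b}{cz+d})=\chi(d)(cz+d)^\kappa F(z)$ for all $\begin{pmatrix}a&b\\c&d\end{pmatrix}\in\Gamma_0(N)$, with $\Delta_\kappa F=0$, with at most linear exponential growth at all cusps, and with $\xi_\kappa F$ holomorphic at all cusps (in weight $2-\kappa$).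 Put $\beta_\kappa(n,y)=\int_y^\infty e^{-4\pi n u}u^{-\kappa}\,du$ for $n>0$, $\beta_\kappa(0,y)=(\kappa-1)^{-1}y^{1-\kappa}$ if $\kappa\ne1$, and $\beta_1(0,y)=-\log y$. A series $\sum_{n\ge n_0}c^+(n)q^n$ is a *mock modular form of weight $\kappa$, level $N$ and character $\chi$ with shadow $g$* if there is $F\in H_\kappa(N,\chi)$ with $\xi_\kappa F=g$ and with a Fourier expansion $$F(z)=\sum_{n\ge n_0}c^+(n)q^n-\sum_{n\ge0}\overline{c(n)}\,\beta_\kappa(n,y)q^{-n}.$$ Let $L,M,t\ge1$ be integers and let $\psi$ mod $L$, $\varrho$ mod $M$ be Dirichlet characters with $\psi(-1)\varrho(-1)=-1$. For $n\geq 1$ put $$\sigma_0^{\psi,\varrho}(n)=\sum_{0<c\mid n}\psi\!\left(\tfrac nc\right)\sum_{0<d\mid\gcd(\ell_\varrho,c)}d\,\mu\!\left(\tfrac{\ell_\varrho}{d}\right)\overline{\varrho^0}\!\left(\tfrac{\ell_\varrho}{d}\right)\varrho^0\!\left(\tfrac cd\right),$$ and $\sigma_0^{\psi,\varrho}(x)=0$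 if $x$ is not a positive integer. Let $C=L(1,\overline\varrho)$ if $\psi=\mathbf 1_1$ and $C=0$ otherwise; let $D=-\pi i\,L(0,\psi)\prod_{p\mid M}(1-p^{-1})$ if $\varrho=\mathbf 1_M$ and $D=0$ otherwise; and let $$E_1^{\psi,\varrho,t}(z)=C+D-\frac{2\pi i}{M}W(\overline{\varrho^0})\sum_{n=1}^\infty\sigma_0^{\psi,\varrho}(n)q^{tn}.$$ **Theorem.** Put $$c_1^+(0,t,\psi,\varrho)=\begin{cases}2L'(1,\varrho),&\psi=\mathbf 1_1,\\ 2\pi i\big(\log(2tM)L(0,\overline\psi)-L'(0,\overline\psi)\big)\prod_{p\mid M}(1-p^{-1}),&\varrho=\mathbf 1_M,\\ 0,&\text{otherwise,}\end{cases}$$ and for $n>0$ $$\begin{aligned}c_1^+(n,t,\psi,\varrho)=-\frac{2\pi i}{M}W(\varrho^0)\Big(&\sigma_0^{\overline\psi,\overline\varrho}\!\left(\tfrac nt\right)\big(\log\tfrac{\pi}{M^2}+\gamma-\log n\big)\\&+2\sum_{0<c\mid\frac nt}\overline\psi\!\left(\tfrac n{tc}\right)\log(c)\sum_{0<d\mid\gcd(\ell_\varrho,c)}d\,\mu\!\left(\tfrac{\ell_\varrho}d\right)\varrho^0\!\left(\tfrac{\ell_\varrho}d\right)\overline{\varrho^0}\!\left(\tfrac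 cd\right)\Big),\end{aligned}$$ where the last sum is zero if $t\nmid n$. Then the series $$G_1^{\psi,\varrho,t}(z)=\sum_{n=0}^\infty c_1^+(n,t,\psi,\varrho)q^n$$ converges on $\mathbb{H}$ and is a mock modular form of weight $1$, level $tLM$ and character $\overline{\psi\varrho}$ with shadow $E_1^{\psi,\varrho,t}$. -/

import Mathlib

open scoped ComplexConjugate UpperHalfPlane ModularForm MatrixGroups

noncomputable section

namespace MockModular

/-! ### Harmonic Maass forms and mock modular forms of integral weight -/

/-- The extension of a function on the upper half-plane to `ℂ` used for differentiation; only its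
values on the open set `0 < Im z` matter. -/
def ext (F : ℍ → ℂ) : ℂ → ℂ := fun z => F (UpperHalfPlane.ofComplex z)

/-- `∂/∂x`, for `z = x + iy`. -/
def partialX (f : ℂ → ℂ) (z : ℂ) : ℂ := fderiv ℝ f z 1

/-- `∂/∂y`, for `z = x + iy`. -/
def partialY (f : ℂ → ℂ) (z : ℂ) : ℂ := fderiv ℝ f z Complex.I

/-- `∂/∂z̄ = (∂/∂x + i ∂/∂y) / 2`. -/
def partialZBar (f : ℂ → ℂ) (z : ℂ) : ℂ :=
  (partialX f z + Complex.I * partialY f z) / 2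

/-- The weight `k` hyperbolic Laplacian
`y² (∂²/∂x² + ∂²/∂y²) - i k y (∂/∂x + i ∂/∂y)`. -/
def hypLaplacian (k : ℤ) (F : ℍ → ℂ) (z : ℍ) : ℂ :=
  (z.im : ℂ) ^ 2 *
      (partialX (partialX (ext F)) z + partialY (partialY (ext F)) z)
    - Complex.I * (k : ℂ) * (z.im : ℂ) *
      (partialX (ext F) z + Complex.I * partialY (ext F) z)

/-- The operator `ξ_k F = 2 i y^k · conj (∂F/∂z̄)`. -/
def xi (k : ℤ) (F : ℍ → ℂ) (z : ℍ) : ℂ :=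
  2 * Complex.I * (z.im : ℂ) ^ k * conj (partialZBar (ext F) z)

/-- Weakly harmonic Maass forms of weight `k`, level `N` and character `χ`. Every cusp is
`γ ∞` with `γ ∈ SL(2, ℤ)`, and the behaviour there is that of `F ∣[k] γ` as `Im z → ∞`,
uniformly in `Re z`. -/
structure IsWeaklyHarmonicMaassForm (k : ℤ) (N : ℕ) (χ : DirichletCharacter ℂ N)
    (F : ℍ → ℂ) : Prop where
  analytic : AnalyticOnNhd ℝ (ext F) {z : ℂ | 0 < z.im}
  transform : ∀ γ ∈ CongruenceSubgroup.Gamma0 N, ∀ z : ℍ,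
    F (γ • z) = χ ((γ 1 1 : ℤ) : ZMod N) * ((γ 1 0 : ℂ) * z + (γ 1 1 : ℂ)) ^ k * F z
  harmonic : ∀ z : ℍ, hypLaplacian k F z = 0
  growth : ∀ γ : SL(2, ℤ), ∃ C : ℝ,
    (F ∣[k] γ) =O[UpperHalfPlane.atImInfty] fun z : ℍ => Real.exp (C * z.im)

/-- The space `H_k(N, χ)`: weakly harmonic Maass forms whose image under `ξ_k` (a form of
weight `2 - k`) is holomorphic at every cusp. -/
structure IsHarmonicMaassForm (k : ℤ) (N : ℕ) (χ : DirichletCharacter ℂ N)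
    (F : ℍ → ℂ) : Prop extends IsWeaklyHarmonicMaassForm k N χ F where
  xi_bounded : ∀ γ : SL(2, ℤ),
    UpperHalfPlane.IsBoundedAtImInfty ((xi k F) ∣[(2 - k : ℤ)] γ)

/-- `q = e^{2 π i z}`. -/
def q (z : ℂ) : ℂ := Complex.exp (2 * Real.pi * Complex.I * z)

/-- The functions `β_κ(n, y)` in the non-holomorphic part of a harmonic Maass form of
weight `κ`: `∫_y^∞ e^{-4πnu} u^{-κ} du` for `n > 0`, and for `n = 0` either
`(κ - 1)⁻¹ y^{1 - κ}` or, in weight `κ = 1`, `- log y`. -/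
def beta (κ : ℤ) (n : ℕ) (y : ℝ) : ℝ :=
  if n = 0 then
    if κ = 1 then -Real.log y else ((κ : ℝ) - 1)⁻¹ * y ^ (1 - κ)
  else
    ∫ u in Set.Ioi y, Real.exp (-(4 * Real.pi * n * u)) * u ^ (-κ)

/-- `G` is a mock modular form of weight `κ`, level `N` and character `χ` with shadow `g`:
there is `F ∈ H_κ(N, χ)` with `ξ_κ F = g` and with Fourier expansion
`F = ∑_{n ≥ n₀} c⁺(n) q^n - ∑_{n ≥ 0} conj (c(n)) β_κ(n, y) q^{-n}`,
where `G = ∑_{n ≥ n₀} c⁺(n) q^n`. -/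
def IsMockModularForm (κ : ℤ) (N : ℕ) (χ : DirichletCharacter ℂ N) (G g : ℍ → ℂ) : Prop :=
  ∃ F : ℍ → ℂ, IsHarmonicMaassForm κ N χ F ∧ xi κ F = g ∧
    ∃ (cplus : ℤ → ℂ) (c : ℕ → ℂ),
      (∃ n₀ : ℤ, ∀ n < n₀, cplus n = 0) ∧
      (∀ z : ℍ, HasSum (fun n : ℤ => cplus n * q z ^ n) (G z)) ∧
      ∀ z : ℍ, HasSum
        (fun n : ℕ => conj (c n) * (beta κ n z.im : ℂ) * q z ^ (-(n : ℤ))) (G z - F z)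

/-! ### Dirichlet characters, Gauss sums and twisted divisor sums -/

/-- The product of the characters `ψ` mod `L` and `ϱ` mod `M`, as a character mod `tLM`. -/
def prodChar {L M : ℕ} (ψ : DirichletCharacter ℂ L) (ϱ : DirichletCharacter ℂ M) (t : ℕ) :
    DirichletCharacter ℂ (t * L * M) :=
  DirichletCharacter.changeLevel (Dvd.intro_left t rfl |>.mul_right M) ψ *
    DirichletCharacter.changeLevel (Dvd.intro_left (t * L) rfl) ϱ

/-- The sum `W(χ) = ∑_{n=1}^{m} χ(n) e^{2 π i n / m}`, used for primitive `χ` mod `m`. -/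
def gaussW {m : ℕ} (χ : DirichletCharacter ℂ m) : ℂ :=
  ∑ n ∈ Finset.Icc 1 m, χ (n : ZMod m) * Complex.exp (2 * Real.pi * Complex.I * n / m)

/-- `ℓ_ϱ = M / m_ϱ`, where `m_ϱ` is the conductor of `ϱ`. -/
def ell {M : ℕ} (ϱ : DirichletCharacter ℂ M) : ℕ := M / ϱ.conductor

/-- The inner sum
`∑_{0 < d ∣ gcd(ℓ_ϱ, c)} d μ(ℓ_ϱ / d) conj (ϱ⁰(ℓ_ϱ / d)) ϱ⁰(c / d)`,
with `ϱ⁰` the primitive character inducing `ϱ`. -/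
def innerSum {M : ℕ} (ϱ : DirichletCharacter ℂ M) (c : ℕ) : ℂ :=
  ∑ d ∈ (Nat.gcd (ell ϱ) c).divisors,
    (d : ℂ) * (ArithmeticFunction.moebius (ell ϱ / d) : ℂ) *
      conj (ϱ.primitiveCharacter ((ell ϱ / d : ℕ) : ZMod ϱ.conductor)) *
      ϱ.primitiveCharacter ((c / d : ℕ) : ZMod ϱ.conductor)

/-- `σ_0^{ψ,ϱ}(n)`, for a positive integer `n`. -/
def sigmaZero {L M : ℕ} (ψ : DirichletCharacter ℂ L) (ϱ : DirichletCharacter ℂ M)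
    (n : ℕ) : ℂ :=
  ∑ c ∈ n.divisors, ψ ((n / c : ℕ) : ZMod L) * innerSum ϱ c

/-- The same sum with the additional weight `log c`. -/
def sigmaLog {L M : ℕ} (ψ : DirichletCharacter ℂ L) (ϱ : DirichletCharacter ℂ M)
    (n : ℕ) : ℂ :=
  ∑ c ∈ n.divisors, ψ ((n / c : ℕ) : ZMod L) * (Real.log c : ℂ) * innerSum ϱ c

/-- `∏_{p ∣ M} (1 - p⁻¹)`. -/
def eulerProd (M : ℕ) : ℂ := ∏ p ∈ M.primeFactors, (1 - (p : ℂ)⁻¹)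

/-! ### The weight one Eisenstein series and the candidate mock modular form -/

/-- `C_1(ψ, ϱ)`; note that `ψ = 𝟏_1` just means `L = 1`. -/
def constC {L M : ℕ} [NeZero M] (_ψ : DirichletCharacter ℂ L)
    (ϱ : DirichletCharacter ℂ M) : ℂ :=
  if L = 1 then DirichletCharacter.LFunction (star ϱ) 1 else 0

open Classical in
/-- `D(ψ, ϱ)`. -/
def constD {L M : ℕ} [NeZero L] (ψ : DirichletCharacter ℂ L)
    (ϱ : DirichletCharacter ℂ M) : ℂ :=
  if ϱ = 1 then
    -(Real.pi * Complex.I) * DirichletCharacter.LFunction ψ 0 * eulerProd M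
  else 0

/-- The Eisenstein series `E_1^{ψ,ϱ}(z)`, for `Im z > 0`. -/
def eisensteinOne {L M : ℕ} [NeZero L] [NeZero M] (ψ : DirichletCharacter ℂ L)
    (ϱ : DirichletCharacter ℂ M) (z : ℂ) : ℂ :=
  constC ψ ϱ + constD ψ ϱ -
    2 * Real.pi * Complex.I / M * gaussW (star ϱ.primitiveCharacter) *
      ∑' n : ℕ, sigmaZero ψ ϱ (n + 1) * q z ^ (n + 1)

/-- `E_1^{ψ,ϱ,t}(z) = E_1^{ψ,ϱ}(tz)`. -/
def eisensteinOneT {L M : ℕ} [NeZero L] [NeZero M] (ψ : DirichletCharacter ℂ L)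
    (ϱ : DirichletCharacter ℂ M) (t : ℕ) (z : ℍ) : ℂ :=
  eisensteinOne ψ ϱ (t * (z : ℂ))

open Classical in
/-- The coefficients `c_1^+(n, t, ψ, ϱ)`. For `n > 0` both divisor sums vanish
unless `t ∣ n`. -/
def cOnePlus {L M : ℕ} [NeZero L] [NeZero M] (ψ : DirichletCharacter ℂ L)
    (ϱ : DirichletCharacter ℂ M) (t n : ℕ) : ℂ :=
  if n = 0 then
    if L = 1 then 2 * deriv (DirichletCharacter.LFunction ϱ) 1
    else if ϱ = 1 then
      2 * Real.pi * Complex.I *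
        ((Real.log (2 * t * M) : ℂ) * DirichletCharacter.LFunction (star ψ) 0 -
          deriv (DirichletCharacter.LFunction (star ψ)) 0) * eulerProd M
    else 0
  else if t ∣ n then
    -(2 * Real.pi * Complex.I / M) * gaussW ϱ.primitiveCharacter *
      (sigmaZero (star ψ) (star ϱ) (n / t) *
          ((Real.log (Real.pi / M ^ 2) + Real.eulerMascheroniConstant - Real.log n : ℝ) : ℂ) +
        2 * sigmaLog (star ψ) (star ϱ) (n / t))
  else 0

/-- `G_1^{ψ,ϱ,t}(z) = ∑_{n ≥ 0} c_1^+(n, t, ψ, ϱ) q^n`. -/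
def mockG {L M : ℕ} [NeZero L] [NeZero M] (ψ : DirichletCharacter ℂ L)
    (ϱ : DirichletCharacter ℂ M) (t : ℕ) (z : ℍ) : ℂ :=
  ∑' n : ℕ, cOnePlus ψ ϱ t n * q z ^ n

end MockModular

end

/-! For an odd function `f` on ℤ², periodic in each variable, consider the theta series Θ_f(τ, z) =
∑ f(m,n) (m z̄ + n) e^{-πτ|mz+n|²} and its integral over τ > 0 against the weight a + b log(yτ).
Under z ↦ γz the theta series acquires the factor 1/j̄, with j = cz + d, and τ becomes τ/|j|². The
product yτ is compatible with this change and dτ contributes |j|², so the integral has weight 1,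
with `f` replaced by its translate under γ (`thetaLift_smul`). Formally, b = 0 gives (a/π) ∑
f(m,n)/(mz+n), an Eisenstein series, and the logarithm inserts the derivative in Hecke's parameter
s. Integrating the theta series avoids both conditional convergence and analytic continuation in s.

Poisson summation in n turns the integrand into terms indexed by a row m > 0 and a frequency ξ
(`latticeTheta_eq`). After τ = (ν/A)e^{2u}, with A = my and ν = |ξ|/N, the kernel is even in u for ξ
> 0 and odd for ξ < 0, while the logarithm is a constant plus 2u. Hence positive frequencies yield
q-powers with logarithmic coefficients, and negative frequencies yield only b times an exponential
integral (`integral_weighted_besselKernel`, `integral_weighted_besselKernel_neg`). Row 0 and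
frequency 0 give Mellin transforms of one-variable theta series, which are the values and
derivatives of L-functions at 1 and 0.

Take f(m,n) = ψ̄(m/(tM)) ϱ(n), supported on tM ∣ m. The pair b = π/2, a = (π/2)(log π + γ), with γ
here Euler's constant, produces the coefficients `cOnePlus` and, in the nonholomorphic part, the
conjugated coefficients of the Eisenstein series (`hasSum_cOnePlus`). The Eisenstein series is
itself the integral with b = 0 and a = π/2 for ψ and the conjugate of ϱ (`hasSum_shadowCoeff`).
Applying ∂/∂z̄ termwise identifies it with the image under ξ, and its holomorphy gives harmonicity
(`analytic_harmonic_xi`). Every translate of `f` has the same kind of expansion, so growth at all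
cusps follows from one estimate at ∞: at most logarithmic in general, bounded when b = 0
(`exists_norm_thetaLift_le`). -/

namespace MockModular

open Real MeasureTheory Set Filter Topology

/-! ### Exponential and hyperbolic changes of variable -/

section Substitutions

variable {E : Type*} [NormedAddCommGroup E] [NormedSpace ℝ E]

lemma image_mul_exp_two_mul {c : ℝ} (hc : 0 < c) :
    (fun u : ℝ => c * exp (2 * u)) '' univ = Ioi 0 := by
  ext x
  simp only [image_univ, mem_range, mem_Ioi]
  constructor
  · rintro ⟨u, rfl⟩
    positivity
  · intro hx
    refine ⟨log (x / c) / 2, ?_⟩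
    rw [mul_div_cancel₀ _ two_ne_zero, exp_log (by positivity)]
    field_simp

lemma hasDerivAt_mul_exp_two_mul (c u : ℝ) :
    HasDerivAt (fun u : ℝ => c * exp (2 * u)) (2 * c * exp (2 * u)) u := by
  have h := (((hasDerivAt_id u).const_mul 2).exp).const_mul c
  refine h.congr_deriv ?_
  simp only [id]
  ring

lemma injective_mul_exp_two_mul {c : ℝ} (hc : 0 < c) :
    Function.Injective (fun u : ℝ => c * exp (2 * u)) := by
  intro u v h
  have := exp_injective (mul_left_cancel₀ hc.ne' h)
  linarith

lemma integral_Ioi_comp_exp {c : ℝ} (hc : 0 < c) (g : ℝ → E) :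
    ∫ x in Ioi (0 : ℝ), g x = ∫ u : ℝ, (2 * c * exp (2 * u)) • g (c * exp (2 * u)) := by
  rw [← image_mul_exp_two_mul hc, integral_image_eq_integral_abs_deriv_smul MeasurableSet.univ
    (fun u _ => (hasDerivAt_mul_exp_two_mul c u).hasDerivWithinAt)
    (injective_mul_exp_two_mul hc).injOn, setIntegral_univ]
  refine integral_congr_ae (Eventually.of_forall fun u => ?_)
  simp only
  rw [abs_of_pos (by positivity)]

lemma integrableOn_Ioi_comp_exp {c : ℝ} (hc : 0 < c) (g : ℝ → E) :
    IntegrableOn g (Ioi 0) ↔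
      Integrable fun u : ℝ => (2 * c * exp (2 * u)) • g (c * exp (2 * u)) := by
  rw [← image_mul_exp_two_mul hc, integrableOn_image_iff_integrableOn_abs_deriv_smul
    MeasurableSet.univ (fun u _ => (hasDerivAt_mul_exp_two_mul c u).hasDerivWithinAt)
    (injective_mul_exp_two_mul hc).injOn, integrableOn_univ]
  refine integrable_congr (Eventually.of_forall fun u => ?_)
  simp only
  rw [abs_of_pos (by positivity)]

lemma integral_comp_sinh (g : ℝ → E) : ∫ u : ℝ, cosh u • g (sinh u) = ∫ x, g x := by
  rw [← setIntegral_univ (f := g), ← sinh_surjective.range_eq, ← image_univ,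
    integral_image_eq_integral_abs_deriv_smul MeasurableSet.univ
    (fun u _ => (hasDerivAt_sinh u).hasDerivWithinAt) sinh_injective.injOn, setIntegral_univ]
  simp_rw [abs_of_pos (cosh_pos _)]

lemma integrable_comp_sinh (g : ℝ → E) :
    Integrable (fun u : ℝ => cosh u • g (sinh u)) ↔ Integrable g := by
  rw [← integrableOn_univ (f := g), ← sinh_surjective.range_eq, ← image_univ,
    integrableOn_image_iff_integrableOn_abs_deriv_smul MeasurableSet.univ
    (fun u _ => (hasDerivAt_sinh u).hasDerivWithinAt) sinh_injective.injOn, integrableOn_univ]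
  simp_rw [abs_of_pos (cosh_pos _)]

end Substitutions

/-! ### The exponential integral as a hyperbolic Gaussian integral -/

section HyperbolicGaussians

lemma abs_le_cosh (u : ℝ) : |u| ≤ cosh u := by
  have h1 : |u| ≤ sinh |u| := self_le_sinh_iff.2 (abs_nonneg u)
  exact h1.trans ((sinh_lt_cosh _).le.trans (cosh_abs u).le)

lemma abs_sinh_le_cosh (u : ℝ) : |sinh u| ≤ cosh u :=
  abs_le_of_sq_le_sq (by rw [cosh_sq]; linarith) (cosh_pos u).le

lemma integrable_cosh_mul_exp_sinh_sq {ε : ℝ} (hε : 0 < ε) :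
    Integrable fun u : ℝ => cosh u * exp (-ε * sinh u ^ 2) := by
  simpa using (integrable_comp_sinh (fun x : ℝ => exp (-ε * x ^ 2))).2 (integrable_exp_neg_mul_sq hε)

lemma integral_cosh_mul_exp_sinh_sq (ε : ℝ) :
    ∫ u : ℝ, cosh u * exp (-ε * sinh u ^ 2) = √(π / ε) := by
  rw [← integral_gaussian, ← integral_comp_sinh (fun x => exp (-ε * x ^ 2))]
  rfl

lemma cosh_pow_mul_exp_le {δ : ℝ} (hδ : 0 < δ) (k : ℕ) (u : ℝ) :
    cosh u ^ k * exp (-δ * cosh u ^ 2) ≤ k.factorial / δ ^ k := by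
  have h1 : 1 ≤ cosh u := one_le_cosh u
  have h2 : (δ * cosh u ^ 2) ^ k / k.factorial ≤ exp (δ * cosh u ^ 2) :=
    pow_div_factorial_le_exp _ (by positivity) k
  have h3 : cosh u ^ k ≤ (cosh u ^ 2) ^ k := by
    rw [← pow_mul]
    exact pow_le_pow_right₀ h1 (by omega)
  rw [neg_mul, exp_neg, ← div_eq_mul_inv, div_le_div_iff₀ (exp_pos _) (by positivity)]
  rw [div_le_iff₀ (by positivity), mul_pow] at h2
  calc cosh u ^ k * δ ^ k ≤ (cosh u ^ 2) ^ k * δ ^ k := by gcongr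
    _ = δ ^ k * (cosh u ^ 2) ^ k := mul_comm _ _
    _ ≤ _ := by rw [mul_comm]; linarith

/-- Half of the exponent absorbs cosh^k. The other half dominates a Gaussian in sinh u, which
together with the remaining factor cosh u is an ordinary Gaussian in x = sinh u. -/
lemma integrable_of_le_cosh_pow {ε : ℝ} (hε : 0 < ε) (k : ℕ) {g : ℝ → ℝ} (hg : Continuous g)
    (hle : ∀ u, |g u| ≤ cosh u ^ (k + 1) * exp (-ε * cosh u ^ 2)) : Integrable g := by
  refine ((integrable_cosh_mul_exp_sinh_sq (half_pos hε)).const_mul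
    (k.factorial / (ε / 2) ^ k)).mono' hg.aestronglyMeasurable (Eventually.of_forall fun u => ?_)
  rw [norm_eq_abs]
  refine (hle u).trans ?_
  have h1 := cosh_pow_mul_exp_le (half_pos hε) k u
  have h2 : exp (-ε * cosh u ^ 2) ≤ exp (-(ε / 2) * cosh u ^ 2) * exp (-(ε / 2) * sinh u ^ 2) := by
    rw [← exp_add, exp_le_exp, cosh_sq]
    nlinarith
  calc cosh u ^ (k + 1) * exp (-ε * cosh u ^ 2)
      ≤ cosh u ^ (k + 1) * (exp (-(ε / 2) * cosh u ^ 2) * exp (-(ε / 2) * sinh u ^ 2)) := by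
        have := cosh_pos u
        gcongr
    _ = (cosh u ^ k * exp (-(ε / 2) * cosh u ^ 2)) * (cosh u * exp (-(ε / 2) * sinh u ^ 2)) := by
        ring
    _ ≤ _ := by
        have := cosh_pos u
        gcongr

/-- The integral `∫ u sinh u e^{-4πB cosh² u} du`, an exponential integral up to a factor. -/
noncomputable def sinhIntegral (B : ℝ) : ℝ := ∫ u : ℝ, u * sinh u * exp (-(4 * π * B) * cosh u ^ 2)

lemma abs_mul_sinh_le (u : ℝ) : |u * sinh u| ≤ cosh u ^ 2 := by
  rw [abs_mul, sq]
  exact mul_le_mul (abs_le_cosh u) (abs_sinh_le_cosh u) (abs_nonneg _) (cosh_pos u).le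

lemma integrable_mul_sinh_mul_exp {ε : ℝ} (hε : 0 < ε) :
    Integrable fun u : ℝ => u * sinh u * exp (-ε * cosh u ^ 2) := by
  refine integrable_of_le_cosh_pow hε 1 (by fun_prop) fun u => ?_
  rw [abs_mul, abs_of_pos (exp_pos _)]
  gcongr
  exact abs_mul_sinh_le u

/-- Differentiation under the integral sign; for parameters above B/2 the derivative is dominated by
the Gaussian with parameter B/2. -/
lemma hasDerivAt_sinhIntegral {B : ℝ} (hB : 0 < B) :
    Integrable (fun u : ℝ => -(4 * π * cosh u ^ 2) * (u * sinh u * exp (-(4 * π * B) * cosh u ^ 2))) ∧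
    HasDerivAt sinhIntegral
      (∫ u : ℝ, -(4 * π * cosh u ^ 2) * (u * sinh u * exp (-(4 * π * B) * cosh u ^ 2))) B := by
  have hpi := pi_pos
  refine hasDerivAt_integral_of_dominated_loc_of_deriv_le
    (F := fun B u => u * sinh u * exp (-(4 * π * B) * cosh u ^ 2))
    (F' := fun B u => -(4 * π * cosh u ^ 2) * (u * sinh u * exp (-(4 * π * B) * cosh u ^ 2)))
    (s := Ioi (B / 2))
    (bound := fun u => 4 * π * (cosh u ^ (3 + 1) * exp (-(4 * π * (B / 2)) * cosh u ^ 2)))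
    (Ioi_mem_nhds (by linarith)) ?_ ?_ ?_ ?_ ?_ ?_
  · exact Eventually.of_forall fun x => (by fun_prop : Continuous _).aestronglyMeasurable
  · exact integrable_mul_sinh_mul_exp (by positivity)
  · exact (by fun_prop : Continuous _).aestronglyMeasurable
  · refine Eventually.of_forall fun u x hx => ?_
    have hx' : B / 2 < x := hx
    rw [norm_eq_abs, abs_mul, abs_neg, abs_of_nonneg (by positivity), abs_mul,
      abs_of_pos (exp_pos _)]
    have h1 := abs_mul_sinh_le u
    have h2 : exp (-(4 * π * x) * cosh u ^ 2) ≤ exp (-(4 * π * (B / 2)) * cosh u ^ 2) := by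
      gcongr
    calc 4 * π * cosh u ^ 2 * (|u * sinh u| * exp (-(4 * π * x) * cosh u ^ 2))
        ≤ 4 * π * cosh u ^ 2 * (cosh u ^ 2 * exp (-(4 * π * (B / 2)) * cosh u ^ 2)) := by gcongr
      _ = _ := by ring
  · refine (integrable_of_le_cosh_pow (ε := 4 * π * (B / 2)) (by positivity) 3
      (by fun_prop) fun u => ?_).const_mul _
    rw [abs_of_nonneg (by have := cosh_pos u; positivity)]
  · refine Eventually.of_forall fun u x _ => ?_
    have h := ((((hasDerivAt_id x).const_mul (4 * π)).neg.mul_const (cosh u ^ 2)).exp).const_mul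
      (u * sinh u)
    refine h.congr_deriv ?_
    simp only [id, Pi.neg_apply]
    ring_nf

lemma integral_cosh_mul_exp_cosh_sq {B : ℝ} (hB : 0 < B) :
    ∫ u : ℝ, cosh u * exp (-(4 * π * B) * cosh u ^ 2) = exp (-(4 * π * B)) / (2 * √B) := by
  have h : ∀ u : ℝ, cosh u * exp (-(4 * π * B) * cosh u ^ 2) =
      exp (-(4 * π * B)) * (cosh u * exp (-(4 * π * B) * sinh u ^ 2)) := by
    intro u
    rw [cosh_sq, mul_add, exp_add]
    ring_nf
  simp_rw [h]
  rw [integral_const_mul, integral_cosh_mul_exp_sinh_sq, div_eq_mul_inv (exp _)]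
  congr 1
  rw [show π / (4 * π * B) = (1 / (2 * √B)) ^ 2 by
    rw [div_pow, mul_pow, sq_sqrt hB.le]; field_simp; norm_num, sqrt_sq (by positivity), one_div]

/-- Integration by parts: the derivative of u cosh u e^{-4πB cosh² u} has total integral zero. Its
three terms are an elementary Gaussian, the integrand of `sinhIntegral`, and 2B times that of its
derivative in B. -/
lemma sinhIntegral_ode {B : ℝ} (hB : 0 < B) :
    sinhIntegral B + 2 * B *
      (∫ u : ℝ, -(4 * π * cosh u ^ 2) * (u * sinh u * exp (-(4 * π * B) * cosh u ^ 2))) =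
      -(exp (-(4 * π * B)) / (2 * √B)) := by
  have hpi := pi_pos
  have hi1 := integrable_mul_sinh_mul_exp (ε := 4 * π * B) (by positivity)
  have hi2 := (hasDerivAt_sinhIntegral hB).1
  have hi3 : Integrable fun u : ℝ => cosh u * exp (-(4 * π * B) * cosh u ^ 2) :=
    integrable_of_le_cosh_pow (ε := 4 * π * B) (by positivity) 0 (by fun_prop) fun u => by
      rw [abs_of_pos (by have := cosh_pos u; positivity)]; simp
  have hi4 : Integrable fun u : ℝ => u * (cosh u * exp (-(4 * π * B) * cosh u ^ 2)) :=
    integrable_of_le_cosh_pow (ε := 4 * π * B) (by positivity) 1 (by fun_prop) fun u => by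
      have := cosh_pos u
      rw [abs_mul, abs_of_pos (by positivity : 0 < cosh u * exp (-(4 * π * B) * cosh u ^ 2))]
      calc _ ≤ cosh u * (cosh u * exp (-(4 * π * B) * cosh u ^ 2)) := by
            gcongr; exact abs_le_cosh u
        _ = _ := by ring
  have key := integral_eq_zero_of_hasDerivAt_of_integrable
    (f := fun u : ℝ => u * (cosh u * exp (-(4 * π * B) * cosh u ^ 2)))
    (f' := fun u : ℝ => cosh u * exp (-(4 * π * B) * cosh u ^ 2) +
      (u * sinh u * exp (-(4 * π * B) * cosh u ^ 2) + 2 * B *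
      (-(4 * π * cosh u ^ 2) * (u * sinh u * exp (-(4 * π * B) * cosh u ^ 2)))))
    (fun u => by
      have h := (hasDerivAt_id u).mul ((hasDerivAt_cosh u).mul
        ((((hasDerivAt_cosh u).pow 2).const_mul (-(4 * π * B))).exp))
      refine h.congr_deriv ?_
      simp only [id, Pi.mul_apply, Pi.pow_apply]
      ring)
    (hi3.add (hi1.add (hi2.const_mul _))) hi4
  rw [integral_add hi3 (by exact hi1.add (hi2.const_mul _)), integral_add hi1 (hi2.const_mul _),
    integral_cosh_mul_exp_cosh_sq hB, integral_const_mul] at key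
  rw [sinhIntegral]
  linarith

/-- For B ≥ 1 one has 4πB cosh² u ≥ 2πB + 2π cosh² u, which separates the decay in B from the
integration in u. -/
lemma abs_sinhIntegral_le {B : ℝ} (hB : 1 ≤ B) :
    |sinhIntegral B| ≤ exp (-(2 * π * B)) * ∫ u : ℝ, cosh u ^ 2 * exp (-(2 * π) * cosh u ^ 2) := by
  have hpi := pi_pos
  rw [sinhIntegral, ← integral_const_mul, ← norm_eq_abs]
  refine norm_integral_le_of_norm_le ?_ (Eventually.of_forall fun u => ?_)
  · refine (integrable_of_le_cosh_pow (ε := 2 * π) (by positivity) 1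
      (by fun_prop) fun u => ?_).const_mul _
    rw [abs_of_nonneg (by positivity)]
  · rw [norm_eq_abs, abs_mul, abs_of_pos (exp_pos _)]
    have h1 := abs_mul_sinh_le u
    have h2 : exp (-(4 * π * B) * cosh u ^ 2) ≤
        exp (-(2 * π * B)) * exp (-(2 * π) * cosh u ^ 2) := by
      rw [← exp_add, exp_le_exp]
      have h3 : 1 ≤ cosh u ^ 2 := one_le_pow₀ (one_le_cosh u)
      have h4 : B ≤ B * cosh u ^ 2 := by nlinarith
      have h5 : cosh u ^ 2 ≤ B * cosh u ^ 2 := by nlinarith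
      nlinarith
    calc |u * sinh u| * exp (-(4 * π * B) * cosh u ^ 2)
        ≤ cosh u ^ 2 * (exp (-(2 * π * B)) * exp (-(2 * π) * cosh u ^ 2)) := by gcongr
      _ = _ := by ring

lemma tendsto_sqrt_mul_sinhIntegral : Tendsto (fun B => √B * sinhIntegral B) atTop (𝓝 0) := by
  have hpi := pi_pos
  set K := ∫ u : ℝ, cosh u ^ 2 * exp (-(2 * π) * cosh u ^ 2)
  have h1 : Tendsto (fun B : ℝ => B * exp (-(2 * π * B)) * K) atTop (𝓝 0) := by
    have h := (tendsto_rpow_mul_exp_neg_mul_atTop_nhds_zero 1 (2 * π) (by positivity)).mul_const K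
    simpa using h
  refine squeeze_zero_norm' ?_ h1
  filter_upwards [eventually_ge_atTop 1] with B hB
  rw [norm_mul, norm_eq_abs, norm_eq_abs, abs_of_nonneg (sqrt_nonneg _), mul_assoc]
  refine mul_le_mul ?_ (abs_sinhIntegral_le hB) (abs_nonneg _) (by linarith)
  rw [sqrt_le_left (by linarith)]
  nlinarith

lemma integrableOn_exp_mul_inv {r y : ℝ} (hr : 0 < r) (hy : 0 < y) :
    IntegrableOn (fun u : ℝ => exp (-(4 * π * r * u)) * u⁻¹) (Ioi y) := by
  have hpi := pi_pos
  have h1 : IntegrableOn (fun u : ℝ => exp (-(4 * π * r) * u)) (Ioi y) :=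
    exp_neg_integrableOn_Ioi y (by positivity)
  refine (h1.mul_const y⁻¹).mono' ?_ ?_
  · refine ContinuousOn.aestronglyMeasurable ?_ measurableSet_Ioi
    exact (by fun_prop : Continuous fun u : ℝ => exp (-(4 * π * r * u))).continuousOn.mul
      (continuousOn_inv₀.mono fun u hu => (hy.trans hu).ne')
  · refine (ae_restrict_iff' measurableSet_Ioi).2 (Eventually.of_forall fun u hu => ?_)
    have hu' : y < u := hu
    have : 0 < u := hy.trans hu'
    rw [norm_eq_abs, abs_of_pos (by positivity), neg_mul]
    gcongr

/-- √B is the integrating factor of `sinhIntegral_ode`: writing I for `sinhIntegral`, (√B I)' = (I +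
2B I')/(2√B), and the numerator is elementary. Up to the factor -1/4 the result is the integrand of
the exponential integral. -/
lemma hasDerivAt_sqrt_mul_sinhIntegral {r : ℝ} (hr : 0 < r) {u : ℝ} (hu' : 0 < u) :
    HasDerivAt (fun u => √(r * u) * sinhIntegral (r * u))
      (-(exp (-(4 * π * r * u)) * u⁻¹) / 4) u := by
  have hB : 0 < r * u := mul_pos hr hu'
  have h0 : HasDerivAt (fun u => r * u) r u := by simpa using (hasDerivAt_id u).const_mul r
  have h1 := (hasDerivAt_sqrt hB.ne').comp u h0
  have h2 := (hasDerivAt_sinhIntegral hB).2.comp u h0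
  refine (h1.mul h2).congr_deriv ?_
  have hode := sinhIntegral_ode hB
  set D := ∫ v : ℝ, -(4 * π * cosh v ^ 2) * (v * sinh v * exp (-(4 * π * (r * u)) * cosh v ^ 2))
  have hs : √(r * u) ≠ 0 := (sqrt_pos.2 hB).ne'
  have hsq : √(r * u) ^ 2 = r * u := sq_sqrt hB.le
  simp only [Function.comp]
  rw [show 4 * π * r * u = 4 * π * (r * u) by ring]
  have e1 : sinhIntegral (r * u) =
    -(exp (-(4 * π * (r * u))) / (2 * √(r * u))) - 2 * (r * u) * D := by linarith
  rw [e1]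
  field_simp
  have h3 : √(r * u) ^ 3 = r * u * √(r * u) := by rw [pow_succ, hsq]
  rw [hsq]
  ring_nf
  rw [h3]
  ring

/-- The exponential integral as a hyperbolic Gaussian integral. -/
lemma integral_exp_mul_inv_eq {r y : ℝ} (hr : 0 < r) (hy : 0 < y) :
    ∫ u in Ioi y, exp (-(4 * π * r * u)) * u⁻¹ = 4 * (√(r * y) * sinhIntegral (r * y)) := by
  have hd : ∀ u ∈ Ioi (0 : ℝ), HasDerivAt (fun u => √(r * u) * sinhIntegral (r * u))
      (-(exp (-(4 * π * r * u)) * u⁻¹) / 4) u := fun u hu =>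
    hasDerivAt_sqrt_mul_sinhIntegral hr hu
  have ht : Tendsto (fun u => √(r * u) * sinhIntegral (r * u)) atTop (𝓝 0) :=
    tendsto_sqrt_mul_sinhIntegral.comp (tendsto_id.const_mul_atTop hr)
  have h := integral_Ioi_of_hasDerivAt_of_tendsto
    (hd y hy).continuousAt.continuousWithinAt (fun u hu => hd u (hy.trans hu))
    (((integrableOn_exp_mul_inv hr hy).neg).div_const 4) ht
  rw [integral_div, integral_neg] at h
  linarith

end HyperbolicGaussians

/-! ### Weighted integrals of the Fourier-transformed kernel -/

section BesselKernel

/-- The Fourier transform of `x ↦ i (x - iA) e^{-πτ(x² + A²)}` at `ν`. -/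
noncomputable def besselKernel (A ν τ : ℝ) : ℝ :=
  (A / √τ + ν / (τ * √τ)) * exp (-π * (τ * A ^ 2 + ν ^ 2 / τ))

lemma sqrt_mul_exp_two_mul {c : ℝ} (hc : 0 ≤ c) (u : ℝ) : √(c * exp (2 * u)) = √c * exp u := by
  rw [sqrt_mul hc, show exp (2 * u) = exp u ^ 2 by rw [← exp_nat_mul]; norm_num,
    sqrt_sq (exp_pos u).le]

/-- The point τ = ν/A balances the two summands of the prefactor; moving away from it by e^{2u}
makes them proportional to e^u and e^{-u} with the same constant. -/
lemma besselKernel_subst_aux {A ν : ℝ} (hA : 0 < A) (hν : 0 < ν) (u : ℝ) :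
    2 * (ν / A) * exp (2 * u) * (A / √(ν / A * exp (2 * u))) = 2 * √(A * ν) * exp u ∧
    2 * (ν / A) * exp (2 * u) * (ν / (ν / A * exp (2 * u) * √(ν / A * exp (2 * u)))) =
      2 * √(A * ν) * exp (-u) := by
  rw [sqrt_mul_exp_two_mul (by positivity)]
  have hA' := sqrt_pos.2 hA
  have hν' := sqrt_pos.2 hν
  have e2 : exp (2 * u) = exp u ^ 2 := by rw [← exp_nat_mul]; norm_num
  rw [e2, exp_neg, sqrt_div hν.le, sqrt_mul hA.le]
  have hAA : A = √A ^ 2 := (sq_sqrt hA.le).symm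
  have hνν : ν = √ν ^ 2 := (sq_sqrt hν.le).symm
  generalize √A = s at *
  generalize √ν = r at *
  subst hAA hνν
  constructor <;> field_simp

/-- The exponent is maximal at u = 0, since e^{2u} + e^{-2u} = 2 + 4 sinh² u. The maximal value
-2πAν is the one expected of a q-power. -/
lemma besselKernel_exponent {A ν : ℝ} (hA : 0 < A) (hν : 0 < ν) (u : ℝ) :
    -π * (ν / A * exp (2 * u) * A ^ 2 + ν ^ 2 / (ν / A * exp (2 * u))) =
      -(2 * π * (A * ν)) - 4 * π * (A * ν) * sinh u ^ 2 := by
  have e2 : exp (2 * u) = exp u ^ 2 := by rw [← exp_nat_mul]; norm_num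
  rw [e2, sinh_eq, exp_neg]
  have := exp_pos u
  field_simp
  ring

lemma besselKernel_subst {A ν : ℝ} (hA : 0 < A) (hν : 0 < ν) (u : ℝ) :
    2 * (ν / A) * exp (2 * u) * besselKernel A ν (ν / A * exp (2 * u)) =
      4 * √(A * ν) * exp (-(2 * π * (A * ν))) *
        (cosh u * exp (-(4 * π * (A * ν)) * sinh u ^ 2)) := by
  obtain ⟨h1, h2⟩ := besselKernel_subst_aux hA hν u
  rw [besselKernel, besselKernel_exponent hA hν, ← mul_assoc, mul_add, h1, h2, sub_eq_add_neg,
    exp_add, cosh_eq]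
  ring_nf

/-- Reversing the sign of the frequency flips one prefactor summand only, so cosh u is replaced by
sinh u. This parity change separates the holomorphic from the nonholomorphic terms. -/
lemma besselKernel_neg_subst {A ν : ℝ} (hA : 0 < A) (hν : 0 < ν) (u : ℝ) :
    2 * (ν / A) * exp (2 * u) * besselKernel A (-ν) (ν / A * exp (2 * u)) =
      4 * √(A * ν) * exp (-(2 * π * (A * ν))) *
        (sinh u * exp (-(4 * π * (A * ν)) * sinh u ^ 2)) := by
  obtain ⟨h1, h2⟩ := besselKernel_subst_aux hA hν u
  rw [besselKernel, neg_sq, besselKernel_exponent hA hν, ← mul_assoc, mul_add, h1, neg_div, mul_neg,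
    h2, sub_eq_add_neg, exp_add, sinh_eq]
  ring_nf

lemma integrable_abs_mul_exp_neg_mul_sq {c : ℝ} (hc : 0 < c) :
    Integrable fun x : ℝ => |x| * exp (-c * x ^ 2) := by
  refine (integrable_mul_exp_neg_mul_sq hc).norm.congr (Eventually.of_forall fun x => ?_)
  simp [abs_of_pos (exp_pos _)]

lemma integral_abs_mul_exp_neg_mul_sq {c : ℝ} (hc : 0 < c) :
    ∫ x : ℝ, |x| * exp (-c * x ^ 2) = c⁻¹ := by
  have h1 := integral_comp_abs (f := fun x : ℝ => x * exp (-c * x ^ 2))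
  simp only [sq_abs] at h1
  rw [h1]
  have h2 : ∫ x in Ioi (0 : ℝ), x * exp (-c * x ^ 2) = (2 * c)⁻¹ := by
    have h := integral_mul_cexp_neg_mul_sq (b := (c : ℂ)) (by simpa using hc)
    have e : ∀ r : ℝ, (r : ℂ) * Complex.exp (-(c : ℂ) * (r : ℂ) ^ 2) =
      ((r * exp (-c * r ^ 2) : ℝ) : ℂ) := by intro r; push_cast; rfl
    simp_rw [e] at h
    rw [integral_complex_ofReal] at h
    exact_mod_cast h
  rw [h2]
  field_simp

/-- A function dominating the substituted weighted kernels. -/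
noncomputable def kernelBound (B p s : ℝ) (u : ℝ) : ℝ :=
  4 * √B * exp (-(2 * π * B)) *
    (p * (cosh u * exp (-(4 * π * B) * sinh u ^ 2)) +
      2 * s * (cosh u * (|sinh u| * exp (-(4 * π * B) * sinh u ^ 2))))

lemma integrable_kernelBound {B : ℝ} (hB : 0 < B) (p s : ℝ) : Integrable (kernelBound B p s) := by
  have hpi := pi_pos
  refine ((Integrable.const_mul (integrable_cosh_mul_exp_sinh_sq (by positivity)) p).add
    (Integrable.const_mul ?_ _)).const_mul _
  exact (integrable_comp_sinh fun x => |x| * exp (-(4 * π * B) * x ^ 2)).2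
    (integrable_abs_mul_exp_neg_mul_sq (by positivity))

lemma sqrt_pi_div_four_pi_mul {B : ℝ} (hB : 0 < B) : √(π / (4 * π * B)) = 1 / (2 * √B) := by
  have hpi := pi_pos
  rw [show π / (4 * π * B) = (1 / (2 * √B)) ^ 2 by
    rw [div_pow, mul_pow, sq_sqrt hB.le]; field_simp; norm_num, sqrt_sq (by positivity)]

lemma integral_kernelBound {B : ℝ} (hB : 0 < B) (p s : ℝ) :
    ∫ u, kernelBound B p s u = exp (-(2 * π * B)) * (2 * p + 2 * s / (π * √B)) := by
  have hpi := pi_pos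
  unfold kernelBound
  have h1 : Integrable fun u : ℝ => p * (cosh u * exp (-(4 * π * B) * sinh u ^ 2)) :=
    Integrable.const_mul (integrable_cosh_mul_exp_sinh_sq (by positivity)) p
  have h2 : Integrable fun u : ℝ =>
      2 * s * (cosh u * (|sinh u| * exp (-(4 * π * B) * sinh u ^ 2))) :=
    Integrable.const_mul ((integrable_comp_sinh fun x => |x| * exp (-(4 * π * B) * x ^ 2)).2
      (integrable_abs_mul_exp_neg_mul_sq (by positivity))) _
  have h3 : ∫ u : ℝ, cosh u * (|sinh u| * exp (-(4 * π * B) * sinh u ^ 2)) = (4 * π * B)⁻¹ := by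
    rw [← integral_abs_mul_exp_neg_mul_sq (by positivity),
      ← integral_comp_sinh (fun x => |x| * exp (-(4 * π * B) * x ^ 2))]
    rfl
  rw [integral_const_mul, integral_add h1 h2, integral_const_mul, integral_const_mul, h3,
    integral_cosh_mul_exp_sinh_sq, sqrt_pi_div_four_pi_mul hB]
  have hs := sqrt_pos.2 hB
  have hsq : √B ^ 2 = B := sq_sqrt hB.le
  field_simp
  linear_combination (4 * s) * hsq

/-- Since |u| ≤ |sinh u|, the logarithmic weight costs at most one factor |sinh u|, still integrable
against the hyperbolic Gaussian. -/
lemma norm_weight_le (a b : ℂ) (l u : ℝ) :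
    ‖a + b * ((l + 2 * u : ℝ) : ℂ)‖ ≤ (‖a‖ + ‖b‖ * |l|) + 2 * ‖b‖ * |sinh u| := by
  have h1 : |u| ≤ |sinh u| := by
    rcases le_total 0 u with h | h
    · rw [abs_of_nonneg h, abs_of_nonneg (sinh_nonneg_iff.2 h)]
      exact self_le_sinh_iff.2 h
    · rw [abs_of_nonpos h, abs_of_nonpos (sinh_nonpos_iff.2 h)]
      exact neg_le_neg (sinh_le_self_iff.2 h)
  calc ‖a + b * ((l + 2 * u : ℝ) : ℂ)‖ ≤ ‖a‖ + ‖b‖ * |l + 2 * u| := by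
        refine (norm_add_le _ _).trans ?_
        rw [norm_mul, Complex.norm_real, norm_eq_abs]
    _ ≤ ‖a‖ + ‖b‖ * (|l| + 2 * |sinh u|) := by
        gcongr
        refine (abs_add_le _ _).trans ?_
        rw [abs_mul, abs_two]
        gcongr
    _ = _ := by ring

lemma log_mul_mul_exp {y c : ℝ} (hy : 0 < y) (hc : 0 < c) (u : ℝ) :
    log (y * (c * exp (2 * u))) = log (y * c) + 2 * u := by
  rw [← mul_assoc, log_mul (by positivity) (by positivity), log_exp]

variable {A ν y : ℝ}

lemma norm_weighted_subst_le (hA : 0 < A) (hν : 0 < ν) (hy : 0 < y) (a b : ℂ) (ε : ℝ)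
    (hε : ε = ν ∨ ε = -ν) (u : ℝ) :
    ‖(2 * (ν / A) * exp (2 * u)) • ((a + b * (log (y * (ν / A * exp (2 * u))) : ℂ)) *
      (besselKernel A ε (ν / A * exp (2 * u)) : ℂ))‖ ≤
      kernelBound (A * ν) (‖a‖ + ‖b‖ * |log (y * (ν / A))|) ‖b‖ u := by
  have h1 : |2 * (ν / A) * exp (2 * u) * besselKernel A ε (ν / A * exp (2 * u))| ≤
      4 * √(A * ν) * exp (-(2 * π * (A * ν))) *
        (cosh u * exp (-(4 * π * (A * ν)) * sinh u ^ 2)) := by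
    have hc := cosh_pos u
    rcases hε with rfl | rfl
    · rw [besselKernel_subst hA hν, abs_of_nonneg (by positivity)]
    · rw [besselKernel_neg_subst hA hν, abs_mul, abs_mul, abs_of_pos (exp_pos _),
        abs_of_nonneg (by positivity)]
      rw [abs_mul, abs_of_pos (exp_pos _)]
      gcongr
      exact abs_sinh_le_cosh u
  rw [log_mul_mul_exp hy (by positivity), mul_comm (a + _), ← smul_mul_assoc, norm_mul]
  rw [show (2 * (ν / A) * exp (2 * u)) • (besselKernel A ε (ν / A * exp (2 * u)) : ℂ) =
    ((2 * (ν / A) * exp (2 * u) * besselKernel A ε (ν / A * exp (2 * u)) : ℝ) : ℂ) by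
      rw [Complex.real_smul, ← Complex.ofReal_mul], Complex.norm_real, norm_eq_abs]
  refine (mul_le_mul h1 (norm_weight_le a b _ u) (norm_nonneg _)
    ((abs_nonneg _).trans h1)).trans (le_of_eq ?_)
  rw [kernelBound]
  ring

lemma continuousOn_besselKernel (A ν : ℝ) : ContinuousOn (besselKernel A ν) (Ioi 0) := by
  unfold besselKernel
  have h : ∀ x ∈ Ioi (0 : ℝ), x ≠ 0 := fun x hx => (ne_of_gt hx)
  have h2 : ∀ x ∈ Ioi (0 : ℝ), √x ≠ 0 := fun x hx => (sqrt_pos.2 hx).ne'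
  have h3 : ∀ x ∈ Ioi (0 : ℝ), x * √x ≠ 0 := fun x hx => mul_ne_zero (h x hx) (h2 x hx)
  fun_prop (disch := assumption)

lemma continuousOn_weight (a b : ℂ) (hy : 0 < y) :
    ContinuousOn (fun τ : ℝ => a + b * (log (y * τ) : ℂ)) (Ioi 0) := by
  have h : ∀ x ∈ Ioi (0 : ℝ), y * x ≠ 0 := fun x hx => (mul_pos hy hx).ne'
  fun_prop (disch := assumption)

lemma integrableOn_weighted_besselKernel (hA : 0 < A) (hν : 0 < ν) (hy : 0 < y) (a b : ℂ) (ε : ℝ)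
    (hε : ε = ν ∨ ε = -ν) :
    IntegrableOn (fun τ : ℝ => (a + b * (log (y * τ) : ℂ)) * (besselKernel A ε τ : ℂ)) (Ioi 0) := by
  rw [integrableOn_Ioi_comp_exp (div_pos hν hA)]
  refine (integrable_kernelBound (mul_pos hA hν) _ _).mono' ?_
    (Eventually.of_forall (norm_weighted_subst_le hA hν hy a b ε hε))
  refine Continuous.aestronglyMeasurable ?_
  refine (by fun_prop : Continuous fun u : ℝ => 2 * (ν / A) * exp (2 * u)).smul ?_
  have h : Continuous fun u : ℝ => ν / A * exp (2 * u) := by fun_prop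
  have hmem : ∀ u : ℝ, ν / A * exp (2 * u) ∈ Ioi (0 : ℝ) := fun u => by
    rw [mem_Ioi]; positivity
  exact ((continuousOn_weight a b hy).comp_continuous h hmem).mul
    (Complex.continuous_ofReal.comp ((continuousOn_besselKernel A ε).comp_continuous h hmem))

lemma integral_norm_weighted_besselKernel_le (hA : 0 < A) (hν : 0 < ν) (hy : 0 < y) (a b : ℂ)
    (ε : ℝ) (hε : ε = ν ∨ ε = -ν) :
    ∫ τ in Ioi (0 : ℝ), ‖(a + b * (log (y * τ) : ℂ)) * (besselKernel A ε τ : ℂ)‖ ≤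
      exp (-(2 * π * (A * ν))) *
        (2 * (‖a‖ + ‖b‖ * |log (y * (ν / A))|) + 2 * ‖b‖ / (π * √(A * ν))) := by
  rw [integral_Ioi_comp_exp (div_pos hν hA), ← integral_kernelBound (mul_pos hA hν)]
  refine integral_mono_of_nonneg (Eventually.of_forall fun u => by simp only [Pi.zero_apply]; positivity)
    (integrable_kernelBound (mul_pos hA hν) _ _) (Eventually.of_forall fun u => ?_)
  have h := norm_weighted_subst_le hA hν hy a b ε hε u
  rw [norm_smul, norm_eq_abs, abs_of_pos (by positivity)] at h
  exact h

lemma integral_odd_eq_zero {E : Type*} [NormedAddCommGroup E] [NormedSpace ℝ E] {g : ℝ → E}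
    (hg : ∀ u, g (-u) = -g u) : ∫ u, g u = 0 := by
  have h := integral_neg_eq_self g volume
  simp_rw [hg] at h
  rw [integral_neg] at h
  have h2 : (2 : ℝ) • ∫ u, g u = 0 := by
    rw [two_smul]
    nth_rewrite 1 [← h]
    simp
  simpa using h2

/-- After the substitution the weight is a + b(log(yν/A) + 2u) and the kernel is even in u, so the
term in u integrates to zero. For A proportional to y the remaining logarithm does not depend on y,
which is why these terms become holomorphic. -/
lemma integral_weighted_besselKernel (hA : 0 < A) (hν : 0 < ν) (hy : 0 < y) (a b : ℂ) :
    ∫ τ in Ioi (0 : ℝ), (a + b * (log (y * τ) : ℂ)) * (besselKernel A ν τ : ℂ) =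
      2 * exp (-(2 * π * (A * ν))) * (a + b * (log (y * (ν / A)) : ℂ)) := by
  have hpi := pi_pos
  have hB := mul_pos hA hν
  have hintegrable := (integrableOn_Ioi_comp_exp (div_pos hν hA) _).1
    (integrableOn_weighted_besselKernel hA hν hy a b ν (Or.inl rfl))
  rw [integral_Ioi_comp_exp (div_pos hν hA)]
  set l := log (y * (ν / A))
  set g : ℝ → ℝ := fun u => 4 * √(A * ν) * exp (-(2 * π * (A * ν))) *
    (cosh u * exp (-(4 * π * (A * ν)) * sinh u ^ 2)) with hg
  have e : ∀ u : ℝ, (2 * (ν / A) * exp (2 * u)) • ((a + b * (log (y * (ν / A * exp (2 * u))) : ℂ)) *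
      (besselKernel A ν (ν / A * exp (2 * u)) : ℂ)) =
      (a + b * l) * (g u : ℂ) + 2 * b * u * (g u : ℂ) := by
    intro u
    rw [log_mul_mul_exp hy (by positivity), mul_comm (a + _), ← smul_mul_assoc, hg]
    simp only
    rw [← besselKernel_subst hA hν, Complex.real_smul, ← Complex.ofReal_mul]
    push_cast
    ring
  have hgi : Integrable g := (integrable_cosh_mul_exp_sinh_sq (by positivity)).const_mul _
  have hgi' : Integrable fun u => (a + b * l) * (g u : ℂ) := hgi.ofReal.const_mul _
  simp_rw [e] at hintegrable ⊢
  have hgi2 : Integrable fun u : ℝ => 2 * b * u * (g u : ℂ) := by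
    refine (hintegrable.sub hgi').congr (Eventually.of_forall fun u => ?_)
    simp
  rw [integral_add hgi' hgi2, integral_const_mul, integral_odd_eq_zero (g := fun u : ℝ =>
    2 * b * u * (g u : ℂ)) (fun u => by simp [hg]), add_zero, integral_complex_ofReal]
  have h1 : ∫ u, g u = 2 * exp (-(2 * π * (A * ν))) := by
    rw [hg, integral_const_mul, integral_cosh_mul_exp_sinh_sq, sqrt_pi_div_four_pi_mul hB]
    have := sqrt_pos.2 hB
    field_simp
    ring
  rw [h1]
  push_cast
  ring

/-- Here the kernel is odd in u, so everything constant in the weight drops out, including a. Only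
2bu survives, and u sinh u against the Gaussian is the exponential integral; passing from sinh² to
cosh² turns e^{-2πAν} into e^{2πAν}. -/
lemma integral_weighted_besselKernel_neg (hA : 0 < A) (hν : 0 < ν) (hy : 0 < y) (a b : ℂ) :
    ∫ τ in Ioi (0 : ℝ), (a + b * (log (y * τ) : ℂ)) * (besselKernel A (-ν) τ : ℂ) =
      2 * b * exp (2 * π * (A * ν)) * ((4 * (√(A * ν) * sinhIntegral (A * ν)) : ℝ) : ℂ) := by
  have hpi := pi_pos
  have hB := mul_pos hA hν
  have hintegrable := (integrableOn_Ioi_comp_exp (div_pos hν hA) _).1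
    (integrableOn_weighted_besselKernel hA hν hy a b (-ν) (Or.inr rfl))
  rw [integral_Ioi_comp_exp (div_pos hν hA)]
  set l := log (y * (ν / A))
  set g : ℝ → ℝ := fun u => 4 * √(A * ν) * exp (-(2 * π * (A * ν))) *
    (sinh u * exp (-(4 * π * (A * ν)) * sinh u ^ 2)) with hg
  have e : ∀ u : ℝ, (2 * (ν / A) * exp (2 * u)) • ((a + b * (log (y * (ν / A * exp (2 * u))) : ℂ)) *
      (besselKernel A (-ν) (ν / A * exp (2 * u)) : ℂ)) =
      (a + b * l) * (g u : ℂ) + 2 * b * ((u * g u : ℝ) : ℂ) := by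
    intro u
    rw [log_mul_mul_exp hy (by positivity), mul_comm (a + _), ← smul_mul_assoc, hg]
    simp only
    rw [← besselKernel_neg_subst hA hν, Complex.real_smul, ← Complex.ofReal_mul]
    push_cast
    ring
  have hgi : Integrable g := by
    refine ((integrable_cosh_mul_exp_sinh_sq (ε := 4 * π * (A * ν)) (by positivity)).mono'
      (by fun_prop : Continuous _).aestronglyMeasurable (Eventually.of_forall fun u => ?_)).const_mul _
    rw [norm_eq_abs, abs_mul, abs_of_pos (exp_pos _)]
    gcongr
    exact abs_sinh_le_cosh u
  have hgi' : Integrable fun u => (a + b * l) * (g u : ℂ) := hgi.ofReal.const_mul _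
  simp_rw [e] at hintegrable ⊢
  have hgi2 : Integrable fun u : ℝ => 2 * b * ((u * g u : ℝ) : ℂ) := by
    refine (hintegrable.sub hgi').congr (Eventually.of_forall fun u => ?_)
    simp
  rw [integral_add hgi' hgi2, integral_const_mul, integral_complex_ofReal, integral_const_mul (2 * b),
    integral_complex_ofReal, integral_odd_eq_zero (g := g) (fun u => by simp [hg])]
  have h1 : ∫ u, u * g u = 4 * √(A * ν) * exp (2 * π * (A * ν)) * sinhIntegral (A * ν) := by
    rw [sinhIntegral, ← integral_const_mul]
    refine integral_congr_ae (Eventually.of_forall fun u => ?_)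
    simp only [hg]
    have h2 : exp (-(2 * π * (A * ν))) * exp (-(4 * π * (A * ν)) * sinh u ^ 2) =
        exp (2 * π * (A * ν)) * exp (-(4 * π * (A * ν)) * cosh u ^ 2) := by
      rw [← exp_add, ← exp_add, cosh_sq]
      ring_nf
    linear_combination (4 * √(A * ν) * u * sinh u) * h2
  rw [h1]
  push_cast
  ring

end BesselKernel

/-! ### Poisson summation with periodic coefficients -/

section PeriodicSums

lemma hasSum_of_hasSum_residues {E : Type*} [AddCommMonoid E] [TopologicalSpace E] [ContinuousAdd E]
    {N : ℕ} (hN : 0 < N) {F : ℤ → E} {s : ℕ → E}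
    (h : ∀ a ∈ Finset.range N, HasSum (fun k : ℤ => F (a + N * k)) (s a)) :
    HasSum F (∑ a ∈ Finset.range N, s a) := by
  have hN' : (0 : ℤ) < N := by exact_mod_cast hN
  have h1 : ∀ a ∈ Finset.range N, HasSum (fun n : ℤ => if n % N = a then F n else 0) (s a) := by
    intro a ha
    have haN : (a : ℤ) < N := by exact_mod_cast Finset.mem_range.1 ha
    have hinj : Function.Injective fun k : ℤ => (a : ℤ) + N * k := by
      intro k l hkl
      simpa [hN.ne'] using hkl
    have hmod : ∀ k : ℤ, ((a : ℤ) + N * k) % N = a := fun k => by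
      rw [Int.add_mul_emod_self_left, Int.emod_eq_of_lt (by positivity) haN]
    rw [← hinj.hasSum_iff]
    · convert h a ha using 2 with k
      simp [hmod]
    · intro n hn
      rw [if_neg]
      intro hna
      refine hn ⟨n / N, ?_⟩
      simp only
      rw [← hna]
      exact Int.emod_add_mul_ediv n N
  refine (hasSum_sum h1).congr_fun fun n => ?_
  have h2 : (n % N).toNat ∈ Finset.range N := by
    rw [Finset.mem_range]
    have := Int.emod_lt_of_pos n hN'
    have := Int.emod_nonneg n hN'.ne'
    omega
  rw [Finset.sum_eq_single_of_mem _ h2]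
  · have := Int.emod_nonneg n hN'.ne'
    rw [if_pos (by omega)]
  · intro b _ hb
    rw [if_neg]
    intro hnb
    apply hb
    omega

lemma periodic_add_mul {g : ℤ → ℂ} {N : ℕ} (hg : Function.Periodic g (N : ℤ)) (a k : ℤ) :
    g (a + N * k) = g a := by
  have := hg.int_mul k a
  rwa [mul_comm] at this

/-- The finite Fourier transform `∑_{a < N} g(a) e(aξ/N)`. -/
noncomputable def periodicDFT (N : ℕ) (g : ℤ → ℂ) (ξ : ℤ) : ℂ :=
  ∑ a ∈ Finset.range N, g a * Complex.exp (2 * π * Complex.I * a * ξ / N)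

lemma norm_periodicDFT_le {N : ℕ} {g : ℤ → ℂ} {C : ℝ} (hC : ∀ n, ‖g n‖ ≤ C) (ξ : ℤ) :
    ‖periodicDFT N g ξ‖ ≤ N * C := by
  refine (norm_sum_le _ _).trans ?_
  calc _ ≤ ∑ a ∈ Finset.range N, C := by
        refine Finset.sum_le_sum fun a _ => ?_
        rw [norm_mul, show (2 * π * Complex.I * a * ξ / N : ℂ) =
          ((2 * π * a * ξ / N : ℝ) : ℂ) * Complex.I by push_cast; ring,
          Complex.norm_exp_ofReal_mul_I, mul_one]
        exact hC a
    _ = _ := by simp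

/-- Poisson summation for `(x - iA) e^{-πτ(x² + A²)}`, weighted by a periodic function. -/
lemma poisson_periodic {N : ℕ} (hN : 0 < N) {g : ℤ → ℂ} (hg : Function.Periodic g (N : ℤ))
    (X A : ℝ) {τ : ℝ} (hτ : 0 < τ) :
    ∃ S : ℂ, HasSum (fun n : ℤ => g n * ((X + n : ℝ) - Complex.I * A) *
        (exp (-π * τ * ((X + n) ^ 2 + A ^ 2)) : ℝ)) S ∧
      HasSum (fun ξ : ℤ => -Complex.I / N * periodicDFT N g ξ *
        Complex.exp (2 * π * Complex.I * ξ * X / N) * (besselKernel A (ξ / N) τ : ℂ)) S := by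
  have hN' : (0 : ℝ) < N := by exact_mod_cast hN
  have hNC : (N : ℂ) ≠ 0 := by exact_mod_cast hN.ne'
  have hx : 0 < (N : ℝ) ^ 2 * τ := by positivity
  -- On the residue class n = a + Nk one has X + n = N(k + (X + a)/N), so the sum is a combination
  -- of odd and even Hurwitz kernels at (X + a)/N and N²τ. Their functional equations supply the
  -- Poisson summation.
  set t : ℝ := N ^ 2 * τ with ht
  have hsx : √t = N * √τ := by rw [ht, sqrt_mul (by positivity), sqrt_sq hN'.le]
  have hsτ : √τ ≠ 0 := (sqrt_pos.2 hτ).ne'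
  have hsτ' : (√τ : ℂ) ≠ 0 := by exact_mod_cast hsτ
  have hτ' : (τ : ℂ) ≠ 0 := by exact_mod_cast hτ.ne'
  set α : ℕ → ℝ := fun a => (X + a) / N
  set s : ℕ → ℂ := fun a => g a * (exp (-π * τ * A ^ 2) : ℝ) *
    (N * (HurwitzZeta.oddKernel (α a) t : ℂ) - Complex.I * A * (HurwitzZeta.evenKernel (α a) t : ℂ))
    with hs
  refine ⟨∑ a ∈ Finset.range N, s a, hasSum_of_hasSum_residues hN fun a _ => ?_, ?_⟩
  · have h1 := Complex.hasSum_ofReal.2 (HurwitzZeta.hasSum_int_oddKernel (α a) hx)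
    have h2 := Complex.hasSum_ofReal.2 (HurwitzZeta.hasSum_int_evenKernel (α a) hx)
    have h3 := ((h1.mul_left (N : ℂ)).sub (h2.mul_left (Complex.I * A))).mul_left
      (g a * (exp (-π * τ * A ^ 2) : ℝ))
    refine h3.congr_fun fun k => ?_
    have e1 : exp (-π * τ * ((X + ((a + N * k : ℤ) : ℝ)) ^ 2 + A ^ 2)) =
        exp (-π * τ * A ^ 2) * exp (-π * (k + α a) ^ 2 * t) := by
      rw [← exp_add]
      congr 1
      simp only [α, ht]
      push_cast
      field_simp
      ring
    rw [periodic_add_mul hg, e1]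
    simp only [α]
    push_cast
    field_simp
    ring
  · have e1 : ∀ a : ℕ, HasSum (fun ξ : ℤ => g a * (-Complex.I / N *
        Complex.exp (2 * π * Complex.I * a * ξ / N) *
        Complex.exp (2 * π * Complex.I * ξ * X / N) * (besselKernel A (ξ / N) τ : ℂ))) (s a) := by
      intro a
      have h1 := HurwitzZeta.hasSum_int_sinKernel (α a) (one_div_pos.2 hx)
      have h2 := HurwitzZeta.hasSum_int_cosKernel (α a) (one_div_pos.2 hx)
      have h3 := ((h1.mul_left (N * (1 / t ^ (3 / 2 : ℝ) : ℝ) : ℂ)).sub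
        (h2.mul_left (Complex.I * A * (1 / t ^ (1 / 2 : ℝ) : ℝ)))).mul_left
        (g a * (exp (-π * τ * A ^ 2) : ℝ))
      rw [mul_assoc (N : ℂ), ← Complex.ofReal_mul, ← HurwitzZeta.oddKernel_functional_equation,
        mul_assoc (Complex.I * (A : ℂ)), ← Complex.ofReal_mul,
        ← HurwitzZeta.evenKernel_functional_equation] at h3
      refine h3.congr_fun fun ξ => ?_
      have e2 : t ^ (1 / 2 : ℝ) = N * √τ := by rw [← sqrt_eq_rpow, hsx]
      have e3 : t ^ (3 / 2 : ℝ) = N ^ 2 * τ * (N * √τ) := by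
        rw [← e2, ← ht]
        nth_rewrite 2 [← rpow_one t]
        rw [← rpow_add hx]
        norm_num
      have e4 : Complex.exp (2 * π * Complex.I * (α a : ℂ) * ξ) =
          Complex.exp (2 * π * Complex.I * a * ξ / N) *
            Complex.exp (2 * π * Complex.I * ξ * X / N) := by
        rw [← Complex.exp_add]
        congr 1
        simp only [α]
        push_cast
        field_simp
        ring
      have e5 : besselKernel A (ξ / N) τ = (A / √τ + ξ / N / (τ * √τ)) *
          (exp (-π * τ * A ^ 2) * exp (-π * ξ ^ 2 * (1 / t))) := by
        rw [besselKernel, ← exp_add]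
        congr 2
        rw [ht]
        field_simp
        ring
      rw [e2, e3, e4, e5]
      push_cast
      field_simp
      ring
    refine (hasSum_sum fun a _ => e1 a).congr_fun fun ξ => ?_
    rw [periodicDFT, Finset.mul_sum, Finset.sum_mul, Finset.sum_mul]
    refine Finset.sum_congr rfl fun a _ => ?_
    ring

end PeriodicSums

/-! ### One-variable odd theta series and their Mellin transforms -/

section OddTheta

/-- The theta series `∑ g(n) n e^{-πn²τ}`. -/
noncomputable def oddTheta (g : ℤ → ℂ) (τ : ℝ) : ℂ :=
  ∑' n : ℤ, g n * n * (exp (-π * n ^ 2 * τ) : ℝ)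

variable {N : ℕ} {g : ℤ → ℂ}

lemma hasSum_oddTheta_aux (hN : 0 < N) (hg : Function.Periodic g (N : ℤ)) {τ : ℝ} (hτ : 0 < τ) :
    HasSum (fun n : ℤ => g n * n * (exp (-π * n ^ 2 * τ) : ℝ))
      (∑ a ∈ Finset.range N, g a * N *
        (HurwitzZeta.oddKernel ((a / N : ℝ) : UnitAddCircle) (N ^ 2 * τ) : ℂ)) := by
  have hN' : (0 : ℝ) < N := by exact_mod_cast hN
  have hNC : (N : ℂ) ≠ 0 := by exact_mod_cast hN.ne'
  refine hasSum_of_hasSum_residues hN fun a _ => ?_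
  have h1 := (Complex.hasSum_ofReal.2 (HurwitzZeta.hasSum_int_oddKernel (a / N)
    (x := N ^ 2 * τ) (by positivity))).mul_left (g a * N)
  refine h1.congr_fun fun k => ?_
  rw [periodic_add_mul hg, show -π * (((a + N * k : ℤ) : ℝ)) ^ 2 * τ =
    -π * (k + a / N) ^ 2 * (N ^ 2 * τ) by push_cast; field_simp; ring]
  push_cast
  field_simp
  ring

lemma hasSum_oddTheta (hN : 0 < N) (hg : Function.Periodic g (N : ℤ)) {τ : ℝ} (hτ : 0 < τ) :
    HasSum (fun n : ℤ => g n * n * (exp (-π * n ^ 2 * τ) : ℝ)) (oddTheta g τ) :=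
  (hasSum_oddTheta_aux hN hg hτ).summable.hasSum

lemma oddTheta_eq_sum (hN : 0 < N) (hg : Function.Periodic g (N : ℤ)) {τ : ℝ} (hτ : 0 < τ) :
    oddTheta g τ = ∑ a ∈ Finset.range N, g a * N *
        (HurwitzZeta.oddKernel ((a / N : ℝ) : UnitAddCircle) (N ^ 2 * τ) : ℂ) :=
  (hasSum_oddTheta_aux hN hg hτ).tsum_eq

lemma isBigO_oddKernel_mul_atTop (a : UnitAddCircle) {c : ℝ} (hc : 0 < c) (r : ℝ) :
    (fun τ : ℝ => (HurwitzZeta.oddKernel a (c * τ) : ℂ)) =O[atTop] (· ^ r) := by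
  have h := ((HurwitzZeta.isStrong_hurwitzOddFEPair a).hf_top r).comp_tendsto
    (tendsto_id.const_mul_atTop hc)
  refine h.trans (Asymptotics.IsBigO.of_bound (c ^ r) ?_)
  filter_upwards [eventually_gt_atTop 0] with x hx
  simp only [Function.comp, id]
  rw [mul_rpow hc.le hx.le, norm_mul, norm_of_nonneg (by positivity)]

lemma isBigO_oddKernel_mul_zero (a : UnitAddCircle) {c : ℝ} (hc : 0 < c) (r : ℝ) :
    (fun τ : ℝ => (HurwitzZeta.oddKernel a (c * τ) : ℂ)) =O[𝓝[>] 0] (· ^ r) := by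
  have ht : Tendsto (fun τ : ℝ => c * τ) (𝓝[>] 0) (𝓝[>] 0) := by
    refine tendsto_nhdsWithin_of_tendsto_nhds_of_eventually_within _ ?_ ?_
    · have : Tendsto (fun τ : ℝ => c * τ) (𝓝 0) (𝓝 (c * 0)) := tendsto_id.const_mul c
      rw [mul_zero] at this
      exact this.mono_left nhdsWithin_le_nhds
    · filter_upwards [self_mem_nhdsWithin] with x hx using mul_pos hc hx
  have h := ((HurwitzZeta.isStrong_hurwitzOddFEPair a).hf_zero r).comp_tendsto ht
  refine h.trans (Asymptotics.IsBigO.of_bound (c ^ r) ?_)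
  filter_upwards [self_mem_nhdsWithin] with x hx
  have hx' : 0 < x := hx
  simp only [Function.comp]
  rw [mul_rpow hc.le hx'.le, norm_mul, norm_of_nonneg (by positivity)]

lemma isBigO_oddTheta_atTop (hN : 0 < N) (hg : Function.Periodic g (N : ℤ)) (r : ℝ) :
    oddTheta g =O[atTop] (· ^ r) := by
  have h : (fun τ : ℝ => ∑ a ∈ Finset.range N, g a * N *
      (HurwitzZeta.oddKernel ((a / N : ℝ) : UnitAddCircle) (N ^ 2 * τ) : ℂ)) =O[atTop] (· ^ r) :=
    Asymptotics.IsBigO.fun_sum fun a _ =>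
      (isBigO_oddKernel_mul_atTop _ (by positivity) r).const_mul_left _
  refine Asymptotics.IsBigO.congr' h ?_ EventuallyEq.rfl
  filter_upwards [eventually_gt_atTop 0] with x hx using (oddTheta_eq_sum hN hg hx).symm

lemma isBigO_oddTheta_zero (hN : 0 < N) (hg : Function.Periodic g (N : ℤ)) (r : ℝ) :
    oddTheta g =O[𝓝[>] 0] (· ^ r) := by
  have h : (fun τ : ℝ => ∑ a ∈ Finset.range N, g a * N *
      (HurwitzZeta.oddKernel ((a / N : ℝ) : UnitAddCircle) (N ^ 2 * τ) : ℂ)) =O[𝓝[>] 0] (· ^ r) :=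
    Asymptotics.IsBigO.fun_sum fun a _ =>
      (isBigO_oddKernel_mul_zero _ (by positivity) r).const_mul_left _
  refine Asymptotics.IsBigO.congr' h ?_ EventuallyEq.rfl
  filter_upwards [self_mem_nhdsWithin] with x hx using (oddTheta_eq_sum hN hg hx).symm

lemma continuousOn_oddTheta (hN : 0 < N) (hg : Function.Periodic g (N : ℤ)) :
    ContinuousOn (oddTheta g) (Ioi 0) := by
  have hN' : (0 : ℝ) < N := by exact_mod_cast hN
  refine ContinuousOn.congr (f := fun τ : ℝ => ∑ a ∈ Finset.range N, g a * N *
      (HurwitzZeta.oddKernel ((a / N : ℝ) : UnitAddCircle) (N ^ 2 * τ) : ℂ)) ?_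
    fun x hx => oddTheta_eq_sum hN hg hx
  refine continuousOn_finsetSum _ fun a _ => continuousOn_const.mul ?_
  refine Complex.continuous_ofReal.comp_continuousOn
    ((HurwitzZeta.continuousOn_oddKernel _).comp (by fun_prop) fun x hx => ?_)
  have hx' : 0 < x := hx
  rw [mem_Ioi]
  positivity

/-- The factor n removes the constant term at ∞ and, through the functional equation, at 0. The
theta series is therefore smaller than every power of τ at both ends, and no restriction on s is
needed. -/
lemma mellin_oddTheta_hasDerivAt (hN : 0 < N) (hg : Function.Periodic g (N : ℤ)) (s : ℂ) :
    MellinConvergent (fun t => log t • oddTheta g t) s ∧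
      HasDerivAt (mellin (oddTheta g)) (mellin (fun t => log t • oddTheta g t) s) s :=
  mellin_hasDerivAt_of_isBigO_rpow (a := s.re + 1) (b := s.re - 1)
    ((continuousOn_oddTheta hN hg).locallyIntegrableOn measurableSet_Ioi)
    (isBigO_oddTheta_atTop hN hg _) (by linarith) (isBigO_oddTheta_zero hN hg _) (by linarith)

lemma mellinConvergent_oddTheta (hN : 0 < N) (hg : Function.Periodic g (N : ℤ)) (s : ℂ) :
    MellinConvergent (oddTheta g) s :=
  mellinConvergent_of_isBigO_rpow (a := s.re + 1) (b := s.re - 1)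
    ((continuousOn_oddTheta hN hg).locallyIntegrableOn measurableSet_Ioi)
    (isBigO_oddTheta_atTop hN hg _) (by linarith) (isBigO_oddTheta_zero hN hg _) (by linarith)

lemma mellin_oddKernel (a : UnitAddCircle) (s : ℂ) :
    mellin (fun τ => (HurwitzZeta.oddKernel a τ : ℂ)) s =
      2 * HurwitzZeta.completedHurwitzZetaOdd a (2 * s - 1) := by
  rw [HurwitzZeta.completedHurwitzZetaOdd, (HurwitzZeta.isStrong_hurwitzOddFEPair a).Λ_eq,
    show (2 * s - 1 + 1) / 2 = s by ring, mul_div_cancel₀ _ two_ne_zero]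
  rfl

lemma mellinConvergent_oddKernel (a : UnitAddCircle) (s : ℂ) :
    MellinConvergent (fun τ => (HurwitzZeta.oddKernel a τ : ℂ)) s :=
  ((HurwitzZeta.isStrong_hurwitzOddFEPair a).hasMellin s).1

/-- Each residue class contributes an odd Hurwitz kernel at N²τ; rescaling gives N^{-2s} times a
completed odd Hurwitz zeta value, and the sum of these is by definition the completed L-function. -/
lemma mellin_oddTheta_eq [NeZero N] {Φ : ZMod N → ℂ} (hΦ : Function.Odd Φ) (s : ℂ) :
    mellin (oddTheta fun n => Φ n) s = 2 * ZMod.completedLFunction Φ (2 * s - 1) := by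
  have hN : 0 < N := Nat.pos_of_neZero N
  have hN' : (0 : ℝ) < N := by exact_mod_cast hN
  have hNC : (N : ℂ) ≠ 0 := by exact_mod_cast hN.ne'
  have hper : Function.Periodic (fun n : ℤ => Φ n) (N : ℤ) := fun n => by simp
  have hker : ∀ a : ℕ, MellinConvergent (fun τ => ((HurwitzZeta.oddKernel ((a / N : ℝ) :
      UnitAddCircle) (N ^ 2 * τ) : ℝ) : ℂ)) s := fun a =>
    (MellinConvergent.comp_mul_left (by positivity)).2 (mellinConvergent_oddKernel _ s)
  calc mellin (oddTheta fun n => Φ n) s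
      = ∫ τ in Ioi (0 : ℝ), ∑ a ∈ Finset.range N, (Φ ((a : ℤ) : ZMod N) * N) * ((τ : ℂ) ^ (s - 1) •
          (HurwitzZeta.oddKernel ((a / N : ℝ) : UnitAddCircle) (N ^ 2 * τ) : ℂ)) := by
        refine setIntegral_congr_fun measurableSet_Ioi fun τ hτ => ?_
        rw [oddTheta_eq_sum hN hper hτ, Finset.smul_sum]
        refine Finset.sum_congr rfl fun a _ => ?_
        simp only [smul_eq_mul]
        ring
    _ = ∑ a ∈ Finset.range N, (Φ ((a : ℤ) : ZMod N) * N) * ((N : ℂ) ^ (-(2 * s)) *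
          (2 * HurwitzZeta.completedHurwitzZetaOdd ((a / N : ℝ) : UnitAddCircle) (2 * s - 1))) := by
        rw [integral_finsetSum _ fun a _ => (hker a).const_mul _]
        refine Finset.sum_congr rfl fun a _ => ?_
        rw [integral_const_mul, ← mellin_oddKernel]
        congr 1
        have := mellin_comp_mul_left (fun τ => ((HurwitzZeta.oddKernel ((a / N : ℝ) :
          UnitAddCircle) τ : ℝ) : ℂ)) s (a := (N : ℝ) ^ 2) (by positivity)
        rw [mellin] at this
        rw [this, smul_eq_mul]
        congr 1
        push_cast
        rw [sq, Complex.natCast_mul_natCast_cpow, ← Complex.cpow_add _ _ hNC]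
        ring_nf
    _ = 2 * ZMod.completedLFunction Φ (2 * s - 1) := by
        rw [ZMod.completedLFunction_def_odd hΦ, Finset.mul_sum, Finset.mul_sum]
        refine Finset.sum_bij' (fun a _ => (a : ZMod N)) (fun j _ => j.val) ?_ ?_ ?_ ?_ ?_
        · simp
        · intro j _
          simpa using ZMod.val_lt j
        · intro a ha
          exact ZMod.val_cast_of_lt (Finset.mem_range.1 ha)
        · simp
        · intro a ha
          rw [ZMod.toAddCircle_apply, ZMod.val_cast_of_lt (Finset.mem_range.1 ha),
            show -(2 * s - 1) = -(2 * s) + 1 by ring, Complex.cpow_add _ _ hNC, Complex.cpow_one]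
          push_cast
          ring

end OddTheta

/-! ### Weighted integrals of one-variable theta series -/

section ThetaConstants

variable {N : ℕ} {g : ℤ → ℂ} {y : ℝ}

/-- The logarithmic Mellin transform, the derivative of the Mellin transform of the theta series. -/
noncomputable def logMellin (g : ℤ → ℂ) (s : ℂ) : ℂ := mellin (fun t => log t • oddTheta g t) s

lemma hasIntegral_weighted_oddTheta (hN : 0 < N) (hg : Function.Periodic g (N : ℤ)) (hy : 0 < y)
    (a b : ℂ) :
    IntegrableOn (fun τ : ℝ => (a + b * (log (y * τ) : ℂ)) * oddTheta g τ) (Ioi 0) ∧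
    ∫ τ in Ioi (0 : ℝ), (a + b * (log (y * τ) : ℂ)) * oddTheta g τ =
      (a + b * log y) * mellin (oddTheta g) 1 + b * logMellin g 1 := by
  have h1 := (mellinConvergent_oddTheta hN hg 1).const_mul (a + b * log y)
  have h2 := (mellin_oddTheta_hasDerivAt hN hg 1).1.const_mul b
  have e : ∀ τ ∈ Ioi (0 : ℝ), (a + b * log y) * ((τ : ℂ) ^ ((1 : ℂ) - 1) • oddTheta g τ) +
      b * ((τ : ℂ) ^ ((1 : ℂ) - 1) • (log τ • oddTheta g τ)) =
      (a + b * (log (y * τ) : ℂ)) * oddTheta g τ := by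
    intro τ hτ
    rw [sub_self, Complex.cpow_zero, one_smul, one_smul, log_mul hy.ne' (ne_of_gt hτ),
      Complex.real_smul]
    push_cast
    ring
  refine ⟨IntegrableOn.congr_fun (Integrable.add h1 h2) (fun τ hτ => e τ hτ) measurableSet_Ioi, ?_⟩
  rw [← setIntegral_congr_fun measurableSet_Ioi e, integral_add h1 h2, integral_const_mul,
    integral_const_mul]
  rfl

/-- Put σ = y²τ. Then y τ^{-1/2} dτ = σ^{-1/2} dσ, which selects the point 1/2, and log(yτ) = log σ
- log y, which is why log y enters with the opposite sign to that in
`hasIntegral_weighted_oddTheta`. -/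
lemma hasIntegral_weighted_oddTheta_sq (hN : 0 < N) (hg : Function.Periodic g (N : ℤ)) (hy : 0 < y)
    (a b : ℂ) :
    IntegrableOn (fun τ : ℝ => (a + b * (log (y * τ) : ℂ)) *
      ((y / √τ : ℝ) * oddTheta g (y ^ 2 * τ))) (Ioi 0) ∧
    ∫ τ in Ioi (0 : ℝ), (a + b * (log (y * τ) : ℂ)) * ((y / √τ : ℝ) * oddTheta g (y ^ 2 * τ)) =
      (a - b * log y) * mellin (oddTheta g) (1 / 2) + b * logMellin g (1 / 2) := by
  have hy2 : 0 < y ^ 2 := by positivity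
  have h1 := (mellinConvergent_oddTheta hN hg (1 / 2)).const_mul (y ^ 2 * (a - b * log y))
  have h2 := (mellin_oddTheta_hasDerivAt hN hg (1 / 2)).1.const_mul (y ^ 2 * b)
  set H : ℝ → ℂ := fun σ => y ^ 2 * (a - b * log y) * ((σ : ℂ) ^ ((1 / 2 : ℂ) - 1) • oddTheta g σ) +
      y ^ 2 * b * ((σ : ℂ) ^ ((1 / 2 : ℂ) - 1) • (log σ • oddTheta g σ)) with hH
  have hHi : IntegrableOn H (Ioi 0) := h1.add h2
  have e : ∀ τ ∈ Ioi (0 : ℝ), H (y ^ 2 * τ) =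
      (a + b * (log (y * τ) : ℂ)) * ((y / √τ : ℝ) * oddTheta g (y ^ 2 * τ)) := by
    intro τ hτ
    have hτ' : 0 < τ := hτ
    have hs := sqrt_pos.2 hτ'
    have hc : ((y ^ 2 * τ : ℝ) : ℂ) ^ ((1 / 2 : ℂ) - 1) = ((y * √τ : ℝ) : ℂ)⁻¹ := by
      rw [show (1 / 2 : ℂ) - 1 = ((-(1 / 2) : ℝ) : ℂ) by push_cast; norm_num,
        ← Complex.ofReal_cpow (by positivity), rpow_neg (by positivity), ← sqrt_eq_rpow,
        sqrt_mul (by positivity), sqrt_sq hy.le, Complex.ofReal_inv]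
    simp only [hH]
    rw [hc, log_mul hy.ne' hτ'.ne', log_mul hy2.ne' hτ'.ne', log_pow, Complex.real_smul]
    have hyc : (y : ℂ) ≠ 0 := by exact_mod_cast hy.ne'
    have hsc : (√τ : ℂ) ≠ 0 := by exact_mod_cast hs.ne'
    push_cast
    simp only [smul_eq_mul]
    field_simp
    ring
  constructor
  · have := (integrableOn_Ioi_comp_mul_left_iff H 0 hy2).2 (by simpa using hHi)
    exact this.congr_fun (fun τ hτ => e τ hτ) measurableSet_Ioi
  · rw [← setIntegral_congr_fun measurableSet_Ioi e, integral_comp_mul_left_Ioi H 0 hy2, mul_zero,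
      hH, integral_add h1 h2, integral_const_mul, integral_const_mul]
    change (y ^ 2)⁻¹ • (y ^ 2 * (a - b * log y) * mellin (oddTheta g) (1 / 2) +
      y ^ 2 * b * logMellin g (1 / 2)) = _
    rw [Complex.real_smul]
    have hyc : (y : ℂ) ≠ 0 := by exact_mod_cast hy.ne'
    push_cast
    field_simp

end ThetaConstants

/-! ### L-values of odd characters from Mellin transforms -/

section OddCharacters

variable {N : ℕ} {χ : DirichletCharacter ℂ N}

lemma periodic_character (χ : DirichletCharacter ℂ N) :
    Function.Periodic (fun n : ℤ => χ n) (N : ℤ) := fun n => by simp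

lemma ne_one_of_odd (hχ : χ.Odd) : χ ≠ 1 := by
  rintro rfl
  have h : (1 : DirichletCharacter ℂ N) (-1) = -1 := hχ
  rw [MulChar.one_apply (isUnit_one.neg)] at h
  norm_num at h

variable [NeZero N]

lemma mellin_oddTheta_character (hχ : χ.Odd) {s : ℂ} (hs : 0 < s.re) :
    mellin (oddTheta fun n => χ n) s =
      2 * ((π : ℂ) ^ (-s) * Complex.Gamma s * DirichletCharacter.LFunction χ (2 * s - 1)) := by
  have h := ZMod.LFunction_eq_completed_div_gammaFactor_odd hχ.to_fun (2 * s - 1)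
  have hne : Complex.Gammaℝ (2 * s - 1 + 1) ≠ 0 :=
    Complex.Gammaℝ_ne_zero_of_re_pos (by simpa using hs)
  rw [eq_div_iff hne] at h
  rw [mellin_oddTheta_eq hχ.to_fun, ← h, DirichletCharacter.LFunction, Complex.Gammaℝ_def,
    show -(2 * s - 1 + 1) / 2 = -s by ring, show (2 * s - 1 + 1) / 2 = s by ring]
  ring

/-- The product rule applied to 2π^{-s} Γ(s) L(2s-1, χ). The value G of Γ' stays a parameter because
it is only made explicit at 1 and at 1/2. -/
lemma logMellin_character (hχ : χ.Odd) {s : ℂ} (hs : 0 < s.re) {G : ℂ}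
    (hG : HasDerivAt Complex.Gamma G s) :
    logMellin (fun n => χ n) s = 2 * (π : ℂ) ^ (-s) *
      ((G - log π * Complex.Gamma s) * DirichletCharacter.LFunction χ (2 * s - 1) +
        Complex.Gamma s * (2 * deriv (DirichletCharacter.LFunction χ) (2 * s - 1))) := by
  have hd := (mellin_oddTheta_hasDerivAt (Nat.pos_of_neZero N) (periodic_character χ) s).2
  have hpi : (π : ℂ) ≠ 0 := by exact_mod_cast pi_ne_zero
  have h1 : HasDerivAt (fun s : ℂ => (π : ℂ) ^ (-s)) ((π : ℂ) ^ (-s) * (log π : ℂ) * -1) s := by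
    have := (hasDerivAt_neg s).const_cpow (c := (π : ℂ)) (Or.inl hpi)
    rwa [← Complex.ofReal_log pi_pos.le] at this
  have h2 : HasDerivAt (fun s : ℂ => DirichletCharacter.LFunction χ (2 * s - 1))
      (deriv (DirichletCharacter.LFunction χ) (2 * s - 1) * 2) s := by
    have h3 : HasDerivAt (fun s : ℂ => 2 * s - 1) 2 s := by
      simpa using ((hasDerivAt_id s).const_mul 2).sub_const 1
    exact (DirichletCharacter.differentiable_LFunction (ne_one_of_odd hχ)
      (2 * s - 1)).hasDerivAt.comp s h3
  have h4 := ((h1.mul hG).mul h2).const_mul 2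
  -- The closed formula is available only for Re s > 0, an open set containing the point; that
  -- suffices to identify derivatives.
  have h5 := h4.congr_of_eventuallyEq (f₁ := mellin (oddTheta fun n => χ n)) (by
    filter_upwards [(isOpen_Ioi.preimage Complex.continuous_re).mem_nhds hs] with w hw
    exact mellin_oddTheta_character hχ hw)
  rw [logMellin, hd.unique h5]
  simp only [Pi.mul_apply]
  ring

lemma mellin_oddTheta_character_one (hχ : χ.Odd) :
    mellin (oddTheta fun n => χ n) 1 = 2 / π * DirichletCharacter.LFunction χ 1 := by
  rw [mellin_oddTheta_character hχ (by simp), Complex.cpow_neg_one, Complex.Gamma_one]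
  norm_num
  ring

lemma logMellin_character_one (hχ : χ.Odd) :
    logMellin (fun n => χ n) 1 = 2 / π * (2 * deriv (DirichletCharacter.LFunction χ) 1 -
      (log π + eulerMascheroniConstant) * DirichletCharacter.LFunction χ 1) := by
  rw [logMellin_character hχ (by simp) Complex.hasDerivAt_Gamma_one, Complex.cpow_neg_one,
    Complex.Gamma_one]
  norm_num
  ring

lemma mellin_oddTheta_character_half (hχ : χ.Odd) :
    mellin (oddTheta fun n => χ n) (1 / 2) = 2 * DirichletCharacter.LFunction χ 0 := by
  have h : (π : ℂ) ^ (-(1 / 2 : ℂ)) * (π : ℂ) ^ (1 / 2 : ℂ) = 1 := by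
    rw [← Complex.cpow_add _ _ (by exact_mod_cast pi_ne_zero)]
    simp
  rw [mellin_oddTheta_character hχ (by norm_num), Complex.Gamma_one_half_eq, h]
  norm_num

/-- The term 2 log 2, absent at s = 1, comes from Γ'(1/2) = -√π (γ + 2 log 2). It accounts for the 2
inside log(2tM) in the constant coefficient. -/
lemma logMellin_character_half (hχ : χ.Odd) :
    logMellin (fun n => χ n) (1 / 2) = 2 * (2 * deriv (DirichletCharacter.LFunction χ) 0 -
      (log π + eulerMascheroniConstant + 2 * log 2) * DirichletCharacter.LFunction χ 0) := by
  have h : (π : ℂ) ^ (-(1 / 2 : ℂ)) * (π : ℂ) ^ (1 / 2 : ℂ) = 1 := by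
    rw [← Complex.cpow_add _ _ (by exact_mod_cast pi_ne_zero)]
    simp
  have h2 : ((√π : ℝ) : ℂ) = (π : ℂ) ^ (1 / 2 : ℂ) := by
    rw [sqrt_eq_rpow, Complex.ofReal_cpow pi_pos.le]
    norm_num
  have h3 : Complex.log 2 = (log 2 : ℂ) := by
    rw [← Complex.ofReal_ofNat, ← Complex.ofReal_log (by norm_num)]
  rw [logMellin_character hχ (by norm_num) Complex.hasDerivAt_Gamma_one_half,
    Complex.Gamma_one_half_eq, h2, h3, show 2 * (1 / 2 : ℂ) - 1 = 0 by norm_num]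
  linear_combination (2 * (2 * deriv (DirichletCharacter.LFunction χ) 0 -
      (log π + eulerMascheroniConstant + 2 * log 2) * DirichletCharacter.LFunction χ 0)) * h

end OddCharacters

/-! ### The two-variable theta series and the modularity of its integral -/

section LatticeTheta

/-- The theta series `∑ f(m,n) (m z̄ + n) e^{-πτ|mz+n|²}`. -/
noncomputable def latticeTheta (f : ℤ → ℤ → ℂ) (τ : ℝ) (z : ℍ) : ℂ :=
  ∑' p : ℤ × ℤ, f p.1 p.2 * (p.1 * conj (z : ℂ) + p.2) *
    (exp (-π * τ * ‖(p.1 * z + p.2 : ℂ)‖ ^ 2) : ℝ)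

/-- The theta integral `∫ (a + b log(yτ)) Θ(τ, z) dτ`. -/
noncomputable def thetaLift (a b : ℂ) (f : ℤ → ℤ → ℂ) (z : ℍ) : ℂ :=
  ∫ τ in Ioi (0 : ℝ), (a + b * (log (z.im * τ) : ℂ)) * latticeTheta f τ z

/-- The exponent -3 is chosen because ∑ |mz+n|^{-3} over the lattice converges. At w = 0 both sides
are zero, so the origin needs no separate treatment later. -/
lemma mul_exp_neg_sq_le {c w : ℝ} (hc : 0 < c) (hw : 0 ≤ w) :
    w * exp (-c * w ^ 2) ≤ 2 / c ^ 2 * w ^ (-3 : ℝ) := by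
  rcases hw.eq_or_lt with rfl | hw
  · simp
  have h := pow_div_factorial_le_exp (c * w ^ 2) (by positivity) 2
  rw [neg_mul, exp_neg, show w ^ (-3 : ℝ) = (w ^ 3)⁻¹ by
    rw [rpow_neg hw.le]; norm_cast, ← div_eq_mul_inv, ← div_eq_mul_inv,
    div_le_div_iff₀ (exp_pos _) (by positivity), mul_comm (2 / c ^ 2)]
  have h2 : (c * w ^ 2) ^ 2 ≤ 2 * exp (c * w ^ 2) := by
    rw [div_le_iff₀ (by positivity)] at h
    simpa [Nat.factorial, mul_comm] using h
  calc w * w ^ 3 = (c * w ^ 2) ^ 2 / c ^ 2 := by field_simp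
    _ ≤ 2 * exp (c * w ^ 2) / c ^ 2 := by gcongr
    _ = _ := by ring

lemma norm_mul_conj_add (m n : ℤ) (z : ℂ) : ‖(m * conj z + n : ℂ)‖ = ‖(m * z + n : ℂ)‖ := by
  rw [← Complex.norm_conj]
  simp

lemma summable_latticeTheta {f : ℤ → ℤ → ℂ} {C : ℝ} (hC : ∀ m n, ‖f m n‖ ≤ C) {τ : ℝ} (hτ : 0 < τ)
    (z : ℍ) : Summable fun p : ℤ × ℤ => f p.1 p.2 * (p.1 * conj (z : ℂ) + p.2) *
      (exp (-π * τ * ‖(p.1 * z + p.2 : ℂ)‖ ^ 2) : ℝ) := by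
  have hpi := pi_pos
  have hC0 : 0 ≤ C := (norm_nonneg _).trans (hC 0 0)
  rw [← (finTwoArrowEquiv ℤ).summable_iff]
  refine Summable.of_norm_bounded
    (((EisensteinSeries.summable_one_div_norm_rpow (k := 3) (by norm_num)).mul_left
      (C * (2 / (π * τ) ^ 2 * EisensteinSeries.r z ^ (-3 : ℝ))))) fun x => ?_
  simp only [Function.comp, finTwoArrowEquiv_apply]
  rw [norm_mul, norm_mul, norm_mul_conj_add, Complex.norm_real, norm_of_nonneg (exp_pos _).le]
  have h1 := mul_exp_neg_sq_le (c := π * τ) (by positivity) (norm_nonneg ((x 0 * z + x 1 : ℂ)))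
  have h2 := EisensteinSeries.summand_bound z (k := 3) (by norm_num) x
  rw [mul_assoc, mul_assoc C]
  refine mul_le_mul (hC _ _) ?_ (by positivity) hC0
  rw [neg_mul π τ]
  refine h1.trans ?_
  rw [mul_assoc (2 / (π * τ) ^ 2)]
  gcongr

/-- The action of `SL(2, ℤ)` on functions on `ℤ²`. -/
def latticeAct (f : ℤ → ℤ → ℂ) (γ : SL(2, ℤ)) (m n : ℤ) : ℂ :=
  f (m * γ 1 1 - n * γ 1 0) (n * γ 0 0 - m * γ 0 1)

/-- Right multiplication of row vectors by a matrix in `SL(2, ℤ)`. -/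
def rowMulEquiv (γ : SL(2, ℤ)) : ℤ × ℤ ≃ ℤ × ℤ where
  toFun p := (p.1 * γ 0 0 + p.2 * γ 1 0, p.1 * γ 0 1 + p.2 * γ 1 1)
  invFun p := (p.1 * γ 1 1 - p.2 * γ 1 0, p.2 * γ 0 0 - p.1 * γ 0 1)
  left_inv p := by
    have h := γ.det_coe
    rw [Matrix.det_fin_two] at h
    ext
    · simp only
      linear_combination p.1 * h
    · simp only
      linear_combination p.2 * h
  right_inv p := by
    have h := γ.det_coe
    rw [Matrix.det_fin_two] at h
    ext
    · simp only
      linear_combination p.1 * h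
    · simp only
      linear_combination p.2 * h

lemma coe_smul_eq (γ : SL(2, ℤ)) (z : ℍ) :
    ((γ • z : ℍ) : ℂ) = ((γ 0 0 : ℂ) * z + γ 0 1) / ((γ 1 0 : ℂ) * z + γ 1 1) := by
  rw [UpperHalfPlane.coe_specialLinearGroup_apply]
  simp

lemma denom_ne_zero' (γ : SL(2, ℤ)) (z : ℍ) : (γ 1 0 : ℂ) * z + γ 1 1 ≠ 0 := by
  rw [← ModularGroup.denom_apply]
  exact UpperHalfPlane.denom_ne_zero _ z

lemma im_smul_eq (γ : SL(2, ℤ)) (z : ℍ) :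
    (γ • z : ℍ).im = z.im / ‖(γ 1 0 : ℂ) * z + γ 1 1‖ ^ 2 := by
  rw [ModularGroup.im_smul_eq_div_normSq, ModularGroup.denom_apply, Complex.normSq_eq_norm_sq]

/-- With (m', n') = (m, n)γ one has m γz + n = (m'z + n')/j, so reindexing the lattice moves γ onto
`f`. The linear factor gives 1/j̄ and the Gaussian rescales τ. -/
lemma latticeTheta_smul (f : ℤ → ℤ → ℂ) (γ : SL(2, ℤ)) (τ : ℝ) (z : ℍ) :
    latticeTheta f τ (γ • z) = (conj ((γ 1 0 : ℂ) * z + γ 1 1))⁻¹ *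
      latticeTheta (latticeAct f γ) (τ / ‖(γ 1 0 : ℂ) * z + γ 1 1‖ ^ 2) z := by
  have hne := denom_ne_zero' γ z
  set j : ℂ := (γ 1 0 : ℂ) * z + γ 1 1 with hj
  have hnj : ‖j‖ ≠ 0 := norm_ne_zero_iff.2 hne
  rw [latticeTheta, latticeTheta, ← tsum_mul_left, ← (rowMulEquiv γ).tsum_eq
    (fun p : ℤ × ℤ => (conj j)⁻¹ * _)]
  refine tsum_congr fun p => ?_
  have hf : latticeAct f γ (rowMulEquiv γ p).1 (rowMulEquiv γ p).2 = f p.1 p.2 := by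
    have := (rowMulEquiv γ).left_inv p
    rw [Prod.ext_iff] at this
    rw [latticeAct]
    exact congrArg₂ f this.1 this.2
  have h1 : (p.1 * ((γ • z : ℍ) : ℂ) + p.2 : ℂ) =
      ((rowMulEquiv γ p).1 * z + (rowMulEquiv γ p).2) / j := by
    rw [coe_smul_eq, ← hj]
    field_simp
    simp only [rowMulEquiv, Equiv.coe_fn_mk, hj]
    push_cast
    ring
  have h2 : (p.1 * conj ((γ • z : ℍ) : ℂ) + p.2 : ℂ) =
      (conj j)⁻¹ * ((rowMulEquiv γ p).1 * conj (z : ℂ) + (rowMulEquiv γ p).2) := by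
    have := congrArg conj h1
    simp only [map_add, map_mul, map_div₀, map_intCast] at this
    rw [this]
    ring
  rw [hf, h1, h2, norm_div, show -π * τ * (‖((rowMulEquiv γ p).1 * z + (rowMulEquiv γ p).2 : ℂ)‖ /
    ‖j‖) ^ 2 = -π * (τ / ‖j‖ ^ 2) *
      ‖((rowMulEquiv γ p).1 * z + (rowMulEquiv γ p).2 : ℂ)‖ ^ 2 by field_simp]
  ring

/-- Substituting τ ↦ |j|²τ leaves the weight a + b log(yτ) intact, because Im γz = y/|j|². The
Jacobian |j|² times 1/j̄ is j. -/
lemma thetaLift_smul (a b : ℂ) (f : ℤ → ℤ → ℂ) (γ : SL(2, ℤ)) (z : ℍ) :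
    thetaLift a b f (γ • z) =
      ((γ 1 0 : ℂ) * z + γ 1 1) * thetaLift a b (latticeAct f γ) z := by
  have hne := denom_ne_zero' γ z
  rw [thetaLift, thetaLift, im_smul_eq]
  simp_rw [latticeTheta_smul]
  set j : ℂ := (γ 1 0 : ℂ) * z + γ 1 1 with hj
  have hnj : 0 < ‖j‖ := norm_pos_iff.2 hne
  set H : ℝ → ℂ := fun τ => (conj j)⁻¹ * ((a + b * (log (z.im * τ) : ℂ)) *
    latticeTheta (latticeAct f γ) τ z) with hH
  have e : ∀ τ : ℝ, (a + b * (log (z.im / ‖j‖ ^ 2 * τ) : ℂ)) * ((conj j)⁻¹ *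
      latticeTheta (latticeAct f γ) (τ / ‖j‖ ^ 2) z) = H ((‖j‖ ^ 2)⁻¹ * τ) := by
    intro τ
    simp only [hH]
    rw [show (‖j‖ ^ 2)⁻¹ * τ = τ / ‖j‖ ^ 2 by ring,
      show z.im / ‖j‖ ^ 2 * τ = z.im * (τ / ‖j‖ ^ 2) by ring]
    ring
  simp_rw [e]
  rw [integral_comp_mul_left_Ioi H 0 (by positivity), mul_zero, inv_inv, hH, integral_const_mul,
    Complex.real_smul, ← mul_assoc]
  congr 1
  have hcj : conj j ≠ 0 := by simpa using hne
  rw [Complex.ofReal_pow, ← Complex.mul_conj']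
  field_simp

end LatticeTheta

/-! ### Fourier expansion of the lattice theta series -/

section Expansion

/-- Odd functions on `ℤ²` that are periodic in each variable. -/
structure IsOddPeriodic (P N : ℕ) (f : ℤ → ℤ → ℂ) : Prop where
  odd : ∀ m n, f (-m) (-n) = -f m n
  periodic_left : ∀ m n, f (m + P) n = f m n
  periodic_right : ∀ m n, f m (n + N) = f m n

lemma periodic_eq_toNat_emod {E : Type*} {g : ℤ → E} {N : ℕ} (hN : 0 < N)
    (hg : Function.Periodic g (N : ℤ)) (n : ℤ) : g n = g ((n % N).toNat : ℤ) := by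
  have hN' : (0 : ℤ) < N := by exact_mod_cast hN
  rw [Int.toNat_of_nonneg (Int.emod_nonneg n hN'.ne')]
  have h := hg.int_mul (n / N) (n % N)
  rw [Int.cast_id, mul_comm, Int.emod_add_mul_ediv] at h
  exact h

lemma toNat_emod_mem_range {N : ℕ} (hN : 0 < N) (n : ℤ) : (n % N).toNat ∈ Finset.range N := by
  have hN' : (0 : ℤ) < N := by exact_mod_cast hN
  rw [Finset.mem_range]
  have := Int.emod_lt_of_pos n hN'
  have := Int.emod_nonneg n hN'.ne'
  omega

lemma exists_norm_le_of_periodic {E : Type*} [NormedAddCommGroup E] {g : ℤ → E} {N : ℕ}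
    (hN : 0 < N) (hg : Function.Periodic g (N : ℤ)) : ∃ C, ∀ n, ‖g n‖ ≤ C := by
  refine ⟨∑ a ∈ Finset.range N, ‖g a‖, fun n => ?_⟩
  rw [periodic_eq_toNat_emod hN hg n]
  exact Finset.single_le_sum (f := fun a : ℕ => ‖g a‖) (fun a _ => norm_nonneg _)
    (toNat_emod_mem_range hN n)

lemma hasSum_pnat_of_int {E : Type*} [AddCommGroup E] [TopologicalSpace E] [IsTopologicalAddGroup E]
    {f : ℤ → E} {s : E} (h : HasSum f s) :
    HasSum (fun n : ℕ+ => f (n : ℕ) + f (-((n : ℕ) : ℤ))) (s - f 0) := by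
  have h1 := h.nat_add_neg
  rw [hasSum_pnat_iff (f := fun n : ℕ => f n + f (-(n : ℤ)))]
  convert h1 using 1
  simp

lemma summable_pnat_mul_exp {c : ℝ} (hc : 0 < c) :
    Summable fun n : ℕ+ => (n : ℝ) * exp (-c * n) := by
  have h := Real.summable_pow_mul_exp_neg_nat_mul 1 hc
  have h2 := h.comp_injective PNat.coe_injective
  refine h2.congr fun n => ?_
  simp

lemma summable_pnat_prod_mul_exp {c d : ℝ} (hc : 0 < c) (hd : 0 < d) :
    Summable fun p : ℕ+ × ℕ+ => ((p.1 : ℝ) * exp (-c * p.1)) * ((p.2 : ℝ) * exp (-d * p.2)) :=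
  (summable_pnat_mul_exp hc).mul_of_nonneg (summable_pnat_mul_exp hd)
    (fun _ => by positivity) (fun _ => by positivity)

lemma abs_besselKernel_le {A ν τ : ℝ} (hA : 0 ≤ A) (hτ : 0 < τ) :
    |besselKernel A ν τ| ≤
      (A / √τ + |ν| / (τ * √τ)) * (exp (-π * τ * A ^ 2) * exp (-π * ν ^ 2 / τ)) := by
  have hs := sqrt_pos.2 hτ
  rw [besselKernel, abs_mul, abs_of_pos (exp_pos _), ← exp_add,
    show -π * τ * A ^ 2 + -π * ν ^ 2 / τ = -π * (τ * A ^ 2 + ν ^ 2 / τ) by ring]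
  gcongr
  refine (abs_add_le _ _).trans (le_of_eq ?_)
  rw [abs_div, abs_div, abs_of_nonneg hA, abs_of_pos hs, abs_of_pos (by positivity : 0 < τ * √τ)]

lemma one_le_pnat (n : ℕ+) : (1 : ℝ) ≤ n := Nat.one_le_cast.2 n.pos

/-- For positive integers k ≤ k², so the Gaussian factors are at most exponentials linear in each
index, and the prefactor is at most a constant times the product of the indices. -/
lemma summable_abs_besselKernel {y τ : ℝ} (hy : 0 < y) (hτ : 0 < τ) {N : ℕ} (hN : 0 < N) (ε : ℝ)
    (hε : |ε| = 1) :
    Summable fun p : ℕ+ × ℕ+ => |besselKernel (p.1 * y) (ε * p.2 / N) τ| := by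
  have hpi := pi_pos
  have hN' : (0 : ℝ) < N := by exact_mod_cast hN
  have hs := sqrt_pos.2 hτ
  refine Summable.of_nonneg_of_le (fun _ => abs_nonneg _) (fun p => ?_)
    ((summable_pnat_prod_mul_exp (c := π * τ * y ^ 2) (d := π / (N ^ 2 * τ)) (by positivity)
      (by positivity)).mul_left (y / √τ + 1 / (N * (τ * √τ))))
  have h1 := one_le_pnat p.1
  have h2 := one_le_pnat p.2
  refine (abs_besselKernel_le (by positivity) hτ).trans ?_
  have hε2 : ε ^ 2 = 1 := by rw [← sq_abs, hε, one_pow]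
  have e1 : exp (-π * τ * ((p.1 : ℝ) * y) ^ 2) ≤ exp (-(π * τ * y ^ 2) * p.1) := by
    rw [exp_le_exp]
    have : (p.1 : ℝ) ≤ (p.1 : ℝ) ^ 2 := by nlinarith
    have h3 : 0 < π * τ * y ^ 2 := by positivity
    nlinarith
  have e2 : exp (-π * (ε * p.2 / N) ^ 2 / τ) ≤ exp (-(π / (N ^ 2 * τ)) * p.2) := by
    rw [exp_le_exp, div_pow, mul_pow, hε2, one_mul,
      show -π * ((p.2 : ℝ) ^ 2 / N ^ 2) / τ = -(π / (N ^ 2 * τ)) * (p.2 : ℝ) ^ 2 by field_simp]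
    have : (p.2 : ℝ) ≤ (p.2 : ℝ) ^ 2 := by nlinarith
    have h3 : 0 < π / (N ^ 2 * τ) := by positivity
    nlinarith
  have e3 : (p.1 : ℝ) * y / √τ + |ε * p.2 / N| / (τ * √τ) ≤
      (y / √τ + 1 / (N * (τ * √τ))) * (p.1 * p.2) := by
    rw [abs_div, abs_mul, hε, one_mul, abs_of_pos hN', abs_of_pos (by linarith), add_mul]
    have e4 : (p.1 : ℝ) * y / √τ ≤ y / √τ * (p.1 * p.2) := by
      rw [show y / √τ * ((p.1 : ℝ) * p.2) = (p.1 : ℝ) * y / √τ * p.2 by ring]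
      exact le_mul_of_one_le_right (by positivity) h2
    have e5 : (p.2 : ℝ) / N / (τ * √τ) ≤ 1 / (N * (τ * √τ)) * (p.1 * p.2) := by
      rw [show 1 / (N * (τ * √τ)) * ((p.1 : ℝ) * p.2) = (p.2 : ℝ) / N / (τ * √τ) * p.1 by
        field_simp]
      exact le_mul_of_one_le_right (by positivity) h1
    exact add_le_add e4 e5
  calc _ ≤ (y / √τ + 1 / (N * (τ * √τ))) * (p.1 * p.2) *
        (exp (-(π * τ * y ^ 2) * p.1) * exp (-(π / (N ^ 2 * τ)) * p.2)) := by gcongr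
    _ = _ := by ring

variable {P N : ℕ} {f : ℤ → ℤ → ℂ}

lemma IsOddPeriodic.exists_norm_le (hf : IsOddPeriodic P N f) (hP : 0 < P) (hN : 0 < N) :
    ∃ C, ∀ m n, ‖f m n‖ ≤ C := by
  have h1 : ∀ m, ∃ C, ∀ n, ‖f m n‖ ≤ C := fun m =>
    exists_norm_le_of_periodic hN (hf.periodic_right m)
  choose C hC using h1
  refine ⟨∑ a ∈ Finset.range P, C a, fun m n => ?_⟩
  have h2 : f m n = f ((m % P).toNat : ℤ) n :=
    periodic_eq_toNat_emod hP (g := fun m => f m n) (fun m => hf.periodic_left m n) m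
  rw [h2]
  exact (hC _ n).trans (Finset.single_le_sum (f := fun a : ℕ => C a)
    (fun a _ => (norm_nonneg _).trans (hC a 0)) (toNat_emod_mem_range hP m))

/-- The zeroth Fourier coefficient of a function on `ℤ²` in the second variable. -/
noncomputable def rowSum (N : ℕ) (f : ℤ → ℤ → ℂ) (m : ℤ) : ℂ := periodicDFT N (f m) 0

lemma rowSum_periodic (hf : IsOddPeriodic P N f) : Function.Periodic (rowSum N f) (P : ℤ) := by
  intro m
  simp only [rowSum, periodicDFT]
  simp_rw [hf.periodic_left]

lemma sum_range_neg {g : ℤ → ℂ} (hN : 0 < N) (hg : Function.Periodic g (N : ℤ)) :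
    ∑ a ∈ Finset.range N, g (-(a : ℤ)) = ∑ a ∈ Finset.range N, g a := by
  obtain ⟨n, rfl⟩ : ∃ n, N = n + 1 := ⟨N - 1, by omega⟩
  rw [Finset.sum_range_succ', Finset.sum_range_succ', ← Finset.sum_range_reflect]
  congr 1
  refine Finset.sum_congr rfl fun a ha => ?_
  rw [← hg]
  congr 1
  have := Finset.mem_range.1 ha
  omega

lemma rowSum_neg (hN : 0 < N) (hf : IsOddPeriodic P N f) (m : ℤ) :
    rowSum N f (-m) = -rowSum N f m := by
  simp only [rowSum, periodicDFT, Int.cast_zero, mul_zero, zero_div, Complex.exp_zero, mul_one]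
  rw [← Finset.sum_neg_distrib, ← sum_range_neg hN (hf.periodic_right (-m))]
  refine Finset.sum_congr rfl fun a _ => hf.odd m a

/-- The terms of the Fourier expansion of the theta series, for fixed `τ`. -/
noncomputable def thetaTerm (N : ℕ) (f : ℤ → ℤ → ℂ) (z : ℍ) (m ξ : ℤ) (τ : ℝ) : ℂ :=
  periodicDFT N (f m) ξ * Complex.exp (2 * π * Complex.I * ξ * (m * z.re : ℝ) / N) *
    (besselKernel (m * z.im) (ξ / N) τ : ℂ)

lemma hasSum_latticeTheta_row (hf : IsOddPeriodic P N f) (hN : 0 < N) {τ : ℝ}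
    (hτ : 0 < τ) (z : ℍ) (m : ℤ) : ∃ S : ℂ,
    HasSum (fun n : ℤ => f m n * (m * conj (z : ℂ) + n) *
      (exp (-π * τ * ‖(m * z + n : ℂ)‖ ^ 2) : ℝ)) S ∧
    HasSum (fun ξ : ℤ => -Complex.I / N * thetaTerm N f z m ξ τ) S := by
  obtain ⟨S, h1, h2⟩ := poisson_periodic hN (hf.periodic_right m) (m * z.re) (m * z.im) hτ
  refine ⟨S, h1.congr_fun fun n => ?_, h2.congr_fun fun ξ => ?_⟩
  · have e1 : (m * conj (z : ℂ) + n : ℂ) =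
        ((m * z.re + n : ℝ) : ℂ) - Complex.I * ((m * z.im : ℝ) : ℂ) := by
      apply Complex.ext <;> simp
    have e2 : ‖(m * z + n : ℂ)‖ ^ 2 = (m * z.re + n) ^ 2 + (m * z.im) ^ 2 := by
      rw [← Complex.normSq_eq_norm_sq, Complex.normSq_apply]
      simp
      ring
    rw [e1, e2]
  · rw [thetaTerm]
    ring

lemma summable_thetaTerm (hf : IsOddPeriodic P N f) (hP : 0 < P) (hN : 0 < N) {τ : ℝ}
    (hτ : 0 < τ) (z : ℍ) (ε : ℤ) (hε : |ε| = 1) :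
    Summable fun p : ℕ+ × ℕ+ => thetaTerm N f z (p.1 : ℕ) (ε * (p.2 : ℕ)) τ := by
  obtain ⟨C, hC⟩ := hf.exists_norm_le hP hN
  refine Summable.of_norm_bounded
    ((summable_abs_besselKernel z.im_pos hτ hN (ε : ℝ) (by exact_mod_cast hε)).mul_left (N * C))
    fun p => ?_
  rw [thetaTerm, norm_mul, norm_mul, Complex.norm_real, norm_eq_abs]
  rw [show (2 * π * Complex.I * ((ε * (p.2 : ℕ) : ℤ) : ℂ) * ((((p.1 : ℕ) : ℤ) * z.re : ℝ) : ℂ) / N) =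
    ((2 * π * ((ε * (p.2 : ℕ) : ℤ) : ℝ) * (((p.1 : ℕ) : ℤ) * z.re) / N : ℝ) : ℂ) * Complex.I by
      push_cast; ring, Complex.norm_exp_ofReal_mul_I, mul_one]
  push_cast
  gcongr
  exact norm_periodicDFT_le (hC _) _

lemma besselKernel_zero (A τ : ℝ) : besselKernel A 0 τ = A / √τ * exp (-π * τ * A ^ 2) := by
  rw [besselKernel]
  simp only [zero_div, add_zero, ne_eq, OfNat.ofNat_ne_zero, not_false_eq_true, zero_pow]
  ring_nf

/-- Rows m and -m agree by oddness (replace n by -n), so only row 0 and twice the rows m > 0 remain.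
Poisson summation on the latter separates frequency 0, which assembles into a theta series in m,
from the positive and the negative frequencies. -/
lemma latticeTheta_eq (hf : IsOddPeriodic P N f) (hP : 0 < P) (hN : 0 < N) {τ : ℝ}
    (hτ : 0 < τ) (z : ℍ) :
    latticeTheta f τ z = oddTheta (f 0) τ -
      Complex.I / N * ((z.im / √τ : ℝ) * oddTheta (rowSum N f) (z.im ^ 2 * τ)) -
      2 * Complex.I / N * (∑' p : ℕ+ × ℕ+, thetaTerm N f z (p.1 : ℕ) (p.2 : ℕ) τ +
        ∑' p : ℕ+ × ℕ+, thetaTerm N f z (p.1 : ℕ) (-((p.2 : ℕ) : ℤ)) τ) := by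
  obtain ⟨C, hC⟩ := hf.exists_norm_le hP hN
  choose S hS1 hS2 using hasSum_latticeTheta_row hf hN hτ z
  have h1 : HasSum S (latticeTheta f τ z) :=
    (summable_latticeTheta hC hτ z).hasSum.prod_fiberwise hS1
  have hS0 : S 0 = oddTheta (f 0) τ := by
    refine (hS1 0).unique ?_
    refine (hasSum_oddTheta hN (hf.periodic_right 0) hτ).congr_fun fun n => ?_
    rw [show -π * (n : ℝ) ^ 2 * τ = -π * τ * ‖((0 : ℤ) * z + n : ℂ)‖ ^ 2 by
      simp; ring]
    simp
  have hSneg : ∀ m, S (-m) = S m := by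
    intro m
    refine (hS1 (-m)).unique ?_
    rw [← (Equiv.neg ℤ).hasSum_iff]
    refine (hS1 m).congr_fun fun n => ?_
    simp only [Function.comp, Equiv.neg_apply, hf.odd]
    rw [show (((-m : ℤ) : ℂ) * z + ((-n : ℤ) : ℂ)) = -(m * z + n) by push_cast; ring, norm_neg]
    push_cast
    ring
  have h2 := hasSum_pnat_of_int h1
  simp only [hSneg, hS0] at h2
  have hT : ∀ m : ℕ+, HasSum (fun ξ : ℕ+ => thetaTerm N f z (m : ℕ) (ξ : ℕ) τ +
      thetaTerm N f z (m : ℕ) (-((ξ : ℕ) : ℤ)) τ)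
      (Complex.I * N * S m - thetaTerm N f z (m : ℕ) 0 τ) := by
    intro m
    have hNC : (N : ℂ) ≠ 0 := by exact_mod_cast hN.ne'
    have h3 := (hS2 (m : ℕ)).mul_left (Complex.I * N)
    have h4 : HasSum (fun ξ : ℤ => thetaTerm N f z (m : ℕ) ξ τ) (Complex.I * N * S m) := by
      refine h3.congr_fun fun ξ => ?_
      have : Complex.I * N * (-Complex.I / N * thetaTerm N f z (m : ℕ) ξ τ) =
        -(Complex.I * Complex.I) * thetaTerm N f z (m : ℕ) ξ τ := by field_simp
      rw [this, Complex.I_mul_I]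
      ring
    exact hasSum_pnat_of_int h4
  have hsp := summable_thetaTerm hf hP hN hτ z 1 (by norm_num)
  have hsm := summable_thetaTerm hf hP hN hτ z (-1) (by norm_num)
  simp only [one_mul, neg_mul] at hsp hsm
  have h5 : HasSum _ _ := (hsp.hasSum.add hsm.hasSum).prod_fiberwise hT
  have h6 := hasSum_pnat_of_int (hasSum_oddTheta hP (rowSum_periodic hf)
    (τ := z.im ^ 2 * τ) (by have := z.im_pos; positivity))
  have h7 : HasSum (fun m : ℕ+ => thetaTerm N f z (m : ℕ) 0 τ)
      ((z.im / √τ : ℝ) * oddTheta (rowSum N f) (z.im ^ 2 * τ) / 2) := by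
    have h8 := (h6.mul_left ((z.im / √τ : ℝ) : ℂ)).div_const 2
    simp only [Int.cast_zero, mul_zero, zero_mul, sub_zero] at h8
    refine h8.congr_fun fun m => ?_
    rw [rowSum_neg hN hf, thetaTerm, ← rowSum, Int.cast_zero, Int.cast_zero,
      zero_div (N : ℝ), besselKernel_zero]
    simp only [mul_zero, zero_mul, zero_div, Complex.exp_zero, mul_one]
    rw [show -π * τ * ((((m : ℕ) : ℤ) : ℝ) * z.im) ^ 2 =
      -π * (((m : ℕ) : ℤ) : ℝ) ^ 2 * (z.im ^ 2 * τ) by ring]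
    push_cast
    simp only [neg_sq]
    ring
  have hNC : (N : ℂ) ≠ 0 := by exact_mod_cast hN.ne'
  have h9 := ((h5.add h7).mul_left (-(2 * Complex.I) / N))
  have h10 : HasSum (fun m : ℕ+ => S (m : ℕ) + S (m : ℕ)) _ := h9.congr_fun fun m => by
    rw [sub_add_cancel]
    have : -(2 * Complex.I) / N * (Complex.I * N * S (m : ℕ)) =
      -(Complex.I * Complex.I) * (2 * S (m : ℕ)) := by field_simp
    rw [this, Complex.I_mul_I]
    ring
  have h11 := h2.unique h10
  rw [sub_eq_iff_eq_add] at h11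
  rw [h11]
  ring

end Expansion

/-! ### Termwise integration and growth at infinity -/

section LiftExpansion

lemma integrable_tsum_of_summable_integral_norm {α ι E : Type*} [MeasurableSpace α]
    {μ : Measure α} [NormedAddCommGroup E] [Countable ι] {F : ι → α → E}
    (hF : ∀ i, Integrable (F i) μ) (hs : Summable fun i => ∫ a, ‖F i a‖ ∂μ)
    (hp : ∀ᵐ a ∂μ, Summable fun i => F i a) : Integrable (fun a => ∑' i, F i a) μ := by
  have hlim : ∀ᵐ a ∂μ, Tendsto (fun s : Finset ι => ∑ i ∈ s, F i a) atTop (𝓝 (∑' i, F i a)) := by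
    filter_upwards [hp] with a ha using ha.hasSum
  refine ⟨aestronglyMeasurable_of_tendsto_ae atTop
    (fun s => Finset.aestronglyMeasurable_fun_sum s fun i _ => (hF i).1) hlim, ?_⟩
  have h1 : ∀ i, ∫⁻ a, ‖F i a‖ₑ ∂μ = ENNReal.ofReal (∫ a, ‖F i a‖ ∂μ) := fun i => by
    rw [ofReal_integral_norm_eq_lintegral_enorm (hF i)]
  calc ∫⁻ a, ‖∑' i, F i a‖ₑ ∂μ ≤ ∫⁻ a, ∑' i, ‖F i a‖ₑ ∂μ := by
        refine lintegral_mono_ae ?_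
        filter_upwards with a using enorm_tsum_le_tsum_enorm
    _ = ∑' i, ENNReal.ofReal (∫ a, ‖F i a‖ ∂μ) := by
        rw [lintegral_tsum fun i => (hF i).1.enorm]
        simp_rw [h1]
    _ < ⊤ := by
        rw [← ENNReal.ofReal_tsum_of_nonneg (fun i => integral_nonneg fun _ => norm_nonneg _) hs]
        exact ENNReal.ofReal_lt_top

/-- The exponential integral `∫_y^∞ e^{-4πru} du/u`. -/
noncomputable def expIntegral (r y : ℝ) : ℝ := ∫ u in Ioi y, exp (-(4 * π * r * u)) * u⁻¹

/-- The terms of the holomorphic part of the theta integral. -/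
noncomputable def posTerm (a b : ℂ) (N : ℕ) (f : ℤ → ℤ → ℂ) (z : ℍ) (p : ℕ+ × ℕ+) : ℂ :=
  periodicDFT N (f (p.1 : ℕ)) (p.2 : ℕ) * (a + b * (log (p.2 / (N * p.1)) : ℂ)) *
    Complex.exp (2 * π * Complex.I * (p.1 * p.2 / N : ℝ) * z)

/-- The terms of the nonholomorphic part of the theta integral. -/
noncomputable def negTerm (N : ℕ) (f : ℤ → ℤ → ℂ) (z : ℍ) (p : ℕ+ × ℕ+) : ℂ :=
  periodicDFT N (f (p.1 : ℕ)) (-((p.2 : ℕ) : ℤ)) * (expIntegral (p.1 * p.2 / N) z.im : ℂ) *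
    Complex.exp (-(2 * π * Complex.I * (p.1 * p.2 / N : ℝ) * z))

/-- A bound for the weighted integrals of the terms of the theta series. -/
noncomputable def pairBound (a b : ℂ) (N : ℕ) (y : ℝ) (p : ℕ+ × ℕ+) : ℝ :=
  exp (-(2 * π * (p.1 * p.2 / N * y))) * (2 * (‖a‖ + ‖b‖ * |log (p.2 / (N * p.1))|) +
    2 * ‖b‖ / (π * √(p.1 * p.2 / N * y)))

lemma pairBound_nonneg (a b : ℂ) (N : ℕ) (y : ℝ) (p : ℕ+ × ℕ+) : 0 ≤ pairBound a b N y p := by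
  have := pi_pos
  rw [pairBound]
  positivity

lemma add_le_two_mul_mul {m n : ℝ} (hm : 1 ≤ m) (hn : 1 ≤ n) : m + n ≤ 2 * (m * n) := by
  nlinarith [mul_nonneg (sub_nonneg.2 hm) (sub_nonneg.2 hn)]

lemma abs_log_div_le {N : ℕ} (hN : 0 < N) (p : ℕ+ × ℕ+) :
    |log (p.2 / (N * p.1))| ≤ (N + 2) * ((p.1 : ℝ) * p.2) := by
  have h1 := one_le_pnat p.1
  have h2 := one_le_pnat p.2
  have hN' : (1 : ℝ) ≤ N := by exact_mod_cast hN
  have l1 := log_le_sub_one_of_pos (lt_of_lt_of_le one_pos h1)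
  have l2 := log_le_sub_one_of_pos (lt_of_lt_of_le one_pos h2)
  have l3 := log_le_sub_one_of_pos (lt_of_lt_of_le one_pos hN')
  have k1 := log_nonneg h1
  have k2 := log_nonneg h2
  have k3 := log_nonneg hN'
  have h3 := add_le_two_mul_mul h1 h2
  have h4 : (1 : ℝ) ≤ p.1 * p.2 := by nlinarith
  rw [log_div (by positivity) (by positivity), log_mul (by positivity) (by positivity), abs_le]
  constructor <;> nlinarith

/-- The inequality m + n ≤ 2mn splits the exponential of the product into exponentials of the two
indices; the logarithm and the constants grow at most like mn. -/
lemma summable_pairBound (a b : ℂ) {N : ℕ} (hN : 0 < N) {y : ℝ} (hy : 0 < y) :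
    Summable (pairBound a b N y) := by
  have hpi := pi_pos
  have hN' : (0 : ℝ) < N := by exact_mod_cast hN
  refine Summable.of_nonneg_of_le (pairBound_nonneg a b N y) (fun p => ?_)
    ((summable_pnat_prod_mul_exp (c := π * y / N) (d := π * y / N) (by positivity)
      (by positivity)).mul_left
      (2 * (‖a‖ + ‖b‖ * (N + 2)) + 2 * ‖b‖ / (π * √(y / N))))
  have h1 := one_le_pnat p.1
  have h2 := one_le_pnat p.2
  have h4 : (1 : ℝ) ≤ p.1 * p.2 := by nlinarith
  have e1 : exp (-(2 * π * (p.1 * p.2 / N * y))) ≤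
      exp (-(π * y / N) * p.1) * exp (-(π * y / N) * p.2) := by
    rw [← exp_add, exp_le_exp, show 2 * π * ((p.1 : ℝ) * p.2 / N * y) =
      π * y / N * (2 * (p.1 * p.2)) by ring]
    have := mul_le_mul_of_nonneg_left (add_le_two_mul_mul h1 h2)
      (by positivity : 0 ≤ π * y / N)
    linarith
  have e2 : √(y / N) ≤ √(p.1 * p.2 / N * y) := by
    refine sqrt_le_sqrt ?_
    rw [show (p.1 : ℝ) * p.2 / N * y = (p.1 * p.2) * (y / N) by ring]
    exact le_mul_of_one_le_left (by positivity) h4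
  have e3 := abs_log_div_le hN p
  have e4 : 0 < √(y / N) := sqrt_pos.2 (by positivity)
  have e5 : 2 * (‖a‖ + ‖b‖ * |log (p.2 / (N * p.1))|) + 2 * ‖b‖ / (π * √(p.1 * p.2 / N * y)) ≤
      (2 * (‖a‖ + ‖b‖ * (N + 2)) + 2 * ‖b‖ / (π * √(y / N))) * ((p.1 : ℝ) * p.2) := by
    have f1 : ‖a‖ ≤ ‖a‖ * ((p.1 : ℝ) * p.2) := le_mul_of_one_le_right (norm_nonneg _) h4
    have f2 : ‖b‖ * |log (p.2 / (N * p.1))| ≤ ‖b‖ * (N + 2) * ((p.1 : ℝ) * p.2) := by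
      rw [mul_assoc]; gcongr
    have f3 : 2 * ‖b‖ / (π * √(p.1 * p.2 / N * y)) ≤ 2 * ‖b‖ / (π * √(y / N)) := by gcongr
    have f4 : 2 * ‖b‖ / (π * √(y / N)) ≤ 2 * ‖b‖ / (π * √(y / N)) * ((p.1 : ℝ) * p.2) :=
      le_mul_of_one_le_right (by positivity) h4
    linarith
  calc pairBound a b N y p ≤ (exp (-(π * y / N) * p.1) * exp (-(π * y / N) * p.2)) *
        ((2 * (‖a‖ + ‖b‖ * (N + 2)) + 2 * ‖b‖ / (π * √(y / N))) * ((p.1 : ℝ) * p.2)) := by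
        rw [pairBound]; gcongr
    _ = _ := by ring

lemma pairBound_le_of_one_le (a b : ℂ) {N : ℕ} (hN : 0 < N) {y : ℝ} (hy : 1 ≤ y) (p : ℕ+ × ℕ+) :
    pairBound a b N y p ≤ pairBound a b N 1 p := by
  have hpi := pi_pos
  have hN' : (0 : ℝ) < N := by exact_mod_cast hN
  have h1 := one_le_pnat p.1
  have h2 := one_le_pnat p.2
  have h3 : (p.1 : ℝ) * p.2 / N * 1 ≤ p.1 * p.2 / N * y := by gcongr
  have h4 : 0 < √((p.1 : ℝ) * p.2 / N * 1) := sqrt_pos.2 (by positivity)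
  rw [pairBound, pairBound]
  gcongr

variable {P N : ℕ} {f : ℤ → ℤ → ℂ}

lemma weighted_thetaTerm (hN : 0 < N) (a b : ℂ) (z : ℍ) (p : ℕ+ × ℕ+) (ε : ℤ) (hε : |ε| = 1) {C : ℝ}
    (hC : ∀ m n, ‖f m n‖ ≤ C) :
    IntegrableOn (fun τ : ℝ => (a + b * (log (z.im * τ) : ℂ)) *
      thetaTerm N f z (p.1 : ℕ) (ε * (p.2 : ℕ)) τ) (Ioi 0) ∧
    ∫ τ in Ioi (0 : ℝ), ‖(a + b * (log (z.im * τ) : ℂ)) *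
      thetaTerm N f z (p.1 : ℕ) (ε * (p.2 : ℕ)) τ‖ ≤ N * C * pairBound a b N z.im p := by
  have hN' : (0 : ℝ) < N := by exact_mod_cast hN
  have h1 := one_le_pnat p.1
  have h2 := one_le_pnat p.2
  have hy := z.im_pos
  have hA : 0 < (((p.1 : ℕ) : ℤ) : ℝ) * z.im := by push_cast; positivity
  have hν : 0 < (p.2 : ℝ) / N := by positivity
  have hε' : ((ε * (p.2 : ℕ) : ℤ) : ℝ) / N = p.2 / N ∨ ((ε * (p.2 : ℕ) : ℤ) : ℝ) / N = -(p.2 / N) := by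
    rcases eq_or_eq_neg_of_abs_eq hε with rfl | rfl
    · left; push_cast; ring
    · right; push_cast; ring
  set d := periodicDFT N (f (p.1 : ℕ)) (ε * (p.2 : ℕ)) *
    Complex.exp (2 * π * Complex.I * ((ε * (p.2 : ℕ) : ℤ) : ℂ) * ((((p.1 : ℕ) : ℤ) * z.re : ℝ) : ℂ) / N)
    with hd
  have hdn : ‖d‖ ≤ N * C := by
    rw [hd, norm_mul, show (2 * π * Complex.I * ((ε * (p.2 : ℕ) : ℤ) : ℂ) *
      ((((p.1 : ℕ) : ℤ) * z.re : ℝ) : ℂ) / N) = ((2 * π * ((ε * (p.2 : ℕ) : ℤ) : ℝ) *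
        (((p.1 : ℕ) : ℤ) * z.re) / N : ℝ) : ℂ) * Complex.I by
      push_cast; ring, Complex.norm_exp_ofReal_mul_I, mul_one]
    exact norm_periodicDFT_le (hC _) _
  have e : ∀ τ : ℝ, (a + b * (log (z.im * τ) : ℂ)) *
      thetaTerm N f z (p.1 : ℕ) (ε * (p.2 : ℕ)) τ = d * ((a + b * (log (z.im * τ) : ℂ)) *
      (besselKernel ((((p.1 : ℕ) : ℤ) : ℝ) * z.im) (((ε * (p.2 : ℕ) : ℤ) : ℝ) / N) τ : ℂ)) := by
    intro τ
    rw [thetaTerm, hd]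
    ring
  simp_rw [e]
  refine ⟨(integrableOn_weighted_besselKernel hA hν hy a b _ hε').const_mul d, ?_⟩
  simp_rw [norm_mul d]
  rw [integral_const_mul]
  have h3 := integral_norm_weighted_besselKernel_le hA hν hy a b _ hε'
  have h4 : exp (-(2 * π * ((((p.1 : ℕ) : ℤ) : ℝ) * z.im * (p.2 / N)))) *
        (2 * (‖a‖ + ‖b‖ * |log (z.im * (p.2 / N / ((((p.1 : ℕ) : ℤ) : ℝ) * z.im)))|) +
          2 * ‖b‖ / (π * √((((p.1 : ℕ) : ℤ) : ℝ) * z.im * (p.2 / N)))) =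
      pairBound a b N z.im p := by
    rw [pairBound]
    push_cast
    rw [show (p.1 : ℝ) * z.im * (p.2 / N) = p.1 * p.2 / N * z.im by ring,
      show z.im * ((p.2 : ℝ) / N / (p.1 * z.im)) = p.2 / (N * p.1) by field_simp]
  rw [h4] at h3
  exact mul_le_mul hdn h3 (integral_nonneg fun _ => norm_nonneg _) ((norm_nonneg d).trans hdn)

lemma integral_weighted_thetaTerm_pos (hN : 0 < N) (a b : ℂ) (z : ℍ) (p : ℕ+ × ℕ+) :
    ∫ τ in Ioi (0 : ℝ), (a + b * (log (z.im * τ) : ℂ)) *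
      thetaTerm N f z (p.1 : ℕ) (p.2 : ℕ) τ = 2 * posTerm a b N f z p := by
  have hN' : (0 : ℝ) < N := by exact_mod_cast hN
  have h1 := one_le_pnat p.1
  have h2 := one_le_pnat p.2
  have hy := z.im_pos
  have hA : 0 < (p.1 : ℝ) * z.im := by positivity
  have hν : 0 < (p.2 : ℝ) / N := by positivity
  have e : ∀ τ : ℝ, (a + b * (log (z.im * τ) : ℂ)) *
      thetaTerm N f z (p.1 : ℕ) (p.2 : ℕ) τ = (periodicDFT N (f (p.1 : ℕ)) (p.2 : ℕ) *
    Complex.exp (2 * π * Complex.I * p.2 * (p.1 * z.re) / N)) * ((a + b * (log (z.im * τ) : ℂ)) *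
      (besselKernel (p.1 * z.im) (p.2 / N) τ : ℂ)) := by
    intro τ
    rw [thetaTerm]
    push_cast
    ring
  simp_rw [e]
  rw [integral_const_mul, integral_weighted_besselKernel hA hν hy, posTerm]
  rw [show z.im * ((p.2 : ℝ) / N / (p.1 * z.im)) = p.2 / (N * p.1) by field_simp]
  have e2 : Complex.exp (2 * π * Complex.I * p.2 * (p.1 * z.re) / N) *
      (exp (-(2 * π * (p.1 * z.im * (p.2 / N)))) : ℝ) =
      Complex.exp (2 * π * Complex.I * (p.1 * p.2 / N : ℝ) * z) := by
    rw [Complex.ofReal_exp, ← Complex.exp_add]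
    congr 1
    rw [← Complex.re_add_im (z : ℂ)]
    simp only [UpperHalfPlane.coe_re, UpperHalfPlane.coe_im]
    push_cast
    ring_nf
    rw [Complex.I_sq]
    ring
  rw [← e2]
  ring

lemma integral_weighted_thetaTerm_neg (hN : 0 < N) (a b : ℂ) (z : ℍ) (p : ℕ+ × ℕ+) :
    ∫ τ in Ioi (0 : ℝ), (a + b * (log (z.im * τ) : ℂ)) *
      thetaTerm N f z (p.1 : ℕ) (-((p.2 : ℕ) : ℤ)) τ = 2 * (b * negTerm N f z p) := by
  have hN' : (0 : ℝ) < N := by exact_mod_cast hN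
  have h1 := one_le_pnat p.1
  have h2 := one_le_pnat p.2
  have hy := z.im_pos
  have hA : 0 < (p.1 : ℝ) * z.im := by positivity
  have hν : 0 < (p.2 : ℝ) / N := by positivity
  have e : ∀ τ : ℝ, (a + b * (log (z.im * τ) : ℂ)) *
      thetaTerm N f z (p.1 : ℕ) (-((p.2 : ℕ) : ℤ)) τ =
      (periodicDFT N (f (p.1 : ℕ)) (-((p.2 : ℕ) : ℤ)) *
    Complex.exp (-(2 * π * Complex.I * p.2 * (p.1 * z.re) / N))) *
      ((a + b * (log (z.im * τ) : ℂ)) * (besselKernel (p.1 * z.im) (-(p.2 / N)) τ : ℂ)) := by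
    intro τ
    rw [thetaTerm]
    push_cast
    rw [neg_div, show 2 * (π : ℂ) * Complex.I * -(p.2 : ℂ) * (p.1 * z.re) / N =
      -(2 * π * Complex.I * p.2 * (p.1 * z.re) / N) by ring]
    ring
  simp_rw [e]
  rw [integral_const_mul, integral_weighted_besselKernel_neg hA hν hy, negTerm, expIntegral,
    integral_exp_mul_inv_eq (by positivity) hy,
    show (p.1 : ℝ) * z.im * (p.2 / N) = p.1 * p.2 / N * z.im by ring]
  have e2 : Complex.exp (-(2 * π * Complex.I * p.2 * (p.1 * z.re) / N)) *
      (exp (2 * π * (p.1 * p.2 / N * z.im)) : ℝ) =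
      Complex.exp (-(2 * π * Complex.I * (p.1 * p.2 / N : ℝ) * z)) := by
    rw [Complex.ofReal_exp, ← Complex.exp_add]
    congr 1
    rw [← Complex.re_add_im (z : ℂ)]
    simp only [UpperHalfPlane.coe_re, UpperHalfPlane.coe_im]
    push_cast
    ring_nf
    rw [Complex.I_sq]
    ring
  rw [← e2]
  ring

/-- The term is half of an integral whose absolute value has already been bounded, so the estimate
for integrals serves for the evaluated terms too. -/
lemma norm_posTerm_le (hN : 0 < N) (a b : ℂ) (z : ℍ) {C : ℝ} (hC : ∀ m n, ‖f m n‖ ≤ C)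
    (p : ℕ+ × ℕ+) : ‖posTerm a b N f z p‖ ≤ N * C * pairBound a b N z.im p := by
  have h1 := integral_weighted_thetaTerm_pos (f := f) hN a b z p
  have h2 := (weighted_thetaTerm hN a b z p 1 (by norm_num) hC).2
  rw [one_mul] at h2
  have h3 := (norm_integral_le_integral_norm _).trans h2
  rw [h1, norm_mul, Complex.norm_ofNat] at h3
  linarith [norm_nonneg (posTerm a b N f z p)]

lemma norm_mul_negTerm_le (hN : 0 < N) (a b : ℂ) (z : ℍ) {C : ℝ} (hC : ∀ m n, ‖f m n‖ ≤ C)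
    (p : ℕ+ × ℕ+) : ‖b * negTerm N f z p‖ ≤ N * C * pairBound a b N z.im p := by
  have h1 := integral_weighted_thetaTerm_neg (f := f) hN a b z p
  have h2 := (weighted_thetaTerm hN a b z p (-1) (by norm_num) hC).2
  rw [neg_one_mul] at h2
  have h3 := (norm_integral_le_integral_norm _).trans h2
  rw [h1, norm_mul, Complex.norm_ofNat] at h3
  linarith [norm_nonneg (b * negTerm N f z p)]

/-- The constant term of the theta integral. -/
noncomputable def liftConst (a b : ℂ) (N : ℕ) (f : ℤ → ℤ → ℂ) (y : ℝ) : ℂ :=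
  (a + b * log y) * mellin (oddTheta (f 0)) 1 + b * logMellin (f 0) 1 -
    Complex.I / N * ((a - b * log y) * mellin (oddTheta (rowSum N f)) (1 / 2) +
      b * logMellin (rowSum N f) (1 / 2))

/-- The Fourier expansion of the theta integral. -/
lemma thetaLift_eq (hf : IsOddPeriodic P N f) (hP : 0 < P) (hN : 0 < N) (a b : ℂ) (z : ℍ) :
    Summable (posTerm a b N f z) ∧ Summable (fun p => b * negTerm N f z p) ∧
    thetaLift a b f z = liftConst a b N f z.im - 4 * Complex.I / N *
      (∑' p, posTerm a b N f z p + ∑' p, b * negTerm N f z p) := by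
  obtain ⟨C, hC⟩ := hf.exists_norm_le hP hN
  have hb := (summable_pairBound a b hN z.im_pos).mul_left (N * C)
  refine ⟨Summable.of_norm_bounded hb (norm_posTerm_le hN a b z hC),
    Summable.of_norm_bounded hb (norm_mul_negTerm_le hN a b z hC), ?_⟩
  have hy := z.im_pos
  obtain ⟨i1, e1⟩ := hasIntegral_weighted_oddTheta hN (hf.periodic_right 0) hy a b
  obtain ⟨i2, e2⟩ := hasIntegral_weighted_oddTheta_sq hP (rowSum_periodic hf) hy a b
  -- Summability of the integrals of norms is what permits interchanging the sum with the integral;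
  -- ε = ±1 treats both signs of the frequency at once.
  have key : ∀ (ε : ℤ), |ε| = 1 → (∀ p : ℕ+ × ℕ+,
      IntegrableOn (fun τ : ℝ => (a + b * (log (z.im * τ) : ℂ)) *
        thetaTerm N f z (p.1 : ℕ) (ε * (p.2 : ℕ)) τ) (Ioi 0)) ∧
      Summable fun p : ℕ+ × ℕ+ => ∫ τ in Ioi (0 : ℝ), ‖(a + b * (log (z.im * τ) : ℂ)) *
        thetaTerm N f z (p.1 : ℕ) (ε * (p.2 : ℕ)) τ‖ := fun ε hε =>
    ⟨fun p => (weighted_thetaTerm hN a b z p ε hε hC).1,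
      Summable.of_nonneg_of_le (fun p => integral_nonneg fun _ => norm_nonneg _)
        (fun p => (weighted_thetaTerm hN a b z p ε hε hC).2) hb⟩
  have key2 : ∀ (ε : ℤ), |ε| = 1 →
      IntegrableOn (fun τ : ℝ => (a + b * (log (z.im * τ) : ℂ)) *
        ∑' p : ℕ+ × ℕ+, thetaTerm N f z (p.1 : ℕ) (ε * (p.2 : ℕ)) τ) (Ioi 0) ∧
      ∫ τ in Ioi (0 : ℝ), (a + b * (log (z.im * τ) : ℂ)) *
        ∑' p : ℕ+ × ℕ+, thetaTerm N f z (p.1 : ℕ) (ε * (p.2 : ℕ)) τ =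
      ∑' p : ℕ+ × ℕ+, ∫ τ in Ioi (0 : ℝ), (a + b * (log (z.im * τ) : ℂ)) *
        thetaTerm N f z (p.1 : ℕ) (ε * (p.2 : ℕ)) τ := by
    intro ε hε
    obtain ⟨k1, k2⟩ := key ε hε
    simp_rw [← tsum_mul_left]
    have k3 : ∀ᵐ τ ∂volume.restrict (Ioi (0 : ℝ)), Summable fun p : ℕ+ × ℕ+ =>
        (a + b * (log (z.im * τ) : ℂ)) * thetaTerm N f z (p.1 : ℕ) (ε * (p.2 : ℕ)) τ :=
      (ae_restrict_iff' measurableSet_Ioi).2 (Eventually.of_forall fun τ hτ =>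
        (summable_thetaTerm hf hP hN hτ z ε hε).mul_left _)
    exact ⟨integrable_tsum_of_summable_integral_norm k1 k2 k3,
      (hasSum_integral_of_summable_integral_norm k1 k2).tsum_eq.symm⟩
  obtain ⟨i3, e3⟩ := key2 1 (by norm_num)
  obtain ⟨i4, e4⟩ := key2 (-1) (by norm_num)
  simp only [one_mul, integral_weighted_thetaTerm_pos hN] at i3 e3
  simp only [neg_one_mul, integral_weighted_thetaTerm_neg hN] at i4 e4
  rw [thetaLift]
  have e5 : ∀ τ ∈ Ioi (0 : ℝ), (a + b * (log (z.im * τ) : ℂ)) * latticeTheta f τ z =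
      ((a + b * (log (z.im * τ) : ℂ)) * oddTheta (f 0) τ -
      Complex.I / N * ((a + b * (log (z.im * τ) : ℂ)) *
        ((z.im / √τ : ℝ) * oddTheta (rowSum N f) (z.im ^ 2 * τ)))) -
      2 * Complex.I / N * ((a + b * (log (z.im * τ) : ℂ)) *
        (∑' p : ℕ+ × ℕ+, thetaTerm N f z (p.1 : ℕ) (p.2 : ℕ) τ) +
        (a + b * (log (z.im * τ) : ℂ)) *
        ∑' p : ℕ+ × ℕ+, thetaTerm N f z (p.1 : ℕ) (-((p.2 : ℕ) : ℤ)) τ) := by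
    intro τ hτ
    rw [latticeTheta_eq hf hP hN hτ]
    ring
  rw [setIntegral_congr_fun measurableSet_Ioi e5, integral_sub, integral_sub i1 (i2.const_mul _),
    integral_const_mul, integral_const_mul, integral_add i3 i4, e1, e2, e3, e4, tsum_mul_left,
    tsum_mul_left, liftConst]
  · ring
  · exact i1.sub (i2.const_mul _)
  · exact (i3.add i4).const_mul _

/-- Logarithmic growth of theta integrals at the cusp `∞`. -/
lemma exists_norm_thetaLift_le (hf : IsOddPeriodic P N f) (hP : 0 < P) (hN : 0 < N) (a b : ℂ) :
    ∃ K : ℝ, ∀ z : ℍ, 1 ≤ z.im → ‖thetaLift a b f z‖ ≤ K + ‖b‖ * K * log z.im := by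
  obtain ⟨C, hC⟩ := hf.exists_norm_le hP hN
  have hC0 : 0 ≤ C := (norm_nonneg _).trans (hC 0 0)
  have hs := (summable_pairBound a b hN one_pos).mul_left (N * C)
  set T := ∑' p, N * C * pairBound a b N 1 p with hT
  set u := mellin (oddTheta (f 0)) 1
  set v := mellin (oddTheta (rowSum N f)) (1 / 2)
  set K₁ := ‖a * u + b * logMellin (f 0) 1 - Complex.I / N *
    (a * v + b * logMellin (rowSum N f) (1 / 2))‖ + ‖4 * Complex.I / N‖ * (T + T)
  set K₂ := ‖u + Complex.I / N * v‖
  have hT0 : 0 ≤ T := tsum_nonneg fun p => by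
    have := pairBound_nonneg a b N 1 p
    positivity
  refine ⟨K₁ + K₂, fun z hz => ?_⟩
  obtain ⟨s1, s2, e⟩ := thetaLift_eq hf hP hN a b z
  have hb : ∀ p, N * C * pairBound a b N z.im p ≤ N * C * pairBound a b N 1 p := fun p => by
    have := pairBound_le_of_one_le a b hN hz p
    gcongr
  have b1 : ‖∑' p, posTerm a b N f z p‖ ≤ T := tsum_of_norm_bounded hs.hasSum fun p =>
    (norm_posTerm_le hN a b z hC p).trans (hb p)
  have b2 : ‖∑' p, b * negTerm N f z p‖ ≤ T := tsum_of_norm_bounded hs.hasSum fun p =>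
    (norm_mul_negTerm_le hN a b z hC p).trans (hb p)
  have hlog : 0 ≤ log z.im := log_nonneg hz
  -- The coefficient of log y carries an explicit factor b, so the same estimate yields boundedness
  -- when b = 0.
  have e2 : thetaLift a b f z = (a * u + b * logMellin (f 0) 1 - Complex.I / N *
    (a * v + b * logMellin (rowSum N f) (1 / 2))) + b * log z.im * (u + Complex.I / N * v) -
    4 * Complex.I / N * (∑' p, posTerm a b N f z p + ∑' p, b * negTerm N f z p) := by
    rw [e, liftConst]
    ring
  rw [e2]
  have b3 : ‖∑' p, posTerm a b N f z p + ∑' p, b * negTerm N f z p‖ ≤ T + T :=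
    (norm_add_le _ _).trans (add_le_add b1 b2)
  calc _ ≤ ‖a * u + b * logMellin (f 0) 1 - Complex.I / N *
        (a * v + b * logMellin (rowSum N f) (1 / 2))‖ + ‖b‖ * log z.im * K₂ +
        ‖4 * Complex.I / N‖ * (T + T) := by
        refine (norm_sub_le _ _).trans (add_le_add ((norm_add_le _ _).trans ?_) ?_)
        · rw [norm_mul (b * _), norm_mul b, Complex.norm_real, norm_of_nonneg hlog]
        · rw [norm_mul]; gcongr
    _ ≤ _ := by
        have k1 : 0 ≤ K₁ := by positivity
        have k2 : 0 ≤ K₂ := norm_nonneg _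
        have k3 : 0 ≤ ‖b‖ * log z.im := by positivity
        have k4 := mul_nonneg k3 k1
        simp only [K₁] at k4 ⊢
        nlinarith

end LiftExpansion

/-! ### Real-analyticity of series of products -/

section TsumAnalytic

lemma norm_lp_single_one (n : ℕ) : ‖(lp.single 2 n (1 : ℂ) : lp (fun _ : ℕ => ℂ) 2)‖ = 1 := by
  rw [lp.norm_single (by norm_num)]
  simp

lemma norm_innerSL_lp_single_one (n : ℕ) :
    ‖innerSL ℂ (lp.single 2 n (1 : ℂ) : lp (fun _ : ℕ => ℂ) 2)‖ = 1 := by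
  rw [innerSL_apply_norm, norm_lp_single_one]

lemma inner_lp_single_one (n m : ℕ) :
    inner ℂ (lp.single 2 n (1 : ℂ) : lp (fun _ : ℕ => ℂ) 2) (lp.single 2 m (1 : ℂ)) =
      if m = n then 1 else 0 := by
  rw [lp.inner_single_left (G := fun _ : ℕ => ℂ), lp.single_apply]
  simp [Pi.single_apply, eq_comm]

/-- A series of products of holomorphic functions, with each factor composed with a real-analytic
function, is real-analytic when both series of suprema converge. -/
lemma analyticAt_tsum_mul {U V : Set ℂ} (hU : IsOpen U) (hV : IsOpen V) {a b : ℕ → ℂ → ℂ}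
    {u v : ℕ → ℝ} (hu : Summable u) (hv : Summable v)
    (ha : ∀ n, DifferentiableOn ℂ (a n) U) (hb : ∀ n, DifferentiableOn ℂ (b n) V)
    (hau : ∀ n, ∀ w ∈ U, ‖a n w‖ ≤ u n) (hbv : ∀ n, ∀ w ∈ V, ‖b n w‖ ≤ v n)
    {g h : ℂ → ℂ} {z₀ : ℂ} (hg : AnalyticAt ℝ g z₀) (hh : AnalyticAt ℝ h z₀)
    (hgU : g z₀ ∈ U) (hhV : h z₀ ∈ V) :
    AnalyticAt ℝ (fun z => ∑' n, a n (g z) * b n (h z)) z₀ := by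
  -- The series is the evaluation of a functional Ψ(h(z)) on ℓ² at a vector Φ(g(z)). Both Φ and Ψ
  -- are holomorphic as Banach-valued maps, and real-analyticity passes through the compositions and
  -- through the bilinear evaluation.
  let X := lp (fun _ : ℕ => ℂ) 2
  let e : ℕ → X := fun n => lp.single 2 n 1
  let Φ : ℂ → X := fun w => ∑' n, a n w • e n
  let Ψ : ℂ → X →L[ℂ] ℂ := fun w => ∑' n, b n w • innerSL ℂ (e n)
  have hΦn : ∀ n, ∀ w ∈ U, ‖a n w • e n‖ ≤ u n := fun n w hw => by
    rw [norm_smul, norm_lp_single_one, mul_one]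
    exact hau n w hw
  have hΨn : ∀ n, ∀ w ∈ V, ‖b n w • innerSL ℂ (e n)‖ ≤ v n := fun n w hw => by
    rw [norm_smul, norm_innerSL_lp_single_one, mul_one]
    exact hbv n w hw
  have hΦ : AnalyticAt ℂ Φ (g z₀) :=
    (Complex.differentiableOn_tsum_of_summable_norm hu
      (fun n => (ha n).smul_const (e n)) hU hΦn).analyticAt (hU.mem_nhds hgU)
  have hΨ : AnalyticAt ℂ Ψ (h z₀) :=
    (Complex.differentiableOn_tsum_of_summable_norm hv
      (fun n => (hb n).smul_const (innerSL ℂ (e n))) hV hΨn).analyticAt (hV.mem_nhds hhV)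
  have hΦ' : AnalyticAt ℝ (fun z => Φ (g z)) z₀ :=
    AnalyticAt.comp (hΦ.restrictScalars (𝕜 := ℝ)) hg
  have hΨ' : AnalyticAt ℝ (fun z => Ψ (h z)) z₀ :=
    AnalyticAt.comp (hΨ.restrictScalars (𝕜 := ℝ)) hh
  have hB := ((ContinuousLinearMap.id ℂ (X →L[ℂ] ℂ)).analyticAt_bilinear
    (Ψ (h z₀), Φ (g z₀))).restrictScalars (𝕜 := ℝ)
  have hall : AnalyticAt ℝ (fun z => Ψ (h z) (Φ (g z))) z₀ :=
    AnalyticAt.comp_of_eq hB (hΨ'.prod hΦ') rfl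
  refine hall.congr ?_
  filter_upwards [hg.continuousAt.preimage_mem_nhds (hU.mem_nhds hgU),
    hh.continuousAt.preimage_mem_nhds (hV.mem_nhds hhV)] with z hzU hzV
  have sΦ : HasSum (fun n => a n (g z) • e n) (Φ (g z)) :=
    (Summable.of_norm_bounded hu fun n => hΦn n _ hzU).hasSum
  have sΨ : HasSum (fun n => b n (h z) • innerSL ℂ (e n)) (Ψ (h z)) :=
    (Summable.of_norm_bounded hv fun n => hΨn n _ hzV).hasSum
  have hcoef : ∀ n, inner ℂ (e n) (Φ (g z)) = a n (g z) := by
    intro n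
    have h1 := sΦ.mapL (innerSL ℂ (e n))
    refine h1.unique (hasSum_single n fun m hm => ?_) |>.trans ?_
    · rw [innerSL_apply_apply, inner_smul_right, inner_lp_single_one, if_neg hm, mul_zero]
    · rw [innerSL_apply_apply, inner_smul_right, inner_lp_single_one, if_pos rfl, mul_one]
  have h2 := sΨ.mapL (ContinuousLinearMap.apply ℂ ℂ (Φ (g z)))
  simp only [ContinuousLinearMap.apply_apply, smul_eq_mul,
    innerSL_apply_apply, hcoef, _root_.smul_apply] at h2
  rw [← h2.tsum_eq]
  exact tsum_congr fun n => mul_comm _ _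

end TsumAnalytic

/-! ### Holomorphic continuation of the exponential integral -/

section LaplaceInv

/-- The function `∫_0^∞ e^{-4πrv} (w+v)⁻¹ dv`. -/
noncomputable def laplaceInv (r : ℝ) (w : ℂ) : ℂ :=
  ∫ v in Ioi (0 : ℝ), (exp (-(4 * π * r * v)) : ℂ) * (w + v)⁻¹

variable {r : ℝ}

lemma integrableOn_exp_neg (hr : 0 < r) :
    IntegrableOn (fun v : ℝ => exp (-(4 * π * r * v))) (Ioi 0) := by
  have := exp_neg_integrableOn_Ioi 0 (b := 4 * π * r) (by have := pi_pos; positivity)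
  simpa only [neg_mul] using this

lemma integral_exp_neg (hr : 0 < r) :
    ∫ v in Ioi (0 : ℝ), exp (-(4 * π * r * v)) = (4 * π * r)⁻¹ := by
  have := integral_exp_mul_Ioi (a := -(4 * π * r)) (by have := pi_pos; simp; positivity) 0
  simp only [neg_mul, mul_zero, exp_zero] at this
  rw [this]
  simp

lemma re_le_norm_add {w : ℂ} {v : ℝ} (hv : 0 < v) : w.re ≤ ‖w + v‖ := by
  refine le_trans ?_ (Complex.re_le_norm _)
  simp [hv.le]

lemma norm_inv_add_le {w : ℂ} {c v : ℝ} (hc : 0 < c) (hw : c ≤ w.re) (hv : 0 < v) :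
    ‖(w + v)⁻¹‖ ≤ c⁻¹ := by
  rw [norm_inv]
  exact inv_anti₀ hc (hw.trans (re_le_norm_add hv))

lemma norm_laplaceInv_le (hr : 0 < r) {w : ℂ} {c : ℝ} (hc : 0 < c) (hw : c ≤ w.re) :
    ‖laplaceInv r w‖ ≤ (4 * π * r)⁻¹ * c⁻¹ := by
  rw [← integral_exp_neg hr, ← integral_mul_const]
  refine norm_integral_le_of_norm_le ((integrableOn_exp_neg hr).mul_const _) ?_
  refine (ae_restrict_iff' measurableSet_Ioi).2 (Eventually.of_forall fun v hv => ?_)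
  rw [norm_mul, Complex.norm_real, norm_of_nonneg (exp_pos _).le]
  gcongr
  exact norm_inv_add_le hc hw hv

/-- On the half-plane Re x > Re(w)/2 the factor (x + v)⁻¹ and its derivative are bounded uniformly
in v > 0, so one may differentiate under the integral. -/
lemma differentiableAt_laplaceInv (hr : 0 < r) {w : ℂ} (hw : 0 < w.re) :
    DifferentiableAt ℂ (laplaceInv r) w := by
  have hc : 0 < w.re / 2 := by positivity
  have hmem : {x : ℂ | w.re / 2 < x.re} ∈ 𝓝 w :=
    (isOpen_lt continuous_const Complex.continuous_re).mem_nhds (by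
      change w.re / 2 < w.re
      linarith)
  have hne : ∀ x ∈ {x : ℂ | w.re / 2 < x.re}, ∀ v ∈ Ioi (0 : ℝ), x + v ≠ 0 := by
    intro x hx v hv h
    have h1 := congrArg Complex.re h
    have h2 : w.re / 2 < x.re := hx
    have h3 : 0 < v := hv
    simp at h1
    linarith
  have hcont : ∀ x ∈ {x : ℂ | w.re / 2 < x.re},
      ContinuousOn (fun v : ℝ => (x + v)⁻¹) (Ioi 0) := fun x hx =>
    ContinuousOn.inv₀ (by fun_prop) (hne x hx)
  have hexp : Continuous fun v : ℝ => (exp (-(4 * π * r * v)) : ℂ) := by fun_prop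
  have hintegrable : IntegrableOn (fun v : ℝ => exp (-(4 * π * r * v)) * ((w.re / 2)⁻¹)) (Ioi 0) :=
    (integrableOn_exp_neg hr).mul_const _
  refine (hasDerivAt_integral_of_dominated_loc_of_deriv_le (s := {x : ℂ | w.re / 2 < x.re})
    (F' := fun x v => (exp (-(4 * π * r * v)) : ℂ) * -((x + v) ^ 2)⁻¹)
    (bound := fun v => exp (-(4 * π * r * v)) * ((w.re / 2)⁻¹ * (w.re / 2)⁻¹))
    hmem ?_ ?_ ?_ ?_ ?_ ?_).2.differentiableAt
  · filter_upwards [hmem] with x hx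
    exact (hexp.continuousOn.mul (hcont x hx)).aestronglyMeasurable measurableSet_Ioi
  · refine Integrable.mono' hintegrable
      ((hexp.continuousOn.mul (hcont w (mem_of_mem_nhds hmem))).aestronglyMeasurable
        measurableSet_Ioi) ?_
    refine (ae_restrict_iff' measurableSet_Ioi).2 (Eventually.of_forall fun v hv => ?_)
    rw [norm_mul, Complex.norm_real, norm_of_nonneg (exp_pos _).le]
    gcongr
    exact norm_inv_add_le hc (by linarith) hv
  · refine ContinuousOn.aestronglyMeasurable ?_ measurableSet_Ioi
    refine hexp.continuousOn.mul ?_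
    simp_rw [← inv_pow]
    exact ((hcont w (mem_of_mem_nhds hmem)).pow 2).neg
  · refine (ae_restrict_iff' measurableSet_Ioi).2 (Eventually.of_forall fun v hv x hx => ?_)
    rw [norm_mul, Complex.norm_real, norm_of_nonneg (exp_pos _).le, norm_neg, ← inv_pow, norm_pow,
      sq]
    have := norm_inv_add_le hc (le_of_lt hx : w.re / 2 ≤ x.re) hv
    gcongr
  · exact (integrableOn_exp_neg hr).mul_const _
  · refine (ae_restrict_iff' measurableSet_Ioi).2 (Eventually.of_forall fun v hv x hx => ?_)
    have h1 : HasDerivAt (fun x : ℂ => x + v) 1 x := (hasDerivAt_id x).add_const _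
    have := (h1.inv (hne x hx v hv)).const_mul (exp (-(4 * π * r * v)) : ℂ)
    refine this.congr_deriv ?_
    ring

/-- The shift u = v + y extracts the exponential and leaves a function of y that is holomorphic on
the right half-plane; this is the form needed for real-analyticity. -/
lemma expIntegral_eq_laplaceInv (r y : ℝ) :
    (expIntegral r y : ℂ) = exp (-(4 * π * r * y)) * laplaceInv r y := by
  have h := (measurePreserving_add_right volume y).setIntegral_preimage_emb
    (measurableEmbedding_addRight y) (fun u : ℝ => exp (-(4 * π * r * u)) * u⁻¹) (Ioi y)
  have hs : (fun x => x + y) ⁻¹' Ioi y = Ioi (0 : ℝ) := by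
    ext x
    simp
  rw [hs] at h
  rw [expIntegral, ← h, laplaceInv, ← integral_const_mul, ← integral_complex_ofReal]
  congr 1
  ext v
  rw [← mul_assoc]
  push_cast
  rw [← Complex.exp_add]
  congr 2
  · ring
  · ring

lemma expIntegral_nonneg {y : ℝ} (hy : 0 < y) : 0 ≤ expIntegral r y :=
  setIntegral_nonneg measurableSet_Ioi fun u hu => by
    have : 0 < u := hy.trans hu
    positivity

lemma expIntegral_le (hr : 0 < r) {y : ℝ} (hy : 0 < y) :
    expIntegral r y ≤ exp (-(4 * π * r * y)) * ((4 * π * r)⁻¹ * y⁻¹) := by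
  have h := norm_laplaceInv_le hr hy (w := y) (by simp)
  have h2 := congrArg norm (expIntegral_eq_laplaceInv r y)
  rw [norm_mul, Complex.norm_real, Complex.norm_real, norm_of_nonneg (expIntegral_nonneg hy),
    norm_of_nonneg (exp_pos _).le] at h2
  rw [h2]
  gcongr

lemma hasDerivAt_expIntegral (hr : 0 < r) {y : ℝ} (hy : 0 < y) :
    HasDerivAt (expIntegral r) (-(exp (-(4 * π * r * y)) * y⁻¹)) y := by
  have h := (hasDerivAt_sqrt_mul_sinhIntegral hr hy).const_mul 4
  refine (h.congr_of_eventuallyEq ?_).congr_deriv (by ring)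
  filter_upwards [lt_mem_nhds hy] with u hu
  exact integral_exp_mul_inv_eq hr hu

end LaplaceInv

/-! ### Termwise differentiation of q-series and their nonholomorphic companions -/

section QSeries

/-- Coefficients of a power series which converges absolutely on the open unit disc. -/
def IsDiscSummable (c : ℕ → ℂ) : Prop := ∀ r : ℝ, 0 ≤ r → r < 1 → Summable fun n => ‖c n‖ * r ^ n

/-- The series `∑ c(n) q^n`. -/
noncomputable def qSeries (c : ℕ → ℂ) (z : ℂ) : ℂ := ∑' n, c n * q z ^ n

/-- The term `conj (c(n)) β_1(n,y) q^{-n}`. -/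
noncomputable def nonholTerm (c : ℕ → ℂ) (n : ℕ) (z : ℂ) : ℂ :=
  conj (c n) * (beta 1 n z.im : ℂ) * q z ^ (-(n : ℤ))

lemma norm_q (z : ℂ) : ‖q z‖ = exp (-(2 * π * z.im)) := by
  rw [q, Complex.norm_exp]
  simp

lemma q_ne_zero (z : ℂ) : q z ≠ 0 := Complex.exp_ne_zero _

lemma norm_q_lt_one {z : ℂ} (hz : 0 < z.im) : ‖q z‖ < 1 := by
  rw [norm_q, exp_lt_one_iff]
  have := pi_pos
  have : 0 < 2 * π * z.im := by positivity
  linarith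

lemma norm_q_le {z : ℂ} {y : ℝ} (hz : y ≤ z.im) : ‖q z‖ ≤ exp (-(2 * π * y)) := by
  rw [norm_q]
  have := pi_pos
  gcongr

lemma exp_neg_lt_one {y : ℝ} (hy : 0 < y) : exp (-(2 * π * y)) < 1 := by
  rw [exp_lt_one_iff]
  have := pi_pos
  have : 0 < 2 * π * y := by positivity
  linarith

lemma hasDerivAt_q (z : ℂ) : HasDerivAt q (2 * π * Complex.I * q z) z := by
  have h : HasDerivAt (fun z : ℂ => 2 * π * Complex.I * z) (2 * π * Complex.I) z := by
    simpa using (hasDerivAt_id z).const_mul (2 * π * Complex.I)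
  exact h.cexp.congr_deriv (mul_comm _ _)

variable {c : ℕ → ℂ}

lemma isOpen_lt_im (y : ℝ) : IsOpen {z : ℂ | y < z.im} :=
  isOpen_lt continuous_const Complex.continuous_im

lemma IsDiscSummable.differentiableAt (hc : IsDiscSummable c) {z : ℂ} (hz : 0 < z.im) :
    DifferentiableAt ℂ (qSeries c) z := by
  have hy : 0 < z.im / 2 := by positivity
  have h := Complex.differentiableOn_tsum_of_summable_norm (U := {w : ℂ | z.im / 2 < w.im})
    (F := fun n w => c n * q w ^ n) (hc _ (exp_pos _).le (exp_neg_lt_one hy))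
    (fun n w _ => (((hasDerivAt_q w).differentiableAt.pow n).const_mul
      (c n)).differentiableWithinAt)
    (isOpen_lt_im _) fun n w hw => by
      rw [norm_mul, norm_pow]
      have := norm_q_le (le_of_lt hw)
      gcongr
  exact h.differentiableAt ((isOpen_lt_im _).mem_nhds (by
    change z.im / 2 < z.im
    linarith))

lemma beta_one_zero (y : ℝ) : beta 1 0 y = -log y := by simp [beta]

lemma beta_one_of_ne_zero {n : ℕ} (hn : n ≠ 0) (y : ℝ) : beta 1 n y = expIntegral n y := by
  simp [beta, hn, expIntegral]

lemma hasDerivAt_beta_one (n : ℕ) {y : ℝ} (hy : 0 < y) :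
    HasDerivAt (beta 1 n) (-(exp (-(4 * π * n * y)) * y⁻¹)) y := by
  rcases eq_or_ne n 0 with rfl | hn
  · rw [show beta 1 0 = fun y => -log y from funext beta_one_zero]
    exact (hasDerivAt_log hy.ne').neg.congr_deriv (by simp)
  · rw [show beta 1 n = expIntegral n from funext (beta_one_of_ne_zero hn)]
    exact hasDerivAt_expIntegral (by positivity) hy

/-- The factor n is the one produced by differentiating q^{-n}. It also makes the bound true for n =
0, where β is a logarithm and does not decay. -/
lemma natCast_mul_abs_beta_one_le (n : ℕ) {y : ℝ} (hy : 0 < y) :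
    n * |beta 1 n y| ≤ exp (-(4 * π * n * y)) * ((4 * π)⁻¹ * y⁻¹) := by
  have hpi := pi_pos
  rcases eq_or_ne n 0 with rfl | hn
  · rw [Nat.cast_zero, zero_mul]
    positivity
  · have hn' : (0 : ℝ) < n := by positivity
    rw [beta_one_of_ne_zero hn, abs_of_nonneg (expIntegral_nonneg hy)]
    calc n * expIntegral n y ≤ n * (exp (-(4 * π * n * y)) * ((4 * π * n)⁻¹ * y⁻¹)) := by
          gcongr
          exact expIntegral_le hn' hy
      _ = _ := by field_simp

/-- The real derivative of `nonholTerm`. -/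
noncomputable def nonholDeriv (c : ℕ → ℂ) (n : ℕ) (z : ℂ) : ℂ →L[ℝ] ℂ :=
  (conj (c n) * q z ^ (-(n : ℤ)) * (-(exp (-(4 * π * n * z.im)) * z.im⁻¹) : ℝ)) •
      (Complex.ofRealCLM ∘L Complex.imCLM) +
    (conj (c n) * (beta 1 n z.im : ℂ) * (-(2 * π * Complex.I * n) * q z ^ (-(n : ℤ)))) •
      ContinuousLinearMap.id ℝ ℂ

lemma hasDerivAt_q_zpow_neg (n : ℕ) (z : ℂ) :
    HasDerivAt (fun z => q z ^ (-(n : ℤ))) (-(2 * π * Complex.I * n) * q z ^ (-(n : ℤ))) z := by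
  have h := (hasDerivAt_zpow (-(n : ℤ)) (q z) (Or.inl (q_ne_zero z))).comp z (hasDerivAt_q z)
  refine h.congr_deriv ?_
  rw [zpow_sub_one₀ (q_ne_zero z)]
  have := q_ne_zero z
  push_cast
  field_simp

lemma hasFDerivAt_nonholTerm (c : ℕ → ℂ) (n : ℕ) {z : ℂ} (hz : 0 < z.im) :
    HasFDerivAt (nonholTerm c n) (nonholDeriv c n z) z := by
  have h1 : HasFDerivAt (fun z : ℂ => (beta 1 n z.im : ℂ))
      (((-(exp (-(4 * π * n * z.im)) * z.im⁻¹) : ℝ) : ℂ) •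
        (Complex.ofRealCLM ∘L Complex.imCLM)) z := by
    have h := (hasDerivAt_beta_one n hz).hasFDerivAt.comp z Complex.imCLM.hasFDerivAt
    refine (Complex.ofRealCLM.hasFDerivAt.comp z h).congr_fderiv ?_
    ext
    simp
    ring
  have h2 := (hasDerivAt_q_zpow_neg n z).hasFDerivAt.restrictScalars ℝ
  have h3 := (h1.const_mul (conj (c n))).mul h2
  refine h3.congr_fderiv ?_
  ext
  simp [nonholDeriv]
  ring

lemma norm_q_zpow_neg (n : ℕ) (z : ℂ) : ‖q z ^ (-(n : ℤ))‖ = exp (2 * π * n * z.im) := by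
  rw [norm_zpow, norm_q, zpow_neg, zpow_natCast, ← exp_nat_mul, ← exp_neg]
  congr 1
  ring

/-- The growth e^{2πny} of q^{-n} is beaten by e^{-4πny}, from β or from its derivative. The
constant 3/2 is 1 from differentiating β plus 1/2 from differentiating q^{-n}. -/
lemma norm_nonholDeriv_le (c : ℕ → ℂ) (n : ℕ) {z : ℂ} {y : ℝ} (hy : 0 < y) (hz : y ≤ z.im) :
    ‖nonholDeriv c n z‖ ≤ ‖c n‖ * exp (-(2 * π * y)) ^ n * (3 / 2 * y⁻¹) := by
  have hpi := pi_pos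
  have hz0 : 0 < z.im := hy.trans_le hz
  have hE : exp (2 * π * n * z.im) * exp (-(4 * π * n * z.im)) ≤ exp (-(2 * π * y)) ^ n := by
    rw [← exp_add, ← exp_nat_mul, exp_le_exp]
    have : (n : ℝ) * (2 * π) * y ≤ n * (2 * π) * z.im := by gcongr
    linarith
  have hL : ‖Complex.ofRealCLM ∘L Complex.imCLM‖ ≤ 1 := by
    refine ContinuousLinearMap.opNorm_le_bound _ zero_le_one fun w => ?_
    simpa using Complex.abs_im_le_norm w
  have hI : ‖ContinuousLinearMap.id ℝ ℂ‖ ≤ 1 := ContinuousLinearMap.norm_id_le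
  have hyz : z.im⁻¹ ≤ y⁻¹ := inv_anti₀ hy hz
  have h1 : ‖conj (c n) * q z ^ (-(n : ℤ)) * (-(exp (-(4 * π * n * z.im)) * z.im⁻¹) : ℝ)‖ ≤
      ‖c n‖ * exp (-(2 * π * y)) ^ n * y⁻¹ := by
    rw [norm_mul, norm_mul, RCLike.norm_conj, norm_q_zpow_neg, Complex.norm_real, norm_neg,
      norm_of_nonneg (by positivity)]
    calc _ = ‖c n‖ * (exp (2 * π * n * z.im) * exp (-(4 * π * n * z.im))) * z.im⁻¹ := by ring
      _ ≤ _ := by gcongr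
  have h2 : ‖conj (c n) * (beta 1 n z.im : ℂ) *
      (-(2 * π * Complex.I * n) * q z ^ (-(n : ℤ)))‖ ≤
      ‖c n‖ * exp (-(2 * π * y)) ^ n * (1 / 2 * y⁻¹) := by
    rw [norm_mul, norm_mul, norm_mul, RCLike.norm_conj, norm_q_zpow_neg, Complex.norm_real,
      norm_neg, norm_mul, norm_mul, norm_mul, Complex.norm_I, Complex.norm_real,
      norm_of_nonneg hpi.le, Complex.norm_natCast, Complex.norm_ofNat, norm_eq_abs]
    calc _ = ‖c n‖ * (2 * π) * exp (2 * π * n * z.im) * (n * |beta 1 n z.im|) := by ring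
      _ ≤ ‖c n‖ * (2 * π) * exp (2 * π * n * z.im) *
          (exp (-(4 * π * n * z.im)) * ((4 * π)⁻¹ * z.im⁻¹)) := by
        exact mul_le_mul_of_nonneg_left (natCast_mul_abs_beta_one_le n hz0) (by positivity)
      _ = ‖c n‖ * (exp (2 * π * n * z.im) * exp (-(4 * π * n * z.im))) * (1 / 2 * z.im⁻¹) := by
        field_simp
        norm_num
      _ ≤ _ := by gcongr
  refine (norm_add_le _ _).trans ?_
  rw [norm_smul, norm_smul]
  calc _ ≤ ‖c n‖ * exp (-(2 * π * y)) ^ n * y⁻¹ * 1 +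
        ‖c n‖ * exp (-(2 * π * y)) ^ n * (1 / 2 * y⁻¹) * 1 := by gcongr
    _ = _ := by ring

lemma norm_nonholTerm_le (c : ℕ → ℂ) {n : ℕ} (hn : n ≠ 0) {z : ℂ} (hz : 0 < z.im) :
    ‖nonholTerm c n z‖ ≤ ‖c n‖ * ‖q z‖ ^ n * z.im⁻¹ := by
  have hpi := pi_pos
  have h := natCast_mul_abs_beta_one_le n hz
  have hn1 : (1 : ℝ) ≤ n := Nat.one_le_cast.2 (Nat.one_le_iff_ne_zero.2 hn)
  have hb : |beta 1 n z.im| ≤ exp (-(4 * π * n * z.im)) * z.im⁻¹ := by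
    calc |beta 1 n z.im| ≤ n * |beta 1 n z.im| := le_mul_of_one_le_left (abs_nonneg _) hn1
      _ ≤ _ := h
      _ ≤ exp (-(4 * π * n * z.im)) * (1 * z.im⁻¹) := by
        gcongr
        exact inv_le_one_of_one_le₀ (by linarith [pi_gt_three])
      _ = _ := by ring
  rw [nonholTerm, norm_mul, norm_mul, RCLike.norm_conj, norm_q_zpow_neg, Complex.norm_real,
    norm_eq_abs]
  calc _ ≤ ‖c n‖ * (exp (-(4 * π * n * z.im)) * z.im⁻¹) * exp (2 * π * n * z.im) := by gcongr
    _ = ‖c n‖ * (exp (-(4 * π * n * z.im)) * exp (2 * π * n * z.im)) * z.im⁻¹ := by ring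
    _ = _ := by
      rw [← exp_add, norm_q, ← exp_nat_mul]
      congr 3
      ring

lemma IsDiscSummable.summable_nonholTerm (hc : IsDiscSummable c) {z : ℂ} (hz : 0 < z.im) :
    Summable fun n => nonholTerm c n z := by
  rw [← summable_nat_add_iff 1]
  refine Summable.of_norm_bounded ((summable_nat_add_iff 1).2
    ((hc ‖q z‖ (norm_nonneg _) (norm_q_lt_one hz)).mul_right z.im⁻¹)) fun n => ?_
  exact norm_nonholTerm_le c n.succ_ne_zero hz

/-- The functional `L ↦ (L 1 + i L i) / 2`, which computes `∂/∂z̄` from a real derivative. -/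
noncomputable def zbarPart : (ℂ →L[ℝ] ℂ) →L[ℝ] ℂ :=
  (2 : ℂ)⁻¹ • (ContinuousLinearMap.apply ℝ ℂ (1 : ℂ) +
    Complex.I • ContinuousLinearMap.apply ℝ ℂ Complex.I)

lemma zbarPart_apply (T : ℂ →L[ℝ] ℂ) : zbarPart T = (T 1 + Complex.I * T Complex.I) / 2 := by
  simp [zbarPart]
  ring

lemma partialZBar_eq {f : ℂ → ℂ} {f' : ℂ →L[ℝ] ℂ} {z : ℂ} (h : HasFDerivAt f f' z) :
    partialZBar f z = zbarPart f' := by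
  rw [partialZBar, partialX, partialY, h.fderiv, zbarPart_apply]

/-- ∂/∂z̄ annihilates q^{-n} and sees only β, whose derivative contains e^{-4πny}; and q^{-n}
e^{-4πny} is the conjugate of q^n. -/
lemma zbarPart_nonholDeriv (c : ℕ → ℂ) (n : ℕ) (z : ℂ) :
    zbarPart (nonholDeriv c n z) = -(Complex.I / (2 * z.im)) * conj (c n * q z ^ n) := by
  have h : q z ^ (-(n : ℤ)) * (exp (-(4 * π * n * z.im)) : ℝ) = conj (q z ^ n) := by
    rw [q, ← Complex.exp_int_mul, ← Complex.exp_nat_mul, ← Complex.exp_conj, Complex.ofReal_exp,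
      ← Complex.exp_add]
    congr 1
    apply Complex.ext <;> simp
    ring
  rw [map_mul, ← h, zbarPart_apply, nonholDeriv]
  simp
  ring_nf
  rw [Complex.I_pow_three]
  ring

/-- The derivatives are summable uniformly on the convex half-plane Im w > Im(z)/2, so the series
may be differentiated term by term there. -/
lemma IsDiscSummable.hasFDerivAt_tsum_nonholTerm (hc : IsDiscSummable c) {z : ℂ} (hz : 0 < z.im) :
    ∃ T : ℂ →L[ℝ] ℂ, HasFDerivAt (fun z => ∑' n, nonholTerm c n z) T z ∧
      zbarPart T = -(Complex.I / (2 * z.im)) * conj (qSeries c z) := by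
  have hy : 0 < z.im / 2 := by positivity
  have hmem : z ∈ {w : ℂ | z.im / 2 < w.im} := by
    change z.im / 2 < z.im
    linarith
  have hs := (hc _ (exp_pos _).le (exp_neg_lt_one hy)).mul_right (3 / 2 * (z.im / 2)⁻¹)
  have hb : ∀ n, ∀ w ∈ {w : ℂ | z.im / 2 < w.im}, ‖nonholDeriv c n w‖ ≤
      ‖c n‖ * exp (-(2 * π * (z.im / 2))) ^ n * (3 / 2 * (z.im / 2)⁻¹) := fun n w hw =>
    norm_nonholDeriv_le c n hy (le_of_lt hw)
  refine ⟨∑' n, nonholDeriv c n z, hasFDerivAt_tsum_of_isPreconnected hs (isOpen_lt_im _)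
    (convex_halfSpace_im_gt _).isPreconnected
    (fun n w hw => hasFDerivAt_nonholTerm c n (hy.trans hw)) hb hmem
    (hc.summable_nonholTerm hz) hmem, ?_⟩
  rw [zbarPart.map_tsum (Summable.of_norm_bounded hs fun n => hb n z hmem), qSeries,
    Complex.conj_tsum, ← tsum_mul_left]
  exact tsum_congr fun n => zbarPart_nonholDeriv c n z

lemma partialZBar_qSeries_sub {cp : ℕ → ℂ} (hcp : IsDiscSummable cp) (hc : IsDiscSummable c) {z : ℂ}
    (hz : 0 < z.im) :
    partialZBar (fun z => qSeries cp z - ∑' n, nonholTerm c n z) z =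
      Complex.I / (2 * z.im) * conj (qSeries c z) := by
  obtain ⟨T, hT, hTz⟩ := hc.hasFDerivAt_tsum_nonholTerm hz
  have h1 := (hcp.differentiableAt hz).hasDerivAt.hasFDerivAt.restrictScalars ℝ
  rw [show partialZBar (fun z => qSeries cp z - ∑' n, nonholTerm c n z) z = _ from
    partialZBar_eq (h1.sub hT), map_sub, hTz, zbarPart_apply]
  simp
  ring_nf
  simp only [Complex.I_sq]
  ring

end QSeries

/-! ### Analyticity, harmonicity and the operator ξ -/

section Harmonic

variable {c cp : ℕ → ℂ}

/-- Splits the term into a holomorphic function of -z̄ and a holomorphic function of y, as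
`analyticAt_tsum_mul` requires. -/
lemma nonholTerm_succ (c : ℕ → ℂ) (n : ℕ) (z : ℂ) :
    nonholTerm c (n + 1) z =
      conj (c (n + 1)) * q (-conj z) ^ (n + 1) * laplaceInv ((n + 1 : ℕ) : ℝ) z.im := by
  rw [nonholTerm, beta_one_of_ne_zero n.succ_ne_zero, expIntegral_eq_laplaceInv]
  have h : ((exp (-(4 * π * ((n + 1 : ℕ) : ℝ) * z.im)) : ℝ) : ℂ) * q z ^ (-((n + 1 : ℕ) : ℤ)) =
      q (-conj z) ^ (n + 1) := by
    rw [q, q, ← Complex.exp_int_mul, ← Complex.exp_nat_mul, Complex.ofReal_exp, ← Complex.exp_add]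
    congr 1
    apply Complex.ext <;> simp <;> ring
  rw [← h]
  ring

lemma IsDiscSummable.analyticAt_tsum_nonholTerm (hc : IsDiscSummable c) {z : ℂ} (hz : 0 < z.im) :
    AnalyticAt ℝ (fun z => ∑' n, nonholTerm c n z) z := by
  have hpi := pi_pos
  have hy : 0 < z.im / 2 := by positivity
  have hy4 : 0 < z.im / 4 := by positivity
  have hmem : z.im / 2 < z.im := by linarith
  -- Near z the factor q(-w̄)^n decays geometrically while the Laplace factor need not. Moving ρ^n
  -- to the first and σ^n = ρ^{-n} to the second makes both series geometric in σ.
  set ρ := exp (π * z.im / 2) with hρ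
  set σ := exp (-(2 * π * (z.im / 4))) with hσ
  have hσ1 : σ < 1 := exp_neg_lt_one hy4
  have hρσ : ρ * σ = 1 := by
    rw [hρ, hσ, ← exp_add, exp_eq_one_iff]
    ring
  have hσρ : exp (-(2 * π * (z.im / 2))) * ρ = σ := by
    rw [hρ, hσ, ← exp_add]
    congr 1
    ring
  have hσ0 : 0 < σ := exp_pos _
  have hρ0 : 0 < ρ := exp_pos _
  have h0 : AnalyticAt ℝ (fun z => nonholTerm c 0 z) z := by
    have h1 : AnalyticAt ℝ (fun z : ℂ => log z.im) z :=
      (analyticAt_log hz).comp (Complex.imCLM.analyticAt z)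
    have h2 : AnalyticAt ℝ (fun z : ℂ => ((log z.im : ℝ) : ℂ)) z :=
      (Complex.ofRealCLM.analyticAt _).comp h1
    refine (analyticAt_const.mul h2.neg : AnalyticAt ℝ (fun z : ℂ =>
      conj (c 0) * -((log z.im : ℝ) : ℂ)) z).congr (Eventually.of_forall fun w => ?_)
    simp [nonholTerm, beta_one_zero]
  have hg : AnalyticAt ℝ (fun z : ℂ => -conj z) z := (Complex.conjCLE.analyticAt z).neg
  have hh : AnalyticAt ℝ (fun z : ℂ => (z.im : ℂ)) z :=
    (Complex.ofRealCLM ∘L Complex.imCLM).analyticAt z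
  have h1 := analyticAt_tsum_mul (U := {w : ℂ | z.im / 2 < w.im}) (V := {w : ℂ | z.im / 2 < w.re})
    (a := fun n w => conj (c (n + 1)) * q w ^ (n + 1) * (ρ ^ (n + 1) : ℝ))
    (b := fun n w => (σ ^ (n + 1) : ℝ) * laplaceInv ((n + 1 : ℕ) : ℝ) w)
    (u := fun n => ‖c (n + 1)‖ * σ ^ (n + 1))
    (v := fun n => σ ^ (n + 1) * (z.im / 2)⁻¹)
    (isOpen_lt_im _) (isOpen_lt continuous_const Complex.continuous_re)
    ((summable_nat_add_iff 1).2 (hc σ hσ0.le hσ1))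
    (((summable_nat_add_iff 1).2 (summable_geometric_of_lt_one hσ0.le hσ1)).mul_right _)
    (fun n w _ => ((((hasDerivAt_q w).differentiableAt.pow (n + 1)).const_mul _).mul_const
      _).differentiableWithinAt)
    (fun n w hw => ((differentiableAt_laplaceInv (by positivity)
      (hy.trans hw)).const_mul _).differentiableWithinAt)
    (fun n w hw => by
      rw [norm_mul, norm_mul, RCLike.norm_conj, norm_pow, Complex.norm_real,
        norm_of_nonneg (by positivity), mul_assoc, ← mul_pow, ← hσρ]
      have := norm_q_le (le_of_lt hw)
      gcongr)
    (fun n w hw => by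
      rw [norm_mul, Complex.norm_real, norm_of_nonneg (by positivity)]
      have h := norm_laplaceInv_le (r := ((n + 1 : ℕ) : ℝ)) (by positivity) hy (le_of_lt hw)
      have hn : (1 : ℝ) ≤ ((n + 1 : ℕ) : ℝ) := by simp
      have h4 : (4 * π * ((n + 1 : ℕ) : ℝ))⁻¹ ≤ 1 :=
        inv_le_one_of_one_le₀ (by nlinarith [pi_gt_three])
      gcongr
      refine h.trans ?_
      calc _ ≤ 1 * (z.im / 2)⁻¹ := by gcongr
        _ = _ := one_mul _)
    hg hh (by simpa using hmem) (by simpa using hmem)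
  refine (h0.add h1).congr ?_
  filter_upwards [(isOpen_lt_im 0).mem_nhds hz] with w hw
  rw [(hc.summable_nonholTerm hw).tsum_eq_zero_add]
  simp only [Pi.add_apply]
  congr 1
  refine tsum_congr fun n => ?_
  rw [nonholTerm_succ]
  have : ((ρ ^ (n + 1) : ℝ) : ℂ) * ((σ ^ (n + 1) : ℝ) : ℂ) = 1 := by
    rw [← Complex.ofReal_mul, ← mul_pow, hρσ]
    simp
  linear_combination (conj (c (n + 1)) * q (-conj w) ^ (n + 1) *
    laplaceInv ((n + 1 : ℕ) : ℝ) w.im) * this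

lemma analyticAt_qSeries_sub (hcp : IsDiscSummable cp) (hc : IsDiscSummable c) {z : ℂ}
    (hz : 0 < z.im) :
    AnalyticAt ℝ (fun z => qSeries cp z - ∑' n, nonholTerm c n z) z := by
  have h : DifferentiableOn ℂ (qSeries cp) {z : ℂ | 0 < z.im} := fun w hw =>
    (hcp.differentiableAt hw).differentiableWithinAt
  exact ((h.analyticAt ((isOpen_lt_im 0).mem_nhds hz)).restrictScalars).sub
    (hc.analyticAt_tsum_nonholTerm hz)

/-- A real-analytic function whose `∂/∂z̄`-derivative is `i/(2y)` times the conjugate of a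
holomorphic function is harmonic of weight one. -/
lemma laplacian_eq_zero {f E : ℂ → ℂ} (hf : AnalyticOnNhd ℝ f {z : ℂ | 0 < z.im})
    (hE : ∀ z : ℂ, 0 < z.im → DifferentiableAt ℂ E z)
    (h : ∀ z : ℂ, 0 < z.im → partialZBar f z = Complex.I / (2 * z.im) * conj (E z)) {z : ℂ}
    (hz : 0 < z.im) :
    (z.im : ℂ) ^ 2 * (partialX (partialX f) z + partialY (partialY f) z) -
      Complex.I * z.im * (partialX f z + Complex.I * partialY f z) = 0 := by
  have hy : (z.im : ℂ) ≠ 0 := by exact_mod_cast hz.ne'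
  have hD := ((hf z hz).fderiv.differentiableAt).hasFDerivAt
  set D := fderiv ℝ (fderiv ℝ f) z with hDdef
  have happ : ∀ v : ℂ, HasFDerivAt (fun w => fderiv ℝ f w v)
      ((ContinuousLinearMap.apply ℝ ℂ v) ∘L D) z := fun v =>
    (ContinuousLinearMap.apply ℝ ℂ v).hasFDerivAt.comp z hD
  have hxx : partialX (partialX f) z = D 1 1 := by
    rw [partialX, show partialX f = fun w => fderiv ℝ f w 1 from rfl, (happ 1).fderiv]
    rfl
  have hyy : partialY (partialY f) z = D Complex.I Complex.I := by
    rw [partialY, show partialY f = fun w => fderiv ℝ f w Complex.I from rfl,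
      (happ Complex.I).fderiv]
    rfl
  have hsymm : D 1 Complex.I = D Complex.I 1 :=
    ((hf z hz).contDiffAt (n := 2)).isSymmSndFDerivAt (by simp) 1 Complex.I
  have hg1 := (happ 1).add ((happ Complex.I).const_mul Complex.I)
  have hev : (fun w : ℂ => Complex.I * (w.im : ℂ)⁻¹ * conj (E w)) =ᶠ[𝓝 z]
      (fun w => fderiv ℝ f w 1) + fun w => Complex.I * fderiv ℝ f w Complex.I := by
    filter_upwards [(isOpen_lt_im 0).mem_nhds hz] with w hw
    have hw' : (w.im : ℂ) ≠ 0 := by exact_mod_cast (show 0 < w.im from hw).ne'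
    have := h w hw
    rw [partialZBar, partialX, partialY, div_eq_iff two_ne_zero] at this
    rw [Pi.add_apply, this]
    field_simp
  have him : HasFDerivAt (fun w : ℂ => (w.im : ℂ)) (Complex.ofRealCLM ∘L Complex.imCLM) z :=
    (Complex.ofRealCLM ∘L Complex.imCLM).hasFDerivAt
  have hinv : HasFDerivAt (fun w : ℂ => (w.im : ℂ)⁻¹)
      ((-((z.im : ℂ) ^ 2)⁻¹) • (Complex.ofRealCLM ∘L Complex.imCLM)) z := by
    have := ((hasDerivAt_inv hy).hasFDerivAt.restrictScalars ℝ).comp z him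
    refine this.congr_fderiv ?_
    ext
    simp
    ring
  have hEr := (hE z hz).hasDerivAt.hasFDerivAt.restrictScalars ℝ
  have hEc : HasFDerivAt (fun w : ℂ => conj (E w)) _ z :=
    (Complex.conjCLE.hasFDerivAt (x := E z)).comp z hEr
  have hg2 := (hinv.const_mul Complex.I).mul hEc
  have hEq := (hg1.congr_of_eventuallyEq hev).unique hg2
  have e1 := DFunLike.congr_fun hEq 1
  have e2 := DFunLike.congr_fun hEq Complex.I
  have e3 := hev.eq_of_nhds
  rw [hxx, hyy, partialX, partialY]
  simp only [Pi.add_apply] at e3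
  rw [← e3]
  simp at e1 e2
  set Ez := conj (E z)
  set Ed := conj (deriv E z)
  have hI := Complex.I_sq
  -- The Laplacian is (∂x - i∂y)(∂x + i∂y), by symmetry of the second derivative. The inner operator
  -- gives (i/y) times the conjugate of E; the outer one annihilates that conjugate, so only 1/y is
  -- differentiated.
  have e4 : D 1 1 + D Complex.I Complex.I = -((z.im : ℂ) ^ 2)⁻¹ * Ez := by
    linear_combination e1 - Complex.I * e2 - Complex.I * hsymm + (Ez * ((z.im : ℂ) ^ 2)⁻¹ +
      D Complex.I Complex.I + Complex.I * (z.im : ℂ)⁻¹ * Ed) * hI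
  rw [e4]
  field_simp
  linear_combination (-Ez) * hI

lemma ext_eventuallyEq {F : ℍ → ℂ} {f : ℂ → ℂ} (hF : ∀ z : ℍ, F z = f z) {z : ℂ} (hz : 0 < z.im) :
    f =ᶠ[𝓝 z] ext F := by
  filter_upwards [(isOpen_lt_im 0).mem_nhds hz] with w hw
  rw [ext, UpperHalfPlane.ofComplex_apply_of_im_pos hw, hF]

/-- A function with the Fourier expansion of a harmonic Maass form of weight one is real-analytic
and harmonic, with image under `ξ` the series formed with the coefficients of the nonholomorphic
part. -/
lemma analytic_harmonic_xi {F : ℍ → ℂ} (hcp : IsDiscSummable cp) (hc : IsDiscSummable c)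
    (hF : ∀ z : ℍ, F z = qSeries cp z - ∑' n, nonholTerm c n z) :
    AnalyticOnNhd ℝ (ext F) {z : ℂ | 0 < z.im} ∧ (∀ z : ℍ, hypLaplacian 1 F z = 0) ∧
      ∀ z : ℍ, xi 1 F z = qSeries c z := by
  have hev := fun (z : ℂ) (hz : 0 < z.im) =>
    ext_eventuallyEq (f := fun z => qSeries cp z - ∑' n, nonholTerm c n z) hF hz
  have ha : AnalyticOnNhd ℝ (ext F) {z : ℂ | 0 < z.im} := fun z hz =>
    (analyticAt_qSeries_sub hcp hc hz).congr (hev z hz)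
  have hzb : ∀ z : ℂ, 0 < z.im →
      partialZBar (ext F) z = Complex.I / (2 * z.im) * conj (qSeries c z) := by
    intro z hz
    rw [← partialZBar_qSeries_sub hcp hc hz, partialZBar, partialX, partialY,
      (hev z hz).symm.fderiv_eq, partialZBar, partialX, partialY]
  refine ⟨ha, fun z => ?_, fun z => ?_⟩
  · have := laplacian_eq_zero ha (fun w hw => hc.differentiableAt hw) hzb z.im_pos
    simp only [UpperHalfPlane.coe_im] at this
    rw [hypLaplacian]
    simpa using this
  · have hy : (z.im : ℂ) ≠ 0 := by exact_mod_cast z.im_pos.ne'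
    rw [xi, hzb z z.im_pos]
    simp
    field_simp
    simp [map_ofNat]

end Harmonic

/-! ### Finite Fourier transforms of imprimitive characters -/

section GaussSums

lemma sum_range_mul {E : Type*} [AddCommMonoid E] (F : ℕ → E) (m k : ℕ) :
    ∑ a ∈ Finset.range (m * k), F a =
      ∑ s ∈ Finset.range k, ∑ r ∈ Finset.range m, F (m * s + r) := by
  induction k with
  | zero => simp
  | succ k ih => rw [mul_add, mul_one, Finset.sum_range_add, ih, Finset.sum_range_succ]

lemma sum_range_exp {k : ℕ} (hk : 0 < k) (ξ : ℤ) :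
    ∑ s ∈ Finset.range k, Complex.exp (2 * π * Complex.I * s * ξ / k) =
      if (k : ℤ) ∣ ξ then (k : ℂ) else 0 := by
  have hk' : (k : ℂ) ≠ 0 := by exact_mod_cast hk.ne'
  set w := Complex.exp (2 * π * Complex.I * (ξ / k)) with hw
  have h : ∀ s : ℕ, Complex.exp (2 * π * Complex.I * s * ξ / k) = w ^ s := fun s => by
    rw [hw, ← Complex.exp_nat_mul]
    congr 1
    ring
  simp_rw [h]
  have hwk : w ^ k = 1 := by
    rw [hw, ← Complex.exp_nat_mul, Complex.exp_eq_one_iff]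
    exact ⟨ξ, by field_simp⟩
  have hw1 : w = 1 ↔ (k : ℤ) ∣ ξ := by
    rw [hw, Complex.exp_eq_one_iff]
    constructor
    · rintro ⟨n, hn⟩
      refine ⟨n, ?_⟩
      have h2 : (2 * π * Complex.I : ℂ) ≠ 0 := Complex.two_pi_I_ne_zero
      have h3 : (ξ / k : ℂ) = n := by
        rw [mul_comm (n : ℂ)] at hn
        exact mul_left_cancel₀ h2 hn
      rw [div_eq_iff hk'] at h3
      rw [mul_comm]
      exact_mod_cast h3
    · rintro ⟨n, rfl⟩
      refine ⟨n, ?_⟩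
      push_cast
      field_simp
  split_ifs with hd
  · rw [hw1.2 hd]
    simp
  · have := mul_geom_sum w k
    rw [hwk, sub_self] at this
    exact (mul_eq_zero.1 this).resolve_left (sub_ne_zero.2 fun h => hd (hw1.1 h))

/-- The discrete Fourier transform of a periodic function, regarded as a function with a larger
period. -/
lemma periodicDFT_mul {m k : ℕ} (hm : 0 < m) (hk : 0 < k) {g : ℤ → ℂ}
    (hg : Function.Periodic g (m : ℤ)) (ξ : ℤ) :
    periodicDFT (m * k) g ξ = if (k : ℤ) ∣ ξ then k * periodicDFT m g (ξ / k) else 0 := by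
  have hk' : (k : ℂ) ≠ 0 := by exact_mod_cast hk.ne'
  have hm' : (m : ℂ) ≠ 0 := by exact_mod_cast hm.ne'
  have h : periodicDFT (m * k) g ξ = (∑ s ∈ Finset.range k,
      Complex.exp (2 * π * Complex.I * s * ξ / k)) *
        ∑ r ∈ Finset.range m, g r * Complex.exp (2 * π * Complex.I * r * ξ / (m * k : ℕ)) := by
    rw [periodicDFT, sum_range_mul, Finset.sum_mul_sum]
    refine Finset.sum_congr rfl fun s _ => Finset.sum_congr rfl fun r _ => ?_
    have h1 : g ((m * s + r : ℕ) : ℤ) = g r := by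
      have := periodic_add_mul hg r s
      rw [← this]
      congr 1
      push_cast
      ring
    rw [h1, mul_left_comm, ← Complex.exp_add]
    congr 2
    push_cast
    field_simp
  rw [h, sum_range_exp hk]
  split_ifs with hd
  · obtain ⟨n, rfl⟩ := hd
    rw [Int.mul_ediv_cancel_left _ (by exact_mod_cast hk.ne'), periodicDFT]
    congr 1
    refine Finset.sum_congr rfl fun r _ => ?_
    congr 2
    push_cast
    field_simp
  · rw [zero_mul]

lemma sum_zmod_eq_sum_range {m : ℕ} [NeZero m] (F : ZMod m → ℂ) :
    ∑ x, F x = ∑ a ∈ Finset.range m, F ((a : ℤ) : ZMod m) := by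
  symm
  refine Finset.sum_bij' (fun a _ => (a : ZMod m)) (fun j _ => j.val) ?_ ?_ ?_ ?_ ?_
  · intro a _
    exact Finset.mem_univ _
  · intro j _
    simpa using ZMod.val_lt j
  · intro a ha
    exact ZMod.val_cast_of_lt (Finset.mem_range.1 ha)
  · intro j _
    simp
  · intro a _
    simp

lemma periodicDFT_character_eq_gaussSum {m : ℕ} [NeZero m] (χ : DirichletCharacter ℂ m) (ξ : ℤ) :
    periodicDFT m (fun n => χ n) ξ = gaussSum χ (ZMod.stdAddChar.mulShift (ξ : ZMod m)) := by
  rw [gaussSum, sum_zmod_eq_sum_range, periodicDFT]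
  refine Finset.sum_congr rfl fun a _ => ?_
  rw [AddChar.mulShift_apply, ← Int.cast_mul, ZMod.stdAddChar_coe]
  congr 2
  push_cast
  ring

lemma gaussW_eq_periodicDFT {m : ℕ} [NeZero m] (χ : DirichletCharacter ℂ m) :
    gaussW χ = periodicDFT m (fun n => χ n) 1 := by
  have hm : (m : ℂ) ≠ 0 := by exact_mod_cast NeZero.ne m
  set F : ℕ → ℂ := fun n => χ (n : ZMod m) * Complex.exp (2 * π * Complex.I * n / m) with hF
  have h0 : F m = F 0 := by
    simp only [hF]
    rw [mul_div_assoc, div_self hm]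
    simp [Complex.exp_two_pi_mul_I]
  have h1 : gaussW χ = ∑ n ∈ Finset.range m, F (n + 1) := by
    rw [gaussW, Finset.range_eq_Ico, Finset.sum_Ico_add' F 0 m 1]
    rfl
  have h2 : ∑ n ∈ Finset.range m, F (n + 1) = ∑ n ∈ Finset.range m, F n := by
    have a := Finset.sum_range_succ F m
    have b := Finset.sum_range_succ' F m
    rw [b, h0] at a
    exact add_right_cancel a
  rw [h1, h2, periodicDFT]
  refine Finset.sum_congr rfl fun a _ => ?_
  simp [hF]

/-- Primitivity makes the Gauss sum separable at every frequency, including those not coprime to the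
modulus, where both sides vanish. -/
lemma periodicDFT_primitive {m : ℕ} [NeZero m] {χ : DirichletCharacter ℂ m} (hχ : χ.IsPrimitive)
    (ξ : ℤ) : periodicDFT m (fun n => χ n) ξ = conj (χ (ξ : ZMod m)) * gaussW χ := by
  rw [gaussW_eq_periodicDFT, periodicDFT_character_eq_gaussSum, periodicDFT_character_eq_gaussSum,
    gaussSum_mulShift_of_isPrimitive _ hχ, Int.cast_one, AddChar.mulShift_one, ← MulChar.star_eq_inv,
    MulChar.star_apply]
  rfl

lemma sum_moebius_divisors {n : ℕ} :
    ∑ d ∈ n.divisors, (ArithmeticFunction.moebius d : ℂ) = if n = 1 then 1 else 0 := by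
  have h := congrArg (fun f : ArithmeticFunction ℤ => f n) ArithmeticFunction.moebius_mul_coe_zeta
  simp only [ArithmeticFunction.coe_mul_zeta_apply, ArithmeticFunction.one_apply] at h
  exact_mod_cast h

variable {M : ℕ} [NeZero M] (ϱ : DirichletCharacter ℂ M)

instance : NeZero ϱ.conductor := ⟨ϱ.conductor_ne_zero⟩

lemma conductor_mul_ell {M : ℕ} (ϱ : DirichletCharacter ℂ M) : ϱ.conductor * ell ϱ = M :=
  Nat.mul_div_cancel' ϱ.conductor_dvd_level

lemma ell_pos : 0 < ell ϱ :=
  Nat.pos_of_ne_zero fun h => NeZero.ne M (by rw [← conductor_mul_ell ϱ, h, mul_zero])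

/-- The primitive character already vanishes off the units modulo the conductor, so only coprimality
to `ell ϱ` must be imposed; the Möbius sum over common divisors does this. -/
lemma character_eq_primitiveCharacter_mul {M : ℕ} (ϱ : DirichletCharacter ℂ M) (n : ℕ) :
    ϱ (n : ZMod M) = ϱ.primitiveCharacter (n : ZMod ϱ.conductor) *
      ∑ d ∈ (Nat.gcd (ell ϱ) n).divisors, (ArithmeticFunction.moebius d : ℂ) := by
  rw [sum_moebius_divisors]
  by_cases h : Nat.Coprime n M
  · have h1 : Nat.gcd (ell ϱ) n = 1 :=
      (Nat.Coprime.coprime_dvd_right (Dvd.intro_left _ (conductor_mul_ell ϱ)) h).symm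
    have h2 := ϱ.primitiveCharacter_apply_of_isCoprime (a := n) (Nat.isCoprime_iff_coprime.2 h)
    rw [if_pos h1, mul_one]
    simpa using h2.symm
  · have h0 : ϱ (n : ZMod M) = 0 := by
      have := (ϱ.apply_eq_zero_iff (n : ℤ)).2 (by rwa [Nat.isCoprime_iff_coprime])
      simpa using this
    rw [h0]
    split_ifs with h1
    · have h3 : ¬ Nat.Coprime n ϱ.conductor := fun h4 => h (by
        rw [← conductor_mul_ell ϱ]
        exact Nat.Coprime.mul_right h4 (Nat.Coprime.symm h1))
      have := (ϱ.primitiveCharacter.apply_eq_zero_iff (n : ℤ)).2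
        (by rwa [Nat.isCoprime_iff_coprime])
      rw [mul_one]
      simpa using this.symm
    · rw [mul_zero]

lemma sum_range_filter_dvd {E : Type*} [AddCommMonoid E] {d K : ℕ} (hd : 0 < d) (F : ℕ → E) :
    ∑ a ∈ Finset.range (d * K), (if d ∣ a then F a else 0) =
      ∑ b ∈ Finset.range K, F (d * b) := by
  rw [sum_range_mul]
  refine Finset.sum_congr rfl fun s _ => ?_
  rw [Finset.sum_eq_single 0]
  · simp
  · intro r hr hr0
    rw [if_neg]
    rw [Nat.dvd_add_right (Dvd.intro s rfl)]
    exact fun h => absurd (Nat.le_of_dvd (Nat.pos_of_ne_zero hr0) h)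
      (not_le.2 (Finset.mem_range.1 hr))
  · intro h
    exact absurd (Finset.mem_range.2 hd) h

/-- The discrete Fourier transform of an arbitrary Dirichlet character in terms of the Gauss sum
of the underlying primitive character. -/
lemma periodicDFT_character (ξ : ℕ) :
    periodicDFT M (fun n => ϱ n) ξ = gaussW ϱ.primitiveCharacter *
      ∑ d ∈ (Nat.gcd (ell ϱ) ξ).divisors, (d : ℂ) *
        (ArithmeticFunction.moebius (ell ϱ / d) : ℂ) *
        ϱ.primitiveCharacter ((ell ϱ / d : ℕ) : ZMod ϱ.conductor) *
        conj (ϱ.primitiveCharacter ((ξ / d : ℕ) : ZMod ϱ.conductor)) := by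
  set m := ϱ.conductor with hm
  set l := ell ϱ with hl
  set χ := ϱ.primitiveCharacter with hχ
  have hml : m * l = M := conductor_mul_ell ϱ
  have hl0 : 0 < l := ell_pos ϱ
  have hm0 : 0 < m := Nat.pos_of_ne_zero ϱ.conductor_ne_zero
  have hgcd : ∀ n : ℕ, (Nat.gcd l n).divisors = l.divisors.filter (· ∣ n) := by
    intro n
    ext d
    simp [Nat.mem_divisors, Nat.dvd_gcd_iff, hl0.ne', Nat.gcd_eq_zero_iff]
  -- Expand ϱ by Möbius and write a = db. The inner sum is the transform of the primitive character
  -- over the period m(l/d), which by `periodicDFT_mul` vanishes unless l/d divides ξ. The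
  -- complementary divisor l/d then becomes the summation index.
  have h1 : periodicDFT M (fun n => ϱ n) ξ = ∑ d ∈ l.divisors,
      (ArithmeticFunction.moebius d : ℂ) * χ (d : ZMod m) *
        periodicDFT (m * (l / d)) (fun n => χ n) ξ := by
    have e1 : ∀ a ∈ Finset.range M, ϱ ((a : ℤ) : ZMod M) *
        Complex.exp (2 * π * Complex.I * a * (ξ : ℤ) / M) =
        ∑ d ∈ l.divisors, if d ∣ a then (ArithmeticFunction.moebius d : ℂ) * (χ (a : ZMod m) *
          Complex.exp (2 * π * Complex.I * a * (ξ : ℤ) / M)) else 0 := by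
      intro a _
      rw [Int.cast_natCast, character_eq_primitiveCharacter_mul, hgcd, ← Finset.sum_filter,
        ← Finset.sum_mul]
      ring
    rw [periodicDFT, Finset.sum_congr rfl e1, Finset.sum_comm]
    refine Finset.sum_congr rfl fun d hd => ?_
    obtain ⟨k, hk⟩ := Nat.dvd_of_mem_divisors hd
    have hd0 : 0 < d := Nat.pos_of_mem_divisors hd
    have hkd : l / d = k := by rw [hk, Nat.mul_div_cancel_left _ hd0]
    have hMd : M = d * (m * k) := by rw [← hml, hk]; ring
    have hk0 : 0 < k := Nat.pos_of_ne_zero fun h => by rw [h, mul_zero] at hk; omega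
    rw [hkd]
    have e2 := sum_range_filter_dvd (K := m * k) hd0 (fun a => (ArithmeticFunction.moebius d : ℂ) *
      (χ (a : ZMod m) * Complex.exp (2 * π * Complex.I * a * (ξ : ℤ) / M)))
    rw [← hMd] at e2
    rw [e2, periodicDFT, Finset.mul_sum]
    refine Finset.sum_congr rfl fun b _ => ?_
    have hMc : (M : ℂ) = d * (m * k : ℕ) := by exact_mod_cast hMd
    have hdc : (d : ℂ) ≠ 0 := by exact_mod_cast hd0.ne'
    rw [Nat.cast_mul, map_mul, hMc, Int.cast_natCast (R := ZMod m),
      show (2 * π * Complex.I * ((d * b : ℕ) : ℂ) * (ξ : ℤ) / (d * (m * k : ℕ)) : ℂ) =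
        2 * π * Complex.I * b * (ξ : ℤ) / (m * k : ℕ) by
        rw [Nat.cast_mul, ← mul_div_mul_left (2 * π * Complex.I * b * (ξ : ℤ) : ℂ) _ hdc]
        congr 1
        ring]
    ring
  rw [h1, ← Nat.sum_div_divisors, hgcd, Finset.sum_filter, Finset.mul_sum]
  refine Finset.sum_congr rfl fun d hd => ?_
  have hdl := Nat.dvd_of_mem_divisors hd
  have hd0 : 0 < d := Nat.pos_of_mem_divisors hd
  rw [Nat.div_div_self hdl hl0.ne', periodicDFT_mul hm0 hd0 (periodic_character χ)]
  simp only [Int.natCast_dvd_natCast]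
  split_ifs with h
  · rw [← Int.natCast_div, periodicDFT_primitive ϱ.primitiveCharacter_isPrimitive, Int.cast_natCast]
    ring
  · simp

/-- The conductors of ϱ and of its conjugate are equal but not definitionally so; comparing values
at natural numbers avoids transporting characters along this equality. -/
lemma primitiveCharacter_apply_congr {M k₁ k₂ : ℕ} [NeZero M] (h : k₁ = k₂)
    {χ₁ : DirichletCharacter ℂ k₁} {χ₂ : DirichletCharacter ℂ k₂} (h₁ : k₁ ∣ M) (h₂ : k₂ ∣ M)
    (he : DirichletCharacter.changeLevel h₁ χ₁ = DirichletCharacter.changeLevel h₂ χ₂) (n : ℕ) :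
    χ₁ (n : ZMod k₁) = χ₂ (n : ZMod k₂) := by
  subst h
  rw [DirichletCharacter.changeLevel_injective h₁ he]

lemma conductor_star {M : ℕ} (ϱ : DirichletCharacter ℂ M) : (star ϱ).conductor = ϱ.conductor := by
  rw [MulChar.star_eq_inv, DirichletCharacter.conductor_inv]

lemma ell_star {M : ℕ} (ϱ : DirichletCharacter ℂ M) : ell (star ϱ) = ell ϱ := by rw [ell, ell, conductor_star]

lemma primitiveCharacter_star_apply (n : ℕ) :
    (star ϱ).primitiveCharacter (n : ZMod (star ϱ).conductor) =
      conj (ϱ.primitiveCharacter (n : ZMod ϱ.conductor)) := by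
  rw [primitiveCharacter_apply_congr (conductor_star ϱ) (star ϱ).conductor_dvd_level
    ϱ.conductor_dvd_level (χ₂ := star ϱ.primitiveCharacter), MulChar.star_apply]
  · rfl
  · rw [DirichletCharacter.changeLevel_primitiveCharacter, MulChar.star_eq_inv, MulChar.star_eq_inv,
      map_inv, DirichletCharacter.changeLevel_primitiveCharacter]

lemma innerSum_star (c : ℕ) : innerSum (star ϱ) c = conj (innerSum ϱ c) := by
  rw [innerSum, innerSum, map_sum, ell_star]
  refine Finset.sum_congr rfl fun d _ => ?_
  rw [primitiveCharacter_star_apply, primitiveCharacter_star_apply]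
  simp

lemma periodicDFT_character_eq (ξ : ℕ) :
    periodicDFT M (fun n => ϱ n) ξ = gaussW ϱ.primitiveCharacter * innerSum (star ϱ) ξ := by
  rw [periodicDFT_character, innerSum_star, innerSum, map_sum]
  congr 1
  refine Finset.sum_congr rfl fun d _ => ?_
  simp

lemma conj_periodicDFT_star {M : ℕ} (ϱ : DirichletCharacter ℂ M) (ξ : ℤ) :
    conj (periodicDFT M (fun n => star ϱ n) ξ) = periodicDFT M (fun n => ϱ n) (-ξ) := by
  rw [periodicDFT, periodicDFT, map_sum]
  refine Finset.sum_congr rfl fun a _ => ?_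
  rw [map_mul, ← Complex.exp_conj]
  simp [map_ofNat]

lemma gaussW_primitiveCharacter_star :
    gaussW (star ϱ).primitiveCharacter = gaussW (star ϱ.primitiveCharacter) := by
  rw [gaussW, gaussW]
  refine Finset.sum_congr (by rw [conductor_star]) fun n _ => ?_
  rw [primitiveCharacter_star_apply, MulChar.star_apply, conductor_star]
  rfl

/-- Conjugation reverses the frequency and conjugates the character. Hence the negative frequencies
for ϱ carry the conjugated coefficients of the Eisenstein series. -/
lemma periodicDFT_character_neg_eq (ξ : ℕ) :
    periodicDFT M (fun n => ϱ n) (-(ξ : ℤ)) =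
      conj (gaussW (star ϱ.primitiveCharacter) * innerSum ϱ ξ) := by
  rw [← conj_periodicDFT_star, periodicDFT_character_eq, star_star, gaussW_primitiveCharacter_star]

lemma sum_range_character_one :
    periodicDFT M (fun n => (1 : DirichletCharacter ℂ M) n) 0 = M * eulerProd M := by
  have h1 : periodicDFT M (fun n => (1 : DirichletCharacter ℂ M) n) 0 =
      ∑ x : ZMod M, (1 : DirichletCharacter ℂ M) x := by
    rw [sum_zmod_eq_sum_range, periodicDFT]
    simp
  have h2 := Nat.totient_eq_mul_prod_factors M
  rw [h1, MulChar.sum_one_eq_card_units, ZMod.card_units_eq_totient, eulerProd]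
  have h3 := congrArg (fun x : ℚ => (x : ℂ)) h2
  push_cast at h3
  exact h3

lemma sum_range_character_of_ne_one (h : ϱ ≠ 1) : periodicDFT M (fun n => ϱ n) 0 = 0 := by
  have h1 : periodicDFT M (fun n => ϱ n) 0 = ∑ x : ZMod M, ϱ x := by
    rw [sum_zmod_eq_sum_range, periodicDFT]
    simp
  rw [h1, MulChar.sum_eq_zero_of_ne_one h]

end GaussSums

/-! ### The lattice function of a pair of characters and its automorphy -/

section CharLattice

variable {L M : ℕ}

/-- The function `(m, n) ↦ ψ(m / (tM)) ϱ(n)` on `ℤ²`, extended by zero to `tM ∤ m`. -/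
noncomputable def charLattice (ψ : DirichletCharacter ℂ L) (ϱ : DirichletCharacter ℂ M) (t : ℕ)
    (m n : ℤ) : ℂ :=
  if ((t * M : ℕ) : ℤ) ∣ m then ψ ((m / (t * M : ℕ) : ℤ) : ZMod L) * ϱ n else 0

variable {ψ : DirichletCharacter ℂ L} {ϱ : DirichletCharacter ℂ M} {t : ℕ}

lemma charLattice_mul (hK : 0 < t * M) (m n : ℤ) :
    charLattice ψ ϱ t ((t * M : ℕ) * m) n = ψ (m : ZMod L) * ϱ n := by
  rw [charLattice, if_pos (Dvd.intro m rfl), Int.mul_ediv_cancel_left _ (by exact_mod_cast hK.ne')]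

lemma charLattice_of_not_dvd {m : ℤ} (h : ¬ ((t * M : ℕ) : ℤ) ∣ m) (n : ℤ) :
    charLattice ψ ϱ t m n = 0 := if_neg h

lemma isOddPeriodic_charLattice (hK : 0 < t * M) (hparity : ψ (-1) * ϱ (-1) = -1) :
    IsOddPeriodic (t * L * M) M (charLattice ψ ϱ t) where
  odd m n := by
    by_cases h : ((t * M : ℕ) : ℤ) ∣ m
    · obtain ⟨k, rfl⟩ := h
      rw [← mul_neg, charLattice_mul hK, charLattice_mul hK, Int.cast_neg, Int.cast_neg,
        ← neg_one_mul (k : ZMod L), ← neg_one_mul (n : ZMod M), map_mul, map_mul]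
      linear_combination (ψ k * ϱ n) * hparity
    · rw [charLattice_of_not_dvd h, charLattice_of_not_dvd (by rwa [dvd_neg]), neg_zero]
  periodic_left m n := by
    have e : ((t * L * M : ℕ) : ℤ) = ((t * M : ℕ) : ℤ) * L := by
      push_cast
      ring
    by_cases h : ((t * M : ℕ) : ℤ) ∣ m
    · obtain ⟨k, rfl⟩ := h
      rw [e, ← mul_add, charLattice_mul hK, charLattice_mul hK]
      simp
    · rw [charLattice_of_not_dvd h, charLattice_of_not_dvd]
      rwa [e, dvd_add_left (Dvd.intro _ rfl)]
  periodic_right m n := by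
    simp [charLattice]

lemma IsOddPeriodic.mul_right {P N k : ℕ} {f : ℤ → ℤ → ℂ} (hf : IsOddPeriodic P N f) :
    IsOddPeriodic P (k * N) f where
  odd := hf.odd
  periodic_left := hf.periodic_left
  periodic_right m n := by
    have := periodic_add_mul (hf.periodic_right m) n k
    rw [← this]
    push_cast
    rw [mul_comm]

lemma IsOddPeriodic.latticeAct {N : ℕ} {f : ℤ → ℤ → ℂ} (hf : IsOddPeriodic N N f) (γ : SL(2, ℤ)) :
    IsOddPeriodic N N (latticeAct f γ) := by
  have hl : ∀ m n k : ℤ, f (m + N * k) n = f m n := fun m n k =>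
    periodic_add_mul (g := fun m => f m n) (fun m => hf.periodic_left m n) m k
  have hr : ∀ m n k : ℤ, f m (n + N * k) = f m n := fun m n k =>
    periodic_add_mul (hf.periodic_right m) n k
  refine ⟨fun m n => ?_, fun m n => ?_, fun m n => ?_⟩
  · rw [MockModular.latticeAct, MockModular.latticeAct, ← hf.odd]
    congr 1 <;> ring
  · rw [MockModular.latticeAct, MockModular.latticeAct, ← hl (m * γ 1 1 - n * γ 1 0) _ (γ 1 1),
      ← hr _ (n * γ 0 0 - m * γ 0 1) (-γ 0 1)]
    congr 1 <;> ring
  · rw [MockModular.latticeAct, MockModular.latticeAct, ← hl (m * γ 1 1 - n * γ 1 0) _ (-γ 1 0),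
      ← hr _ (n * γ 0 0 - m * γ 0 1) (γ 0 0)]
    congr 1 <;> ring

lemma thetaLift_const_mul (a b k : ℂ) (f : ℤ → ℤ → ℂ) (z : ℍ) :
    thetaLift a b (fun m n => k * f m n) z = k * thetaLift a b f z := by
  rw [thetaLift, thetaLift, ← integral_const_mul]
  congr 1
  ext τ
  rw [latticeTheta, latticeTheta, mul_left_comm, ← tsum_mul_left (a := k)]
  congr 2
  ext p
  ring

/-- Since tLM divides the lower left entry c of γ, with a, d its diagonal entries, d is prime to tM
and md - nc is divisible by tM exactly when m is. The quotient is then (m/(tM))d modulo L, and the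
second argument is na modulo M. -/
lemma latticeAct_charLattice (hK : 0 < t * M) (γ : SL(2, ℤ))
    (hγ : γ ∈ CongruenceSubgroup.Gamma0 (t * L * M)) (m n : ℤ) :
    latticeAct (charLattice ψ ϱ t) γ m n =
      ψ ((γ 1 1 : ℤ) : ZMod L) * ϱ ((γ 0 0 : ℤ) : ZMod M) * charLattice ψ ϱ t m n := by
  obtain ⟨c, hc⟩ := (ZMod.intCast_zmod_eq_zero_iff_dvd _ _).1 (CongruenceSubgroup.Gamma0_mem.1 hγ)
  have hdet := γ.det_coe
  rw [Matrix.det_fin_two, hc] at hdet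
  have hcop : IsCoprime ((t * M : ℕ) : ℤ) (γ 1 1) := by
    refine ⟨-(γ 0 1 * L * c), γ 0 0, ?_⟩
    push_cast at hdet ⊢
    linear_combination hdet
  rw [latticeAct, hc]
  by_cases h : ((t * M : ℕ) : ℤ) ∣ m
  · obtain ⟨k, rfl⟩ := h
    rw [show ((t * M : ℕ) : ℤ) * k * γ 1 1 - n * ((t * L * M : ℕ) * c) =
        (t * M : ℕ) * (k * γ 1 1 - n * (L * c)) by push_cast; ring,
      charLattice_mul hK, charLattice_mul hK]
    have h1 : ((k * γ 1 1 - n * (L * c) : ℤ) : ZMod L) = k * ((γ 1 1 : ℤ) : ZMod L) := by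
      simp
    have h2 : ((n * γ 0 0 - (t * M : ℕ) * k * γ 0 1 : ℤ) : ZMod M) =
        n * ((γ 0 0 : ℤ) : ZMod M) := by
      simp
    rw [h1, h2, map_mul, map_mul]
    ring
  · rw [charLattice_of_not_dvd h, charLattice_of_not_dvd, mul_zero]
    intro h'
    have h3 : ((t * M : ℕ) : ℤ) ∣ m * γ 1 1 := by
      have : ((t * M : ℕ) : ℤ) ∣ n * ((t * L * M : ℕ) * c) := ⟨n * L * c, by push_cast; ring⟩
      simpa using dvd_add h' this
    exact h (hcop.dvd_of_dvd_mul_right h3)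

/-- The determinant condition gives ad ≡ 1 modulo M, so ϱ(a) is the conjugate of ϱ(d). -/
lemma star_prodChar_apply [NeZero L] [NeZero M] (γ : SL(2, ℤ))
    (hγ : γ ∈ CongruenceSubgroup.Gamma0 (t * L * M)) :
    star (prodChar ψ ϱ t) ((γ 1 1 : ℤ) : ZMod (t * L * M)) =
      star ψ ((γ 1 1 : ℤ) : ZMod L) * ϱ ((γ 0 0 : ℤ) : ZMod M) := by
  obtain ⟨c, hc⟩ := (ZMod.intCast_zmod_eq_zero_iff_dvd _ _).1 (CongruenceSubgroup.Gamma0_mem.1 hγ)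
  have hdet := γ.det_coe
  rw [Matrix.det_fin_two, hc] at hdet
  have hcop : IsCoprime (γ 1 1) ((t * L * M : ℕ) : ℤ) :=
    ⟨γ 0 0, -(γ 0 1 * c), by linear_combination hdet⟩
  have hone : ϱ ((γ 0 0 : ℤ) : ZMod M) * ϱ ((γ 1 1 : ℤ) : ZMod M) = 1 := by
    rw [← map_mul, ← Int.cast_mul, ← map_one ϱ]
    congr 1
    have : γ 0 0 * γ 1 1 = 1 + (M : ℤ) * (γ 0 1 * t * L * c) := by
      push_cast at hdet
      linear_combination hdet
    rw [this]
    simp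
  have hϱ : ϱ ((γ 0 0 : ℤ) : ZMod M) = star ϱ ((γ 1 1 : ℤ) : ZMod M) := by
    rw [MulChar.star_eq_inv, MulChar.inv_apply_eq_inv']
    exact eq_inv_of_mul_eq_one_left hone
  rw [hϱ, MulChar.star_apply, MulChar.star_apply, MulChar.star_apply, prodChar, MulChar.mul_apply,
    DirichletCharacter.changeLevel_eq_cast_of_dvd' _ _ hcop,
    DirichletCharacter.changeLevel_eq_cast_of_dvd' _ _ hcop, star_mul']

lemma slash_thetaLift (a b : ℂ) (f : ℤ → ℤ → ℂ) (γ : SL(2, ℤ)) :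
    (thetaLift a b f) ∣[(1 : ℤ)] γ = thetaLift a b (latticeAct f γ) := by
  ext z
  rw [ModularForm.SL_slash_apply, ModularGroup.denom_apply, thetaLift_smul, zpow_neg, zpow_one]
  field_simp [denom_ne_zero' γ z]

lemma isBigO_slash_thetaLift {N : ℕ} {f : ℤ → ℤ → ℂ} (hf : IsOddPeriodic N N f) (hN : 0 < N)
    (a b : ℂ) (γ : SL(2, ℤ)) :
    ((thetaLift a b f) ∣[(1 : ℤ)] γ) =O[UpperHalfPlane.atImInfty]
      fun z : ℍ => exp (1 * z.im) := by
  obtain ⟨K, hK⟩ := exists_norm_thetaLift_le (hf.latticeAct γ) hN hN a b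
  rw [slash_thetaLift]
  refine Asymptotics.IsBigO.of_bound (|K| + ‖b‖ * |K|) ?_
  have hmem : {z : ℍ | 1 ≤ z.im} ∈ UpperHalfPlane.atImInfty :=
    (UpperHalfPlane.atImInfty_mem _).2 ⟨1, fun z hz => hz⟩
  filter_upwards [hmem] with z hz
  have hz' : 1 ≤ z.im := hz
  have h1 : log z.im ≤ exp z.im := by
    linarith [log_le_sub_one_of_pos z.im_pos, add_one_le_exp z.im]
  have h2 : 1 ≤ exp z.im := one_le_exp z.im_pos.le
  have h3 := log_nonneg hz'
  rw [one_mul, norm_of_nonneg (exp_pos _).le]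
  calc _ ≤ K + ‖b‖ * K * log z.im := hK z hz'
    _ ≤ |K| * exp z.im + ‖b‖ * |K| * exp z.im := by
      gcongr
      · exact (le_abs_self K).trans (le_mul_of_one_le_right (abs_nonneg K) h2)
      · exact le_abs_self K
    _ = _ := by ring

lemma isBoundedAtImInfty_slash_thetaLift {N : ℕ} {f : ℤ → ℤ → ℂ} (hf : IsOddPeriodic N N f)
    (hN : 0 < N) (a : ℂ) (γ : SL(2, ℤ)) :
    UpperHalfPlane.IsBoundedAtImInfty ((thetaLift a 0 f) ∣[(1 : ℤ)] γ) := by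
  obtain ⟨K, hK⟩ := exists_norm_thetaLift_le (hf.latticeAct γ) hN hN a 0
  rw [slash_thetaLift, UpperHalfPlane.isBoundedAtImInfty_iff]
  exact ⟨K, 1, fun z hz => by simpa using hK z hz⟩

end CharLattice

/-! ### From double sums to power series in q -/

section Regroup

/-- Grouping a sum over pairs of positive integers according to `t` times their product. -/
lemma hasSum_regroup {A : ℕ → ℕ → ℂ} {S : ℂ} (h : HasSum (fun p : ℕ+ × ℕ+ => A p.1 p.2) S) {t : ℕ}
    (ht : 0 < t) :
    HasSum (fun k : ℕ => if k = 0 then 0 else if t ∣ k then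
      ∑ c ∈ (k / t).divisors, A (k / t / c) c else 0) S := by
  have h1 := (sigmaAntidiagonalEquivProd.hasSum_iff).2 h
  have h2 : HasSum (fun n : ℕ+ => ∑ c ∈ (n : ℕ).divisors, A (n / c) c) S := by
    refine h1.sigma fun n => ?_
    rw [← Nat.sum_divisorsAntidiagonal' (f := A), ← Finset.sum_coe_sort]
    exact hasSum_fintype _
  have hinj : Function.Injective fun n : ℕ+ => t * (n : ℕ) := fun m n hmn =>
    PNat.coe_injective (Nat.eq_of_mul_eq_mul_left ht hmn)
  rw [← hinj.hasSum_iff]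
  · convert h2 using 2 with n
    have hn : (n : ℕ) ≠ 0 := n.ne_zero
    simp [ht.ne', Nat.mul_div_cancel_left _ ht]
  · intro k hk
    split_ifs with h0 hd
    · rfl
    · obtain ⟨n, rfl⟩ := hd
      exact absurd ⟨⟨n, Nat.pos_of_ne_zero fun h => h0 (by rw [h, mul_zero])⟩, rfl⟩ hk
    · rfl

lemma hasSum_ite_zero {g : ℕ → ℂ} {S : ℂ} (h : HasSum (fun k => if k = 0 then 0 else g k) S)
    (x : ℂ) : HasSum (fun k => if k = 0 then x else g k) (x + S) := by
  convert (hasSum_ite_eq 0 x).add h using 2 with k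
  split_ifs <;> simp

/-- Convergence at all points of the upper half-plane implies absolute convergence on the disc. -/
lemma isDiscSummable_of_summable {c : ℕ → ℂ} (h : ∀ z : ℍ, Summable fun k => c k * q z ^ k) :
    IsDiscSummable c := by
  have hpos : ∀ r : ℝ, 0 < r → r < 1 → Summable fun n => ‖c n‖ * r ^ n := by
    intro r hr hr1
    have hpi := pi_pos
    have hy : 0 < -log r / (2 * π) := div_pos (by linarith [log_neg hr hr1]) (by positivity)
    -- The point on the imaginary axis at which |q| = r; summability in ℂ is absolute, so norms may
    -- be taken.
    have h1 := (h ⟨Complex.I * (-log r / (2 * π) : ℝ), by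
      rw [Complex.mul_im, Complex.I_re, Complex.I_im, Complex.ofReal_re]
      simpa only [zero_mul, zero_add, one_mul] using hy⟩).norm
    refine h1.congr fun n => ?_
    rw [norm_mul, norm_pow, norm_q]
    congr 2
    simp only [Complex.mul_im, Complex.I_re, Complex.I_im, Complex.ofReal_im, Complex.ofReal_re]
    rw [show -(2 * π * (0 * 0 + 1 * (-log r / (2 * π)))) = log r by field_simp; ring, exp_log hr]
  intro r hr hr1
  rcases hr.eq_or_lt with rfl | hr
  · refine Summable.of_nonneg_of_le (fun n => by positivity) (fun n => ?_)
      (hpos (1 / 2) (by norm_num) (by norm_num))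
    gcongr
    norm_num
  · exact hpos r hr hr1

end Regroup

/-! ### The expansion for a pair of characters -/

section Expansion

variable {L M : ℕ} {ψ : DirichletCharacter ℂ L} {ϱ : DirichletCharacter ℂ M} {t : ℕ}

lemma periodicDFT_charLattice_mul (hK : 0 < t * M) (m ξ : ℤ) :
    periodicDFT M (charLattice ψ ϱ t ((t * M : ℕ) * m)) ξ =
      ψ (m : ZMod L) * periodicDFT M (fun n => ϱ n) ξ := by
  rw [periodicDFT, periodicDFT, Finset.mul_sum]
  refine Finset.sum_congr rfl fun a _ => ?_
  rw [charLattice_mul hK, mul_assoc]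

lemma periodicDFT_charLattice_of_not_dvd {m : ℤ} (h : ¬ ((t * M : ℕ) : ℤ) ∣ m) (ξ : ℤ) :
    periodicDFT M (charLattice ψ ϱ t m) ξ = 0 := by
  rw [periodicDFT]
  refine Finset.sum_eq_zero fun a _ => ?_
  rw [charLattice_of_not_dvd h, zero_mul]

/-- Multiplication of the first entry of a pair of positive integers by a constant. -/
def scaleFst {K : ℕ} (hK : 0 < K) (p : ℕ+ × ℕ+) : ℕ+ × ℕ+ := (K.toPNat hK * p.1, p.2)

lemma coe_scaleFst_fst {K : ℕ} (hK : 0 < K) (p : ℕ+ × ℕ+) :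
    ((scaleFst hK p).1 : ℕ) = K * p.1 := rfl

lemma scaleFst_snd {K : ℕ} (hK : 0 < K) (p : ℕ+ × ℕ+) : (scaleFst hK p).2 = p.2 := rfl

lemma scaleFst_injective {K : ℕ} (hK : 0 < K) : Function.Injective (scaleFst hK) := by
  intro p p' h
  have h1 : K * (p.1 : ℕ) = K * p'.1 := congrArg (fun p : ℕ+ × ℕ+ => (p.1 : ℕ)) h
  have h2 : (scaleFst hK p).2 = (scaleFst hK p').2 := congrArg Prod.snd h
  exact Prod.ext (PNat.coe_injective (Nat.eq_of_mul_eq_mul_left hK h1)) h2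

lemma not_dvd_of_not_mem_range_scaleFst {K : ℕ} (hK : 0 < K) {p : ℕ+ × ℕ+}
    (hp : p ∉ range (scaleFst hK)) : ¬ (K : ℤ) ∣ ((p.1 : ℕ) : ℤ) := by
  rw [Int.natCast_dvd_natCast]
  rintro ⟨m, hm⟩
  have hm0 : 0 < m := Nat.pos_of_ne_zero fun h => p.1.ne_zero (by rw [hm, h, mul_zero])
  exact hp ⟨(m.toPNat hm0, p.2), Prod.ext (PNat.coe_injective hm.symm) rfl⟩

lemma hasSum_scaleFst {K : ℕ} (hK : 0 < K) {F : ℕ+ × ℕ+ → ℂ} (hF : Summable F)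
    (h0 : ∀ p : ℕ+ × ℕ+, ¬ (K : ℤ) ∣ ((p.1 : ℕ) : ℤ) → F p = 0) :
    HasSum (fun p => F (scaleFst hK p)) (∑' p, F p) :=
  ((scaleFst_injective hK).hasSum_iff fun p hp =>
    h0 p (not_dvd_of_not_mem_range_scaleFst hK hp)).2 hF.hasSum

/-- Only rows m = tM m' contribute. The M in the row cancels the one in the frequency ξ/M, which
leaves the integral exponent t m'ξ; this is the purpose of the dilation by M. -/
lemma posTerm_scaleFst (hK : 0 < t * M) (hM : 0 < M) (a b : ℂ) (z : ℍ) (p : ℕ+ × ℕ+) :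
    posTerm a b M (charLattice ψ ϱ t) z (scaleFst hK p) =
      ψ ((p.1 : ℕ) : ZMod L) * periodicDFT M (fun n => ϱ n) (p.2 : ℕ) *
        (a + b * (log ((p.2 : ℕ) / (M * (t * M * (p.1 : ℕ)))) : ℝ)) *
        q z ^ (t * ((p.1 : ℕ) * (p.2 : ℕ))) := by
  have hMc : (M : ℂ) ≠ 0 := by exact_mod_cast hM.ne'
  have h := periodicDFT_charLattice_mul (ψ := ψ) (ϱ := ϱ) hK ((p.1 : ℕ) : ℤ) ((p.2 : ℕ) : ℤ)
  rw [posTerm, coe_scaleFst_fst, scaleFst_snd, Nat.cast_mul (α := ℤ) (t * M), h, Int.cast_natCast, q,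
    ← Complex.exp_nat_mul]
  congr 2
  · push_cast
    rfl
  · push_cast
    field_simp

lemma negTerm_scaleFst (hK : 0 < t * M) (hM : 0 < M) (z : ℍ) (p : ℕ+ × ℕ+) :
    negTerm M (charLattice ψ ϱ t) z (scaleFst hK p) =
      ψ ((p.1 : ℕ) : ZMod L) * periodicDFT M (fun n => ϱ n) (-((p.2 : ℕ) : ℤ)) *
        expIntegral ((t * ((p.1 : ℕ) * (p.2 : ℕ)) : ℕ) : ℝ) z.im *
        q z ^ (-((t * ((p.1 : ℕ) * (p.2 : ℕ)) : ℕ) : ℤ)) := by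
  have hMc : (M : ℂ) ≠ 0 := by exact_mod_cast hM.ne'
  have hMr : (M : ℝ) ≠ 0 := by exact_mod_cast hM.ne'
  have h := periodicDFT_charLattice_mul (ψ := ψ) (ϱ := ϱ) hK ((p.1 : ℕ) : ℤ) (-((p.2 : ℕ) : ℤ))
  rw [negTerm, coe_scaleFst_fst, scaleFst_snd, Nat.cast_mul (α := ℤ) (t * M), h, Int.cast_natCast, q,
    ← Complex.exp_int_mul]
  congr 3
  · congr 1
    push_cast
    field_simp
  · push_cast
    field_simp

/-- The Fourier expansion of the theta integral of `charLattice`. -/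
lemma thetaLift_charLattice (hM : 0 < M) (hL : 0 < L) (ht : 0 < t)
    (hparity : ψ (-1) * ϱ (-1) = -1) (a b : ℂ) (z : ℍ) :
    ∃ S T : ℂ,
      HasSum (fun k : ℕ => (if k = 0 then 0 else if t ∣ k then ∑ c ∈ (k / t).divisors,
        ψ ((k / t / c : ℕ) : ZMod L) * periodicDFT M (fun n => ϱ n) c *
          (a + b * (2 * log c - log (M ^ 2) - log k : ℝ)) else 0) * q z ^ k) S ∧
      HasSum (fun k : ℕ => b * (if k = 0 then 0 else if t ∣ k then ∑ c ∈ (k / t).divisors,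
        ψ ((k / t / c : ℕ) : ZMod L) * periodicDFT M (fun n => ϱ n) (-(c : ℤ)) else 0) *
          expIntegral k z.im * q z ^ (-(k : ℤ))) T ∧
      thetaLift a b (charLattice ψ ϱ t) z =
        liftConst a b M (charLattice ψ ϱ t) z.im - 4 * Complex.I / M * (S + T) := by
  have hK : 0 < t * M := Nat.mul_pos ht hM
  obtain ⟨h1, h2, h3⟩ := thetaLift_eq (isOddPeriodic_charLattice hK hparity)
    (Nat.mul_pos (Nat.mul_pos ht hL) hM) hM a b z
  have p1 := hasSum_scaleFst hK h1 fun p hp => by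
    rw [posTerm, periodicDFT_charLattice_of_not_dvd hp, zero_mul, zero_mul]
  have p2 := hasSum_scaleFst hK h2 fun p hp => by
    rw [negTerm, periodicDFT_charLattice_of_not_dvd hp, zero_mul, zero_mul, mul_zero]
  simp only [posTerm_scaleFst hK hM] at p1
  simp only [negTerm_scaleFst hK hM] at p2
  refine ⟨_, _, ?_, ?_, h3⟩
  · convert hasSum_regroup (A := fun m ξ : ℕ => ψ (m : ZMod L) *
      periodicDFT M (fun n => ϱ n) ξ * (a + b * (log (ξ / (M * (t * M * m))) : ℝ)) *
        q z ^ (t * (m * ξ))) p1 ht using 2 with k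
    split_ifs with h0 hd
    · rw [zero_mul]
    · obtain ⟨n, rfl⟩ := hd
      rw [Nat.mul_div_cancel_left _ ht, Finset.sum_mul]
      refine Finset.sum_congr rfl fun c hc => ?_
      obtain ⟨m, rfl⟩ := Nat.dvd_of_mem_divisors hc
      have hc0 : 0 < c := Nat.pos_of_mem_divisors hc
      have hm0 : m ≠ 0 := by
        rintro rfl
        simp at h0
      rw [Nat.mul_div_cancel_left _ hc0, mul_comm m c]
      -- What remains is log(c/(M · tM · m)) = 2 log c - log M² - log k, where k = tcm.
      congr 5
      have h1 : (c : ℝ) ≠ 0 := by positivity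
      have h2 : (m : ℝ) ≠ 0 := by positivity
      have h3 : (M : ℝ) ≠ 0 := by positivity
      have h4 : (t : ℝ) ≠ 0 := by positivity
      push_cast
      rw [log_div h1 (by positivity), log_mul h3 (by positivity), log_mul (by positivity) h2,
        log_mul h4 h3, log_mul h4 (by positivity), log_mul h1 h2, log_pow]
      push_cast
      ring
    · rw [zero_mul]
  · convert hasSum_regroup (A := fun m ξ : ℕ => b * (ψ (m : ZMod L) *
      periodicDFT M (fun n => ϱ n) (-(ξ : ℤ)) * expIntegral ((t * (m * ξ) : ℕ) : ℝ) z.im *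
        q z ^ (-((t * (m * ξ) : ℕ) : ℤ)))) p2 ht using 2 with k
    split_ifs with h0 hd
    · rw [mul_zero, zero_mul, zero_mul]
    · obtain ⟨n, rfl⟩ := hd
      rw [Nat.mul_div_cancel_left _ ht, mul_assoc, mul_assoc, Finset.sum_mul, Finset.mul_sum]
      refine Finset.sum_congr rfl fun c hc => ?_
      obtain ⟨m, rfl⟩ := Nat.dvd_of_mem_divisors hc
      rw [Nat.mul_div_cancel_left _ (Nat.pos_of_mem_divisors hc), mul_comm m c]
      ring
    · rw [mul_zero, zero_mul, zero_mul]

end Expansion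

/-! ### Conjugation and dilation of the constant terms -/

section Constants

variable {N : ℕ} {g : ℤ → ℂ}

lemma oddTheta_const_mul (k : ℂ) (g : ℤ → ℂ) (τ : ℝ) :
    oddTheta (fun n => k * g n) τ = k * oddTheta g τ := by
  rw [oddTheta, oddTheta, ← tsum_mul_left]
  exact tsum_congr fun n => by ring

lemma mellin_oddTheta_const_mul (k : ℂ) (g : ℤ → ℂ) (s : ℂ) :
    mellin (oddTheta fun n => k * g n) s = k * mellin (oddTheta g) s := by
  rw [← smul_eq_mul, ← mellin_const_smul]
  congr 1
  ext τ
  rw [oddTheta_const_mul, smul_eq_mul]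

lemma logMellin_const_mul (k : ℂ) (g : ℤ → ℂ) (s : ℂ) :
    logMellin (fun n => k * g n) s = k * logMellin g s := by
  rw [logMellin, logMellin, ← smul_eq_mul, ← mellin_const_smul]
  congr 1
  ext τ
  rw [oddTheta_const_mul, smul_eq_mul, mul_smul_comm]

lemma conj_oddTheta (g : ℤ → ℂ) (τ : ℝ) :
    conj (oddTheta g τ) = oddTheta (fun n => conj (g n)) τ := by
  rw [oddTheta, oddTheta, Complex.conj_tsum]
  exact tsum_congr fun n => by rw [map_mul, map_mul, Complex.conj_ofReal, map_intCast]

lemma conj_mellin_oddTheta (g : ℤ → ℂ) (s : ℝ) :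
    conj (mellin (oddTheta g) s) = mellin (oddTheta fun n => conj (g n)) s := by
  rw [mellin, mellin, ← integral_conj]
  refine setIntegral_congr_fun measurableSet_Ioi fun τ hτ => ?_
  have h : ((τ : ℂ) ^ ((s : ℂ) - 1)) = ((τ ^ (s - 1) : ℝ) : ℂ) := by
    rw [Complex.ofReal_cpow (le_of_lt hτ)]
    push_cast
    rfl
  simp only [smul_eq_mul, map_mul]
  rw [h, Complex.conj_ofReal, conj_oddTheta]

/-- At a real point the Mellin integral can be conjugated under the integral sign, and its value is
a nonzero real multiple of the L-value. -/
lemma conj_LFunction_one [NeZero N] {χ : DirichletCharacter ℂ N} (hχ : χ.Odd) (hχ' : (star χ).Odd) :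
    conj (DirichletCharacter.LFunction χ 1) = DirichletCharacter.LFunction (star χ) 1 := by
  have h1 := conj_mellin_oddTheta (fun n => χ n) 1
  have h2 : (fun n : ℤ => conj (χ n)) = fun n : ℤ => star χ n := by
    ext n
    simp
  rw [h2, Complex.ofReal_one, mellin_oddTheta_character_one hχ, mellin_oddTheta_character_one hχ',
    map_mul] at h1
  have hpi : (π : ℂ) ≠ 0 := by exact_mod_cast pi_ne_zero
  have h3 : conj (2 / π : ℂ) = 2 / π := by simp [map_ofNat]
  rw [h3] at h1
  exact mul_left_cancel₀ (div_ne_zero two_ne_zero hpi) h1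

lemma conj_LFunction_zero [NeZero N] {χ : DirichletCharacter ℂ N} (hχ : χ.Odd)
    (hχ' : (star χ).Odd) :
    conj (DirichletCharacter.LFunction χ 0) = DirichletCharacter.LFunction (star χ) 0 := by
  have h1 := conj_mellin_oddTheta (fun n => χ n) (1 / 2)
  have h2 : (fun n : ℤ => conj (χ n)) = fun n : ℤ => star χ n := by
    ext n
    simp
  rw [h2, show ((1 / 2 : ℝ) : ℂ) = 1 / 2 by push_cast; rfl, mellin_oddTheta_character_half hχ,
    mellin_oddTheta_character_half hχ', map_mul, map_ofNat] at h1
  exact mul_left_cancel₀ two_ne_zero h1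

/-- The function `m ↦ g(m / K)`, extended by zero to `K ∤ m`. -/
noncomputable def dilate (K : ℕ) (g : ℤ → ℂ) (m : ℤ) : ℂ := if (K : ℤ) ∣ m then g (m / K) else 0

variable {K : ℕ}

lemma dilate_mul (hK : 0 < K) (m : ℤ) : dilate K g (K * m) = g m := by
  rw [dilate, if_pos (Dvd.intro m rfl), Int.mul_ediv_cancel_left _ (by exact_mod_cast hK.ne')]

lemma oddTheta_dilate (hK : 0 < K) (τ : ℝ) :
    oddTheta (dilate K g) τ = K * oddTheta g (K ^ 2 * τ) := by
  have hinj : Function.Injective fun n : ℤ => (K : ℤ) * n :=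
    mul_right_injective₀ (by exact_mod_cast hK.ne')
  rw [oddTheta, oddTheta, ← tsum_mul_left, ← hinj.tsum_eq]
  · refine tsum_congr fun n => ?_
    rw [dilate_mul hK, show -π * ((K * n : ℤ) : ℝ) ^ 2 * τ = -π * n ^ 2 * (K ^ 2 * τ) by
      push_cast; ring]
    push_cast
    ring
  · intro m hm
    by_contra hd
    refine hm ?_
    simp only [dilate]
    rw [if_neg, zero_mul, zero_mul]
    rintro ⟨n, rfl⟩
    exact hd ⟨n, rfl⟩

lemma natCast_sq_cpow (hK : 0 < K) : ((K ^ 2 : ℝ) : ℂ) ^ (-(1 / 2 : ℂ)) = (K : ℂ)⁻¹ := by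
  have h : (K : ℝ) ^ 2 ≠ 0 := by positivity
  rw [show (-(1 / 2 : ℂ)) = ((-(1 / 2) : ℝ) : ℂ) by push_cast; rfl,
    ← Complex.ofReal_cpow (by positivity), rpow_neg (by positivity), ← sqrt_eq_rpow,
    sqrt_sq (by positivity)]
  push_cast
  rfl

/-- At s = 1/2 the factor K of `oddTheta_dilate` cancels (K²)^{-s} exactly. Only the logarithmic
version detects the dilation, through -2 log K. -/
lemma mellin_oddTheta_dilate (hK : 0 < K) :
    mellin (oddTheta (dilate K g)) (1 / 2) = mellin (oddTheta g) (1 / 2) := by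
  have hKc : (K : ℂ) ≠ 0 := by exact_mod_cast hK.ne'
  rw [show oddTheta (dilate K g) = fun τ => (K : ℂ) • oddTheta g (K ^ 2 * τ) from
      funext fun τ => oddTheta_dilate hK τ, mellin_const_smul,
    mellin_comp_mul_left _ _ (by positivity), natCast_sq_cpow hK, smul_smul, mul_inv_cancel₀ hKc,
    one_smul]

lemma logMellin_dilate (hK : 0 < K) (hN : 0 < N) (hg : Function.Periodic g (N : ℤ)) :
    logMellin (dilate K g) (1 / 2) =
      logMellin g (1 / 2) - 2 * log K * mellin (oddTheta g) (1 / 2) := by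
  have hKc : (K : ℂ) ≠ 0 := by exact_mod_cast hK.ne'
  set h : ℝ → ℂ := fun u => log u • oddTheta g u - (2 * log K : ℂ) • oddTheta g u with hh
  have h1 : logMellin (dilate K g) (1 / 2) = mellin (fun τ => (K : ℂ) • h (K ^ 2 * τ)) (1 / 2) := by
    rw [logMellin, mellin, mellin]
    refine setIntegral_congr_fun measurableSet_Ioi fun τ hτ => ?_
    have hτ' : (0 : ℝ) < τ := hτ
    have hlog : log (K ^ 2 * τ) = 2 * log K + log τ := by
      rw [log_mul (by positivity) hτ'.ne', log_pow]
      push_cast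
      rfl
    simp only [hh]
    rw [oddTheta_dilate hK, hlog]
    simp only [Complex.real_smul, smul_eq_mul]
    push_cast
    ring
  have h2 := (mellin_oddTheta_hasDerivAt hN hg (1 / 2)).1
  have h3 := (mellinConvergent_oddTheta hN hg (1 / 2)).const_smul (2 * log K : ℂ)
  rw [h1, mellin_const_smul, mellin_comp_mul_left _ _ (by positivity), natCast_sq_cpow hK, smul_smul,
    mul_inv_cancel₀ hKc, one_smul, hh, (hasMellin_sub h2 h3).2, mellin_const_smul, smul_eq_mul,
    logMellin]

variable {L M : ℕ} {ψ : DirichletCharacter ℂ L} {ϱ : DirichletCharacter ℂ M} {t : ℕ}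

lemma charLattice_zero (ψ : DirichletCharacter ℂ L) (ϱ : DirichletCharacter ℂ M) (t : ℕ) :
    charLattice ψ ϱ t 0 = fun n : ℤ => ψ 0 * ϱ n := by
  ext n
  simp [charLattice]

lemma rowSum_charLattice (hK : 0 < t * M) (ψ : DirichletCharacter ℂ L)
    (ϱ : DirichletCharacter ℂ M) :
    rowSum M (charLattice ψ ϱ t) =
      fun m => periodicDFT M (fun n => ϱ n) 0 * dilate (t * M) (fun n => ψ n) m := by
  ext m
  rw [rowSum]
  by_cases h : ((t * M : ℕ) : ℤ) ∣ m
  · obtain ⟨k, rfl⟩ := h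
    rw [periodicDFT_charLattice_mul hK, dilate_mul hK, mul_comm]
  · rw [periodicDFT_charLattice_of_not_dvd h, dilate, if_neg h, mul_zero]

end Constants

/-! ### Identification of the Fourier coefficients -/

section Coefficients

variable {L M : ℕ} {ψ : DirichletCharacter ℂ L} {ϱ : DirichletCharacter ℂ M} {t : ℕ}

lemma star_apply_neg_one (χ : DirichletCharacter ℂ M) : star χ (-1) = χ (-1) := by
  rw [MulChar.star_apply]
  rcases χ.even_or_odd with h | h
  · rw [h]
    simp
  · rw [h]
    simp

lemma odd_star {χ : DirichletCharacter ℂ M} (h : χ.Odd) : (star χ).Odd :=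
  (star_apply_neg_one χ).trans h

lemma odd_right_of_level_eq_one (hparity : ψ (-1) * ϱ (-1) = -1) (hL : L = 1) : ϱ.Odd := by
  rw [ψ.level_one' hL, MulChar.one_apply isUnit_one.neg, one_mul] at hparity
  exact hparity

lemma odd_left_of_eq_one (hparity : ψ (-1) * ϱ (-1) = -1) (hϱ : ϱ = 1) : ψ.Odd := by
  rw [hϱ, MulChar.one_apply isUnit_one.neg, mul_one] at hparity
  exact hparity

lemma star_eq_one_iff [NeZero M] : star ϱ = 1 ↔ ϱ = 1 := by
  rw [MulChar.star_eq_inv, inv_eq_one]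

lemma parity_star_left (hparity : ψ (-1) * ϱ (-1) = -1) : star ψ (-1) * ϱ (-1) = -1 := by
  rwa [star_apply_neg_one]

lemma parity_star_right (hparity : ψ (-1) * ϱ (-1) = -1) : ψ (-1) * star ϱ (-1) = -1 := by
  rwa [star_apply_neg_one]

lemma constC_of_ne [NeZero M] (hL : L ≠ 1) : constC ψ ϱ = 0 := if_neg hL

lemma constD_of_ne [NeZero L] (hϱ : ϱ ≠ 1) : constD ψ ϱ = 0 := if_neg hϱ

/-- Row 0 carries the factor ψ(0) and frequency 0 the sum of ϱ over all residues; both vanish here.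
-/
lemma liftConst_of_ne [NeZero M] (ht : 0 < t) (hL : L ≠ 1) (hϱ : ϱ ≠ 1) (a b : ℂ) (y : ℝ) :
    liftConst a b M (charLattice ψ ϱ t) y = 0 := by
  rw [liftConst, charLattice_zero, rowSum_charLattice (Nat.mul_pos ht (NeZero.pos M)),
    mellin_oddTheta_const_mul, logMellin_const_mul, mellin_oddTheta_const_mul, logMellin_const_mul,
    sum_range_character_of_ne_one ϱ hϱ, ψ.map_zero' hL]
  ring

variable [NeZero L] [NeZero M]

lemma liftConst_of_level_eq_one (hparity : ψ (-1) * ϱ (-1) = -1) (ht : 0 < t) (hL : L = 1)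
    (a b : ℂ) (y : ℝ) :
    liftConst a b M (charLattice ψ ϱ t) y =
      2 / π * ((a + b * log y) * DirichletCharacter.LFunction ϱ 1 +
        b * (2 * deriv (DirichletCharacter.LFunction ϱ) 1 -
          (log π + eulerMascheroniConstant) * DirichletCharacter.LFunction ϱ 1)) := by
  have hϱ := odd_right_of_level_eq_one hparity hL
  have h0 : ψ 0 = 1 := by
    subst hL
    rw [Subsingleton.elim (0 : ZMod 1) 1, map_one]
  rw [liftConst, charLattice_zero, rowSum_charLattice (Nat.mul_pos ht (NeZero.pos M)),
    mellin_oddTheta_const_mul, logMellin_const_mul, mellin_oddTheta_const_mul, logMellin_const_mul,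
    sum_range_character_of_ne_one ϱ (ne_one_of_odd hϱ), h0, mellin_oddTheta_character_one hϱ,
    logMellin_character_one hϱ]
  ring

/-- By parity ψ is odd, hence nontrivial, so row 0 disappears and only frequency 0 remains. The term
2 log(tM) comes from the dilation of ψ by tM. -/
lemma liftConst_of_eq_one (hparity : ψ (-1) * ϱ (-1) = -1) (ht : 0 < t) (hϱ : ϱ = 1)
    (a b : ℂ) (y : ℝ) :
    liftConst a b M (charLattice ψ ϱ t) y =
      -(2 * Complex.I * eulerProd M) * ((a - b * log y) * DirichletCharacter.LFunction ψ 0 +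
        b * (2 * deriv (DirichletCharacter.LFunction ψ) 0 -
          (log π + eulerMascheroniConstant + 2 * log 2 + 2 * log (t * M)) *
            DirichletCharacter.LFunction ψ 0)) := by
  have hψ := odd_left_of_eq_one hparity hϱ
  have hL : L ≠ 1 := fun h => ne_one_of_odd hψ (ψ.level_one' h)
  have hMc : (M : ℂ) ≠ 0 := by exact_mod_cast NeZero.ne M
  have hK := Nat.mul_pos ht (NeZero.pos M)
  subst hϱ
  rw [liftConst, charLattice_zero, rowSum_charLattice hK,
    mellin_oddTheta_const_mul, logMellin_const_mul, mellin_oddTheta_const_mul, logMellin_const_mul,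
    sum_range_character_one, ψ.map_zero' hL, mellin_oddTheta_dilate hK,
    logMellin_dilate hK (NeZero.pos L) (periodic_character ψ), mellin_oddTheta_character_half hψ,
    logMellin_character_half hψ]
  push_cast
  field_simp
  ring

/-- The Fourier coefficients of `E_1^{ψ,ϱ,t}`. -/
noncomputable def shadowCoeff (ψ : DirichletCharacter ℂ L) (ϱ : DirichletCharacter ℂ M) (t k : ℕ) :
    ℂ :=
  if k = 0 then constC ψ ϱ + constD ψ ϱ
  else if t ∣ k then
    -(2 * π * Complex.I / M) * gaussW (star ϱ.primitiveCharacter) * sigmaZero ψ ϱ (k / t)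
  else 0

lemma shadowCoeff_zero_eq_liftConst (hparity : ψ (-1) * ϱ (-1) = -1) (ht : 0 < t) (y : ℝ) :
    shadowCoeff ψ ϱ t 0 = liftConst (π / 2) 0 M (charLattice ψ (star ϱ) t) y := by
  have hpi : (π : ℂ) ≠ 0 := by exact_mod_cast pi_ne_zero
  have hp := parity_star_right hparity
  rw [shadowCoeff, if_pos rfl]
  by_cases hL : L = 1
  · have hϱ := odd_right_of_level_eq_one hparity hL
    rw [liftConst_of_level_eq_one hp ht hL, constD_of_ne (ne_one_of_odd hϱ), constC, if_pos hL]
    field_simp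
    ring
  · rw [constC_of_ne hL]
    by_cases hϱ : ϱ = 1
    · rw [liftConst_of_eq_one hp ht (star_eq_one_iff.2 hϱ), constD, if_pos hϱ]
      ring
    · rw [liftConst_of_ne ht hL (fun h => hϱ (star_eq_one_iff.1 h)), constD_of_ne hϱ, add_zero]

/-- The Eisenstein series as a theta integral. -/
lemma hasSum_shadowCoeff (hparity : ψ (-1) * ϱ (-1) = -1) (ht : 0 < t) (z : ℍ) :
    HasSum (fun k => shadowCoeff ψ ϱ t k * q z ^ k)
      (thetaLift (π / 2) 0 (charLattice ψ (star ϱ) t) z) := by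
  obtain ⟨S, T, hS, hT, h⟩ := thetaLift_charLattice (NeZero.pos M) (NeZero.pos L) ht
    (parity_star_right hparity) (π / 2) 0 z
  -- Every nonholomorphic term has the factor b = 0.
  have hT0 : T = 0 := hT.unique (by simp)
  rw [h, hT0, ← shadowCoeff_zero_eq_liftConst hparity ht, add_zero, sub_eq_add_neg, ← neg_mul]
  have h1 := hasSum_ite_zero (g := fun k => shadowCoeff ψ ϱ t k * q z ^ k)
    (S := -(4 * Complex.I / M) * S) ?_ (shadowCoeff ψ ϱ t 0)
  · convert h1 using 2 with k
    split_ifs with hk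
    · rw [hk, pow_zero, mul_one]
    · rfl
  · refine (hS.mul_left (-(4 * Complex.I / M))).congr_fun fun k => ?_
    simp only [shadowCoeff]
    split_ifs with h0 hd
    · simp
    · rw [← mul_assoc, sigmaZero, Finset.mul_sum, Finset.mul_sum]
      congr 1
      refine Finset.sum_congr rfl fun c _ => ?_
      rw [periodicDFT_character_eq, star_star, gaussW_primitiveCharacter_star]
      ring
    · simp

/-- The choice a = b(log π + γ) cancels the contribution of π^{-s} and of Euler's constant in both
special cases. What depends on y is the constant term of the shadow, conjugated, times log y, that
is, the n = 0 term with β = -log y. -/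
lemma liftConst_eq_cOnePlus (hparity : ψ (-1) * ϱ (-1) = -1) (ht : 0 < t) (y : ℝ) :
    liftConst (π / 2 * (log π + eulerMascheroniConstant)) (π / 2) M (charLattice (star ψ) ϱ t) y =
      cOnePlus ψ ϱ t 0 + conj (shadowCoeff ψ ϱ t 0) * log y := by
  have hpi : (π : ℂ) ≠ 0 := by exact_mod_cast pi_ne_zero
  have hp := parity_star_left hparity
  rw [shadowCoeff, if_pos rfl, cOnePlus, if_pos rfl]
  by_cases hL : L = 1
  · have hϱ := odd_right_of_level_eq_one hparity hL
    have hc := conj_LFunction_one (odd_star hϱ) (by rwa [star_star])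
    rw [star_star] at hc
    rw [liftConst_of_level_eq_one hp ht hL, constD_of_ne (ne_one_of_odd hϱ), constC, if_pos hL,
      if_pos hL, add_zero, hc]
    field_simp
    ring
  · rw [constC_of_ne hL, if_neg hL, zero_add]
    by_cases hϱ : ϱ = 1
    · have hψ := odd_left_of_eq_one hparity hϱ
      have hM0 : (M : ℝ) ≠ 0 := by exact_mod_cast NeZero.ne M
      have hlog : log (2 * t * M) = log 2 + log (t * M) := by
        rw [mul_assoc, log_mul two_ne_zero (by positivity)]
      have he : conj (eulerProd M) = eulerProd M := by
        rw [eulerProd, map_prod]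
        exact Finset.prod_congr rfl fun p _ => by simp
      rw [liftConst_of_eq_one hp ht hϱ, constD, if_pos hϱ, if_pos hϱ, map_mul, map_mul, he,
        conj_LFunction_zero hψ (odd_star hψ), hlog]
      simp only [map_neg, map_mul, Complex.conj_ofReal, Complex.conj_I]
      push_cast
      ring
    · rw [liftConst_of_ne ht hL hϱ, constD_of_ne hϱ, if_neg hϱ]
      simp

/-- The Fourier expansion of the harmonic Maass form with shadow `E_1^{ψ,ϱ,t}`. -/
lemma hasSum_cOnePlus (hparity : ψ (-1) * ϱ (-1) = -1) (ht : 0 < t) (z : ℍ) :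
    ∃ S T : ℂ, HasSum (fun k => cOnePlus ψ ϱ t k * q z ^ k) S ∧
      HasSum (fun k => nonholTerm (shadowCoeff ψ ϱ t) k z) T ∧
      thetaLift (π / 2 * (log π + eulerMascheroniConstant)) (π / 2)
        (charLattice (star ψ) ϱ t) z = S - T := by
  obtain ⟨S, T, hS, hT, h⟩ := thetaLift_charLattice (NeZero.pos M) (NeZero.pos L) ht
    (parity_star_left hparity) (π / 2 * (log π + eulerMascheroniConstant)) (π / 2) z
  refine ⟨cOnePlus ψ ϱ t 0 + -(4 * Complex.I / M) * S,
    -(conj (shadowCoeff ψ ϱ t 0) * log z.im) + 4 * Complex.I / M * T, ?_, ?_, ?_⟩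
  · have h1 := hasSum_ite_zero (g := fun k => cOnePlus ψ ϱ t k * q z ^ k)
      (S := -(4 * Complex.I / M) * S) ?_ (cOnePlus ψ ϱ t 0)
    · convert h1 using 2 with k
      split_ifs with hk
      · rw [hk, pow_zero, mul_one]
      · rfl
    · refine (hS.mul_left (-(4 * Complex.I / M))).congr_fun fun k => ?_
      simp only [cOnePlus]
      split_ifs with h0 hd
      · simp
      · have hM0 : (M : ℝ) ≠ 0 := by exact_mod_cast NeZero.ne M
        rw [← mul_assoc, sigmaZero, sigmaLog, Finset.mul_sum (a := (2 : ℂ)), Finset.sum_mul,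
          ← Finset.sum_add_distrib, Finset.mul_sum, Finset.mul_sum]
        congr 1
        refine Finset.sum_congr rfl fun c _ => ?_
        rw [periodicDFT_character_eq, log_div pi_ne_zero (by positivity)]
        push_cast
        ring
      · simp
  · have h1 := hasSum_ite_zero (g := fun k => nonholTerm (shadowCoeff ψ ϱ t) k z)
      (S := 4 * Complex.I / M * T) ?_ (-(conj (shadowCoeff ψ ϱ t 0) * log z.im))
    · convert h1 using 2 with k
      split_ifs with hk
      · rw [hk, nonholTerm, beta_one_zero]
        simp
      · rfl
    · refine (hT.mul_left (4 * Complex.I / M)).congr_fun fun k => ?_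
      simp only [nonholTerm, shadowCoeff]
      split_ifs with h0 hd
      · simp
      · rw [beta_one_of_ne_zero h0, ← mul_assoc, ← mul_assoc, UpperHalfPlane.coe_im, sigmaZero,
          Finset.mul_sum, map_sum, ← mul_assoc, Finset.mul_sum]
        congr 2
        refine Finset.sum_congr rfl fun c _ => ?_
        rw [periodicDFT_character_neg_eq]
        simp only [map_mul, map_neg, map_div₀, MulChar.star_apply, Complex.conj_ofReal,
          Complex.conj_I, map_ofNat, map_natCast, RCLike.star_def]
        ring
      · simp
  · rw [h, liftConst_eq_cOnePlus hparity ht]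
    ring

lemma q_natCast_mul (t : ℕ) (z : ℂ) : q (t * z) = q z ^ t := by
  rw [q, q, ← Complex.exp_nat_mul]
  congr 1
  ring

lemma qSeries_shadowCoeff (ht : 0 < t) {z : ℍ}
    (hs : Summable fun k => shadowCoeff ψ ϱ t k * q z ^ k) :
    qSeries (shadowCoeff ψ ϱ t) z = eisensteinOneT ψ ϱ t z := by
  -- Splitting off the zeroth coefficient shifts the index by one, so exponent t(n+1) sits at
  -- position t(n+1) - 1 of the remaining series.
  have hinj : Function.Injective fun n : ℕ => t * (n + 1) - 1 := by
    intro m n hmn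
    have h1 : 0 < t * (m + 1) := by positivity
    have h2 : 0 < t * (n + 1) := by positivity
    have h3 : t * (m + 1) = t * (n + 1) := by
      simp only at hmn
      omega
    exact Nat.succ_injective (Nat.eq_of_mul_eq_mul_left ht h3)
  have hsub : ∀ n : ℕ, t * (n + 1) - 1 + 1 = t * (n + 1) := fun n =>
    Nat.sub_add_cancel (by have : 0 < t * (n + 1) := by positivity
                           omega)
  rw [qSeries, hs.tsum_eq_zero_add, eisensteinOneT, eisensteinOne, ← hinj.tsum_eq]
  · rw [shadowCoeff, if_pos rfl, pow_zero, mul_one, sub_eq_add_neg, ← neg_mul, ← tsum_mul_left]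
    congr 1
    refine tsum_congr fun n => ?_
    rw [hsub, shadowCoeff, if_neg (by positivity), if_pos (Dvd.intro _ rfl),
      Nat.mul_div_cancel_left _ ht, q_natCast_mul, ← pow_mul]
    ring
  · intro k hk
    by_contra hd
    refine hk ?_
    simp only
    rw [shadowCoeff, if_neg k.succ_ne_zero, if_neg, zero_mul]
    rintro ⟨n, hn⟩
    rcases n with _ | n
    · omega
    · exact hd ⟨n, by simp only; omega⟩

end Coefficients

end MockModular

/-! ### The main theorem -/

theorem theorem1p3 {L M : ℕ} [NeZero L] [NeZero M]
    (ψ : DirichletCharacter ℂ L) (ϱ : DirichletCharacter ℂ M)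
    (hparity : ψ (-1) * ϱ (-1) = -1) (t : ℕ) (ht : 1 ≤ t) :
    (∀ z : UpperHalfPlane,
      Summable fun n : ℕ => MockModular.cOnePlus ψ ϱ t n * MockModular.q z ^ n) ∧
    MockModular.IsMockModularForm 1 (t * L * M) (star (MockModular.prodChar ψ ϱ t))
      (MockModular.mockG ψ ϱ t) (MockModular.eisensteinOneT ψ ϱ t) := by
  open MockModular in
  have hK : 0 < t * M := Nat.mul_pos ht (NeZero.pos M)
  have hN : 0 < t * L * M := Nat.mul_pos (Nat.mul_pos ht (NeZero.pos L)) (NeZero.pos M)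
  have hexp := hasSum_cOnePlus hparity ht
  have hE := hasSum_shadowCoeff hparity ht
  have hsum : ∀ z : ℍ, Summable fun n : ℕ => cOnePlus ψ ϱ t n * q z ^ n := fun z => by
    obtain ⟨S, T, hS, -, -⟩ := hexp z
    exact hS.summable
  refine ⟨hsum, thetaLift (Real.pi / 2 * (Real.log Real.pi + Real.eulerMascheroniConstant))
    (Real.pi / 2) (charLattice (star ψ) ϱ t), ?_⟩
  set F := thetaLift (Real.pi / 2 * (Real.log Real.pi + Real.eulerMascheroniConstant))
    (Real.pi / 2) (charLattice (star ψ) ϱ t) with hFdef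
  have hF : ∀ z : ℍ, F z = qSeries (cOnePlus ψ ϱ t) z -
      ∑' n, nonholTerm (shadowCoeff ψ ϱ t) n z := fun z => by
    obtain ⟨S, T, hS, hT, h⟩ := hexp z
    rw [h, qSeries, hS.tsum_eq, hT.tsum_eq]
  obtain ⟨hanalytic, hharm, hxi⟩ := analytic_harmonic_xi (isDiscSummable_of_summable hsum)
    (isDiscSummable_of_summable fun z => (hE z).summable) hF
  have hf : IsOddPeriodic (t * L * M) (t * L * M) (charLattice (star ψ) ϱ t) :=
    (isOddPeriodic_charLattice hK (parity_star_left hparity)).mul_right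
  have hf' : IsOddPeriodic (t * L * M) (t * L * M) (charLattice ψ (star ϱ) t) :=
    (isOddPeriodic_charLattice hK (parity_star_right hparity)).mul_right
  -- The image under ξ is again a theta integral, now without logarithm, so its boundedness at every
  -- cusp is the case b = 0 of the growth estimate.
  have hxiE : xi 1 F = thetaLift (Real.pi / 2) 0 (charLattice ψ (star ϱ) t) := by
    ext z
    rw [hxi, qSeries, (hE z).tsum_eq]
  refine ⟨⟨⟨hanalytic, fun γ hγ z => ?_, hharm, fun γ => ?_⟩, fun γ => ?_⟩, ?_, ?_⟩
  · rw [hFdef, thetaLift_smul, star_prodChar_apply γ hγ, zpow_one]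
    have h : latticeAct (charLattice (star ψ) ϱ t) γ = fun m n =>
        star ψ ((γ 1 1 : ℤ) : ZMod L) * ϱ ((γ 0 0 : ℤ) : ZMod M) *
          charLattice (star ψ) ϱ t m n := by
      ext m n
      exact latticeAct_charLattice hK γ hγ m n
    rw [h, thetaLift_const_mul]
    ring
  · exact ⟨1, isBigO_slash_thetaLift hf hN _ _ γ⟩
  · rw [hxiE]
    exact isBoundedAtImInfty_slash_thetaLift hf' hN _ γ
  · ext z
    rw [hxi, qSeries_shadowCoeff ht (hE z).summable]
  -- The holomorphic part has no negative powers of q, so n₀ = 0 and the coefficients are extended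
  -- to negative integers by zero.
  · refine ⟨fun n => if 0 ≤ n then cOnePlus ψ ϱ t n.toNat else 0, shadowCoeff ψ ϱ t,
      ⟨0, fun n hn => if_neg (not_le.2 hn)⟩, fun z => ?_, fun z => ?_⟩
    · rw [← Nat.cast_injective.hasSum_iff (g := fun n : ℕ => (n : ℤ))]
      · refine ((hsum z).hasSum).congr_fun fun n => ?_
        simp
      · intro n hn
        simp only
        rw [if_neg, zero_mul]
        intro h0
        exact hn ⟨n.toNat, Int.toNat_of_nonneg h0⟩
    · obtain ⟨S, T, hS, hT, h⟩ := hexp z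
      rw [mockG, hS.tsum_eq, h, sub_sub_cancel]
      exact hT
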